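/- A category is finite if it has finitely many objects and finitely many morphisms, and strongly connected if for every ordered pair of objects $x,y$ there is a morphism $x\to y$. For small categories $I,X$ let $\mathrm{Fun}(I,X)$ be the category of functors $I\to X$ and natural transformations. A functor between small categories is a weak equivalence if the induced morphism of nerves becomes a homotopy equivalence after geometric realization. Let $\mathcal M$ be a class of finite, strongly connected small categories. A functor $F:X\to Y$ between small categories is an $\mathcal M$-equivalence if $\mathrm{Fun}(I,F):\mathrm{Fun}(I,X)\to\mathrm{Fun}(I,Y)$ is a weak equivalence for every $I$ in $\mathcal M$. A functor $i:A\to B$ between small categories is a Dwyer map if it is fully faithful and injective on objects; it is a sieve, i.e. for every morphism $f:b\to i(a)$ of $B$ with $a$ in $A$, both $b$ and $f$ lie in the image of $i$; and there is a full subcategory $W$ of $B$ that contains the image of $i$, is a cosieve (for every morphism $b\to b'$ of $B$ with $b$ in $W$, also $b'$ is in $W$), and is such that the functor $A\to W$ induced by $i$ has a right adjoint. Proposition. Let $\mathcal M$ be a class of finite, strongly connected small categories. All limits and colimits are taken in the category of small categories and functors. (i) If $(f_j:X_j\to Y_j)_{j\in J}$ is a family of $\mathcal M$-equivalences indexed by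 a set $J$, then the coproduct functor $\coprod_j f_j:\coprod_j X_j\to\coprod_j Y_j$ is an $\mathcal M$-equivalence. (ii) If $(f_j:X_j\to Y_j)_{j\in J}$ is a family of $\mathcal M$-equivalences indexed by a finite set $J$, then the product functor $\prod_j f_j:\prod_j X_j\to\prod_j Y_j$ is an $\mathcal M$-equivalence. (iii) Let $f_n:Y_n\to Y_{n+1}$, $n\ge 0$, be $\mathcal M$-equivalences between small categories. Then the canonical functor $f_\infty:Y_0\to Y_\infty$ to the colimit of the sequence $(f_n)_{n\ge 0}$ is an $\mathcal M$-equivalence. (iv) Let $$\begin{array}{ccc} A & \xrightarrow{\;k\;} & C\\ {\scriptstyle i}\downarrow & & \downarrow{\scriptstyle j}\\ B & \xrightarrow{\;h\;} & D\end{array}$$ be a pushout square of small categories such that $k$ is an $\mathcal M$-equivalence. If in addition $i$ or $k$ is a Dwyer map, then $h$ is an $\mathcal M$-equivalence. -/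

import Mathlib

open CategoryTheory

universe u

/-- A morphism of simplicial sets is a weak equivalence if its geometric realization is a
homotopy equivalence of topological spaces. -/
def IsSSetWeakEquivalence {X Y : SSet.{u}} (f : X ⟶ Y) : Prop :=
  ∃ e : ContinuousMap.HomotopyEquiv (SSet.toTop.obj X) (SSet.toTop.obj Y),
    e.toFun = (SSet.toTop.map f).hom

/-- A functor between small categories is a weak equivalence if the induced morphism of
nerves is a weak equivalence of simplicial sets. -/
def IsCatWeakEquivalence {C D : Type u} [Category.{u} C] [Category.{u} D] (F : C ⥤ D) : Prop :=
  IsSSetWeakEquivalence (nerveMap F)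

/-- A category is finite if it has finitely many objects and finitely many morphisms. -/
structure IsFiniteCat (I : Type u) [Category.{u} I] : Prop where
  finite_obj : Finite I
  finite_hom : ∀ x y : I, Finite (x ⟶ y)

/-- A category is strongly connected if there is a morphism `x ⟶ y` for every ordered pair of
objects `x`, `y`. -/
def IsStronglyConnectedCat (I : Type u) [Category.{u} I] : Prop :=
  ∀ x y : I, Nonempty (x ⟶ y)

/-- The functor `Fun(I, F) : Fun(I, X) ⥤ Fun(I, Y)` given by postcomposition with `F`. -/
abbrev funCatMap (I : Type u) [Category.{u} I] {X Y : Type u} [Category.{u} X] [Category.{u} Y]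
    (F : X ⥤ Y) : (I ⥤ X) ⥤ (I ⥤ Y) :=
  (Functor.whiskeringRight I X Y).obj F

/-- A functor `F` between small categories is an `M`-equivalence, for a class `M` of small
categories, if `Fun(I, F)` is a weak equivalence of categories for every `I` in `M`. -/
def IsMEquivalence (M : ObjectProperty Cat.{u, u}) {X Y : Cat.{u, u}} (F : X ⟶ Y) : Prop :=
  ∀ I : Cat.{u, u}, M I → IsCatWeakEquivalence (funCatMap I F.toFunctor)

/-- Dwyer maps of small categories. Since `i` is fully faithful, a morphism of `B` between
objects in the image of `i` automatically lies in the image of `i`; hence the sieve condition only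
has to mention objects. The full subcategory `W` is given by the property that its objects
satisfy. -/
structure IsDwyerMap {A B : Cat.{u, u}} (i : A ⟶ B) : Prop where
  full : i.toFunctor.Full
  faithful : i.toFunctor.Faithful
  obj_injective : Function.Injective i.toFunctor.obj
  sieve : ∀ ⦃b : B⦄ ⦃a : A⦄, (b ⟶ i.toFunctor.obj a) → ∃ a' : A, i.toFunctor.obj a' = b
  exists_cosieve : ∃ W : ObjectProperty B,
    (∀ ⦃b b' : B⦄, (b ⟶ b') → W b → W b') ∧
    ∃ hW : ∀ a : A, W (i.toFunctor.obj a), (W.lift i.toFunctor hW).IsLeftAdjoint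

/-! Fix `I` in the class. Degree `n` of the nerve of `Fun(I, X)` is naturally the set `Hom(P, X)`
with `P = [n] × I` (`chainCat`, `funNerveIso`), so limits and colimits of these nerves can be tested
on the functors `Hom(P, -)`. Each of the four claims then splits in two: `Hom(P, -)` respects the
construction in question, and weak equivalences of simplicial sets are stable under it.

On the categorical side, `Hom(P, -)` preserves all limits, which serves for products. If `I` is
nonempty and strongly connected, `P` has a weakly initial object, so a functor out of `P` that
starts in a cosieve stays in it; hence `Hom(P, -)` preserves coproducts. A Dwyer map presents its
target as a collage of `A` with the full subcategory `V` of the remaining objects, glued by the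
right adjoint (`IsDwyerMap.exists_collage`). Its pushout along `k : A ⟶ C` is the collage of `C`
with the same `V` (`Collage.isPushout`). In both collages the cosieve `near` deforms onto the left
part, and the square comparing these cosieves with the collages becomes a pushout of simplicial sets
along a monomorphism (`Collage.isPushout_funNerve`). Finally, if `I` is finite then so is `P`, and
`Hom(P, -)` preserves sequential colimits: the 2-truncated nerve is fully faithful, preserves such
colimits, and sends `P` to a finite presheaf on a finite category.

On the homotopical side, realizations of monomorphisms have the homotopy extension property, because
singular simplicial sets are Kan (`SSet.hep_toTop_map`), and realizations of trivial fibrations are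
shrinkable (`SSet.isShrinkable_toTop_map`). Factoring a map as a monomorphism followed by a trivial
fibration reduces pushouts and sequential colimits to elementary gluing of spaces. For products, the
comparison from the realization of `X × Z` to the product of the realizations is a bijection, and it
handles continuity well enough to carry homotopies; this rests on a common refinement of points of
two simplices (`stdSimplex.exists_common_refinement`). -/

section

/-! ### Homotopy extension and gluing of homotopy equivalences of spaces. -/

namespace TopCat

open unitInterval

/-- A morphism in `TopCat` that is a homotopy equivalence. -/
def IsHtpyEquiv {X Y : TopCat.{u}} (f : X ⟶ Y) : Prop :=
  ∃ e : ContinuousMap.HomotopyEquiv X Y, e.toFun = f.hom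

/-- The homotopy extension property. -/
def HEP {A B : TopCat.{u}} (i : A ⟶ B) : Prop :=
  ∀ (T : TopCat.{u}) (v : C(B, T)) (H : C(A, C(I, T))), (∀ a, H a 0 = v (i a)) →
    ∃ F : C(B, C(I, T)), (∀ b, F b 0 = v b) ∧ ∀ a, F (i a) = H a

/-- Inclusions of strong deformation retracts. -/
def IsSDR {A B : TopCat.{u}} (i : A ⟶ B) : Prop :=
  ∃ r : C(B, A), (∀ a, r (i a) = a) ∧ ∃ H : C(B, C(I, B)),
    (∀ b, H b 0 = b) ∧ (∀ b, H b 1 = i (r b)) ∧ ∀ a t, H (i a) t = i a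

/-- A map `p` with a section `s` such that `p ≫ s` is fibrewise homotopic to the identity. -/
def IsShrinkable {A C : TopCat.{u}} (p : A ⟶ C) : Prop :=
  ∃ s : C(C, A), (∀ c, p (s c) = c) ∧ ∃ H : C(A, C(I, A)),
    (∀ a, H a 0 = a) ∧ (∀ a, H a 1 = s (p a)) ∧ ∀ a t, p (H a t) = p a

/-- A homotopy given by a curried map. -/
def homotopyOfCurry {X Y : Type*} [TopologicalSpace X] [TopologicalSpace Y]
    (H : C(X, C(I, Y))) (f g : C(X, Y)) (h₀ : ∀ x, H x 0 = f x) (h₁ : ∀ x, H x 1 = g x) :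
    f.Homotopy g where
  toFun p := H p.2 p.1
  map_zero_left := h₀
  map_one_left := h₁

/-- The curried map of a homotopy. -/
def curryOfHomotopy {X Y : Type*} [TopologicalSpace X] [TopologicalSpace Y]
    {f g : C(X, Y)} (H : f.Homotopy g) : C(X, C(I, Y)) :=
  ContinuousMap.curry (H.toContinuousMap.comp ContinuousMap.prodSwap)

@[simp]
lemma curryOfHomotopy_apply {X Y : Type*} [TopologicalSpace X] [TopologicalSpace Y]
    {f g : C(X, Y)} (H : f.Homotopy g) (x : X) (t : I) : curryOfHomotopy H x t = H (t, x) := rfl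

lemma isHtpyEquiv_of_homotopic {X Y : TopCat.{u}} (f : X ⟶ Y) (g : C(Y, X))
    (h₁ : (g.comp f.hom).Homotopic (.id X)) (h₂ : (f.hom.comp g).Homotopic (.id Y)) :
    IsHtpyEquiv f :=
  ⟨⟨f.hom, g, h₁, h₂⟩, rfl⟩

lemma isHtpyEquiv_iff {X Y : TopCat.{u}} (f : X ⟶ Y) :
    IsHtpyEquiv f ↔ ∃ g : C(Y, X), (g.comp f.hom).Homotopic (.id X) ∧
      (f.hom.comp g).Homotopic (.id Y) := by
  constructor
  · rintro ⟨e, he⟩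
    exact ⟨e.invFun, he ▸ e.left_inv, he ▸ e.right_inv⟩
  · rintro ⟨g, h₁, h₂⟩
    exact isHtpyEquiv_of_homotopic f g h₁ h₂

lemma IsHtpyEquiv.comp {X Y Z : TopCat.{u}} {f : X ⟶ Y} {g : Y ⟶ Z}
    (hf : IsHtpyEquiv f) (hg : IsHtpyEquiv g) : IsHtpyEquiv (f ≫ g) := by
  obtain ⟨e, he⟩ := hf
  obtain ⟨e', he'⟩ := hg
  refine ⟨e.trans e', ?_⟩
  rw [TopCat.hom_comp, ← he, ← he']
  rfl

lemma IsHtpyEquiv.of_homotopic {X Y : TopCat.{u}} {f f' : X ⟶ Y} (hf : IsHtpyEquiv f)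
    (h : f.hom.Homotopic f'.hom) : IsHtpyEquiv f' := by
  obtain ⟨g, h₁, h₂⟩ := (isHtpyEquiv_iff f).1 hf
  exact isHtpyEquiv_of_homotopic f' g
    (((ContinuousMap.Homotopic.refl g).comp h.symm).trans h₁)
    ((h.symm.comp (ContinuousMap.Homotopic.refl g)).trans h₂)

lemma IsHtpyEquiv.of_inverse {X Y : TopCat.{u}} {f : X ⟶ Y} {g : Y ⟶ X} (hf : IsHtpyEquiv f)
    (h : (g.hom.comp f.hom).Homotopic (.id X)) : IsHtpyEquiv g := by
  obtain ⟨g', h₁, h₂⟩ := (isHtpyEquiv_iff f).1 hf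
  refine isHtpyEquiv_of_homotopic g f.hom ?_ h
  have h₃ : (g.hom).Homotopic g' := by
    have := (ContinuousMap.Homotopic.refl g.hom).comp h₂
    have h' := h.comp (ContinuousMap.Homotopic.refl g')
    exact this.symm.trans h'
  exact ((ContinuousMap.Homotopic.refl f.hom).comp h₃).trans h₂

lemma IsHtpyEquiv.of_comp_left {X Y Z : TopCat.{u}} {f : X ⟶ Y} {g : Y ⟶ Z}
    (hf : IsHtpyEquiv f) (hfg : IsHtpyEquiv (f ≫ g)) : IsHtpyEquiv g := by
  obtain ⟨f', h₁, h₂⟩ := (isHtpyEquiv_iff f).1 hf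
  have hf' : IsHtpyEquiv (TopCat.ofHom f') := hf.of_inverse h₁
  refine (hf'.comp hfg).of_homotopic ?_
  exact (ContinuousMap.Homotopic.refl g.hom).comp h₂

lemma IsHtpyEquiv.of_comp_right {X Y Z : TopCat.{u}} {f : X ⟶ Y} {g : Y ⟶ Z}
    (hg : IsHtpyEquiv g) (hfg : IsHtpyEquiv (f ≫ g)) : IsHtpyEquiv f := by
  obtain ⟨g', h₁, h₂⟩ := (isHtpyEquiv_iff g).1 hg
  have hg' : IsHtpyEquiv (TopCat.ofHom g') := hg.of_inverse h₁
  refine (hfg.comp hg').of_homotopic ?_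
  exact h₁.comp (ContinuousMap.Homotopic.refl f.hom)

lemma isHtpyEquiv_of_isIso {X Y : TopCat.{u}} (f : X ⟶ Y) [IsIso f] : IsHtpyEquiv f := by
  refine isHtpyEquiv_of_homotopic f (inv f).hom ?_ ?_
  · rw [← TopCat.hom_comp]; simpa using .refl _
  · rw [← TopCat.hom_comp]; simpa using .refl _

lemma IsSDR.isHtpyEquiv {A B : TopCat.{u}} {i : A ⟶ B} (h : IsSDR i) : IsHtpyEquiv i := by
  obtain ⟨r, hr, H, h₀, h₁, -⟩ := h
  refine isHtpyEquiv_of_homotopic i r ?_ ?_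
  · rw [show r.comp i.hom = .id _ from ContinuousMap.ext hr]
  · exact ⟨(homotopyOfCurry H (.id _) (i.hom.comp r) h₀ h₁).symm⟩

lemma IsShrinkable.isHtpyEquiv {A C : TopCat.{u}} {p : A ⟶ C} (h : IsShrinkable p) :
    IsHtpyEquiv p := by
  obtain ⟨s, hs, H, h₀, h₁, -⟩ := h
  refine isHtpyEquiv_of_homotopic p s ?_ ?_
  · exact ⟨(homotopyOfCurry H (.id _) (s.comp p.hom) h₀ h₁).symm⟩
  · rw [show p.hom.comp s = .id _ from ContinuousMap.ext hs]

/-- A homotopy equivalence with the homotopy extension property is a strong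
deformation retract. -/
lemma HEP.isSDR {A B : TopCat.{u}} {i : A ⟶ B} (hi : HEP i) (h : IsHtpyEquiv i) : IsSDR i := by
  obtain ⟨g, ⟨h₁⟩, ⟨h₂⟩⟩ := (isHtpyEquiv_iff i).1 h
  obtain ⟨F, hF₀, hF⟩ := hi A g (curryOfHomotopy h₁) (fun a ↦ by simp)
  let r : C(B, A) := ⟨fun b ↦ F b 1, by fun_prop⟩
  have hr (a : A) : r (i a) = a := by
    change F (i a) 1 = a
    simp [hF]
  have hgr : g.Homotopic r := ⟨homotopyOfCurry F g r hF₀ (fun _ ↦ rfl)⟩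
  obtain ⟨G'⟩ : (ContinuousMap.id B).Homotopic (i.hom.comp r) :=
    ContinuousMap.Homotopic.trans ⟨h₂.symm⟩ ((ContinuousMap.Homotopic.refl i.hom).comp hgr)
  let G : C(I × B, B) := G'.toContinuousMap
  have G0 (b : B) : G (0, b) = b := G'.map_zero_left b
  have G1 (b : B) : G (1, b) = i (r b) := G'.map_one_left b
  -- the tent function
  let tri : C(I, ℝ) := ⟨fun s ↦ 1 - |2 * (s : ℝ) - 1|, by fun_prop⟩
  have tri0 : tri 0 = 0 := by norm_num [tri]
  have tri1 : tri 1 = 0 := by norm_num [tri]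
  -- The path `c b` runs from `b` to `i (r b)` along `G`, then out and back along the track of `i (r
  -- b)`. On a point of `A` both halves use the same track, so the path is a loop traversed forth
  -- and back, hence contractible.
  let c : C(B, C(I, B)) := ContinuousMap.curry
    { toFun p := if (p.2 : ℝ) ≤ 1 / 2 then
          G (Set.projIcc 0 1 zero_le_one (tri p.2), p.1)
        else G (Set.projIcc 0 1 zero_le_one (tri p.2), i (r p.1))
      continuous_toFun := by
        refine Continuous.if_le (by fun_prop) (by fun_prop) (by fun_prop) (by fun_prop) ?_
        rintro ⟨b, s⟩ hs
        have : tri s = 1 := by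
          change 1 - |2 * (s : ℝ) - 1| = 1
          simp only at hs
          rw [hs]; norm_num
        simp only [this]
        rw [Set.projIcc_right]
        erw [G1, G1, hr] }
  have hc (b : B) (s : I) : c b s = if (s : ℝ) ≤ 1 / 2 then
          G (Set.projIcc 0 1 zero_le_one (tri s), b)
        else G (Set.projIcc 0 1 zero_le_one (tri s), i (r b)) := rfl
  -- Lowering the tent by `v` contracts these loops; at `v = 1` they are constant. Homotopy
  -- extension into the path space of `B` spreads the contraction over `B`. The other three sides of
  -- the resulting square are stationary on `A` and together replace `c`.
  let Q : C(A, C(I, C(I, B))) := ContinuousMap.curry (ContinuousMap.curry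
    ⟨fun p ↦ G (Set.projIcc 0 1 zero_le_one (tri p.2 - p.1.2), i p.1.1), by fun_prop⟩)
  have hQ (a : A) (v s : I) : Q a v s = G (Set.projIcc 0 1 zero_le_one (tri s - v), i a) := rfl
  obtain ⟨E, hE₀, hE⟩ := hi (TopCat.of C(I, B)) c Q (fun a ↦ by
    ext s
    rw [hQ]
    change _ = c (i a) s
    rw [hc]
    simp [hr])
  let E' : C(B, C(I, C(I, B))) := E
  have hE₀' (b : B) (s : I) : E' b 0 s = c b s := DFunLike.congr_fun (hE₀ b) s
  have hE' (a : A) (v s : I) : E' (i a) v s = Q a v s :=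
    DFunLike.congr_fun (DFunLike.congr_fun (hE a) v) s
  let e₁ : C(B, B) := ⟨fun b ↦ E' b 1 0, by fun_prop⟩
  let e₂ : C(B, B) := ⟨fun b ↦ E' b 1 1, by fun_prop⟩
  let S : Set B := Set.range i
  let H₁ : (ContinuousMap.id B).HomotopyRel e₁ S :=
    { toFun p := E' p.2 p.1 0
      continuous_toFun := by fun_prop
      map_zero_left b := by
        simp only [hE₀', hc, tri0]
        norm_num [G0]
      map_one_left b := rfl
      prop' := by
        rintro t _ ⟨a, rfl⟩
        change E' (i a) t 0 = i a
        rw [hE', hQ, tri0, Set.projIcc_of_le_left _ (by simpa using t.2.1)]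
        exact G0 _ }
  let H₂ : e₁.HomotopyRel e₂ S :=
    { toFun p := E' p.2 1 p.1
      continuous_toFun := by fun_prop
      map_zero_left b := rfl
      map_one_left b := rfl
      prop' := by
        rintro t _ ⟨a, rfl⟩
        change E' (i a) 1 t = E' (i a) 1 0
        have : tri t ≤ 1 := by simp [tri]
        rw [hE', hE', hQ, hQ, tri0]
        congr 2
        exact (Set.projIcc_of_le_left _ (sub_nonpos.2 this)).trans
          (Set.projIcc_of_le_left _ (by simp)).symm }
  let H₃ : (i.hom.comp r).HomotopyRel e₂ S :=
    { toFun p := E' p.2 p.1 1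
      continuous_toFun := by fun_prop
      map_zero_left b := by
        simp only [hE₀', hc, tri1]
        norm_num [G0]
      map_one_left b := rfl
      prop' := by
        rintro t _ ⟨a, rfl⟩
        change E' (i a) t 1 = i (r (i a))
        rw [hE', hQ, tri1, hr, Set.projIcc_of_le_left _ (by simpa using t.2.1)]
        exact G0 _ }
  let K := (H₁.trans H₂).trans H₃.symm
  refine ⟨r, hr, curryOfHomotopy K.toHomotopy, fun b ↦ K.map_zero_left b,
    fun b ↦ K.map_one_left b, fun a t ↦ K.prop' t _ ⟨a, rfl⟩⟩

section Colimits

open Limits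

/-- Homotopies are curried to maps into a path space, so the universal property of the pushout glues
the deformation of `B` to the constant one on `C`; they agree on `A` because the deformation is
stationary there. -/
lemma IsSDR.of_isPushout {A B C D : TopCat.{u}} {i : A ⟶ B} {k : A ⟶ C} {h : B ⟶ D} {j : C ⟶ D}
    (sq : IsPushout i k h j) (hi : IsSDR i) : IsSDR j := by
  obtain ⟨r, hr, H, h₀, h₁, hH⟩ := hi
  have w (a : A) : h (i a) = j (k a) := ConcreteCategory.congr_hom sq.w a
  have hr' : i ≫ (TopCat.ofHom r ≫ k) = k ≫ 𝟙 C := by ext a; exact congrArg k (hr a)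
  let r' : D ⟶ C := sq.desc _ _ hr'
  have hr₁ (b : B) : r' (h b) = k (r b) := ConcreteCategory.congr_hom (sq.inl_desc _ _ hr') b
  have hr₂ (c : C) : r' (j c) = c := ConcreteCategory.congr_hom (sq.inr_desc _ _ hr') c
  let P : B ⟶ TopCat.of C(I, D) := TopCat.ofHom (ContinuousMap.curry
    ⟨fun p : B × I ↦ h (H p.1 p.2), by fun_prop⟩)
  let Q : C ⟶ TopCat.of C(I, D) := TopCat.ofHom (ContinuousMap.curry
    ⟨fun p : C × I ↦ j p.1, by fun_prop⟩)
  have hP : i ≫ P = k ≫ Q := by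
    ext a t
    change h (H (i a) t) = j (k a)
    rw [hH, w]
  let H' : C(D, C(I, D)) := (sq.desc P Q hP).hom
  have H'₁ (b : B) (t : I) : H' (h b) t = h (H b t) :=
    DFunLike.congr_fun (ConcreteCategory.congr_hom (sq.inl_desc _ _ hP) b) t
  have H'₂ (c : C) (t : I) : H' (j c) t = j c :=
    DFunLike.congr_fun (ConcreteCategory.congr_hom (sq.inr_desc _ _ hP) c) t
  refine ⟨r'.hom, hr₂, H', fun d ↦ ?_, fun d ↦ ?_, H'₂⟩
  · let ev : D ⟶ D := TopCat.ofHom ⟨fun d ↦ H' d 0, by fun_prop⟩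
    suffices ev = 𝟙 D from ConcreteCategory.congr_hom this d
    apply sq.hom_ext
    · ext b
      exact (H'₁ b 0).trans (congrArg h (h₀ b))
    · ext c
      exact H'₂ c 0
  · let ev : D ⟶ D := TopCat.ofHom ⟨fun d ↦ H' d 1, by fun_prop⟩
    suffices ev = r' ≫ j from ConcreteCategory.congr_hom this d
    apply sq.hom_ext
    · ext b
      refine (H'₁ b 1).trans ?_
      rw [h₁, w]
      exact congrArg j (hr₁ b).symm
    · ext c
      exact (H'₂ c 1).trans (congrArg j (hr₂ c).symm)

/-- The pushout of a shrinkable map along a map with the homotopy extension property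
is a homotopy equivalence. -/
lemma IsShrinkable.isHtpyEquiv_of_isPushout {A B C D : TopCat.{u}}
    {i : A ⟶ B} {p : A ⟶ C} {q : B ⟶ D} {j : C ⟶ D}
    (sq : IsPushout i p q j) (hi : HEP i) (hp : IsShrinkable p) : IsHtpyEquiv q := by
  obtain ⟨s, hs, H, h₀, h₁, hH⟩ := hp
  have w (a : A) : q (i a) = j (p a) := ConcreteCategory.congr_hom sq.w a
  -- The fibrewise contraction of `A` onto the section extends to a deformation `F` of `B`. Its end
  -- map factors through `p` on `A`, hence descends to `ρ : D ⟶ B`; and `q ∘ F` descends to `D`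
  -- because the contraction stays in the fibres of `p`.
  obtain ⟨F, hF₀, hF⟩ := hi B (.id B) (ContinuousMap.curry
    ⟨fun x : A × I ↦ i (H x.1 x.2), by fun_prop⟩) (fun a ↦ by
      change i (H a 0) = i a
      rw [h₀])
  have hF (a : A) (t : I) : F (i a) t = i (H a t) := DFunLike.congr_fun (hF a) t
  have hF₀ (b : B) : F b 0 = b := hF₀ b
  let e : B ⟶ B := TopCat.ofHom ⟨fun b ↦ F b 1, by fun_prop⟩
  have he : i ≫ e = p ≫ (TopCat.ofHom s ≫ i) := by
    ext a
    change F (i a) 1 = i (s (p a))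
    rw [hF, h₁]
  let ρ : D ⟶ B := sq.desc _ _ he
  have ρ₁ (b : B) : ρ (q b) = F b 1 := ConcreteCategory.congr_hom (sq.inl_desc _ _ he) b
  have ρ₂ (c : C) : ρ (j c) = i (s c) := ConcreteCategory.congr_hom (sq.inr_desc _ _ he) c
  let P : B ⟶ TopCat.of C(I, D) := TopCat.ofHom (ContinuousMap.curry
    ⟨fun x : B × I ↦ q (F x.1 x.2), by fun_prop⟩)
  let Q : C ⟶ TopCat.of C(I, D) := TopCat.ofHom (ContinuousMap.curry
    ⟨fun x : C × I ↦ j x.1, by fun_prop⟩)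
  have hP : i ≫ P = p ≫ Q := by
    ext a t
    change q (F (i a) t) = j (p a)
    rw [hF, w, hH]
  let H' : C(D, C(I, D)) := (sq.desc P Q hP).hom
  have H'₁ (b : B) (t : I) : H' (q b) t = q (F b t) :=
    DFunLike.congr_fun (ConcreteCategory.congr_hom (sq.inl_desc _ _ hP) b) t
  have H'₂ (c : C) (t : I) : H' (j c) t = j c :=
    DFunLike.congr_fun (ConcreteCategory.congr_hom (sq.inr_desc _ _ hP) c) t
  refine isHtpyEquiv_of_homotopic q ρ.hom ⟨?_⟩ ⟨?_⟩
  · exact (homotopyOfCurry F _ _ hF₀ (fun b ↦ (ρ₁ b).symm)).symm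
  · refine (homotopyOfCurry H' (.id D) _ (fun d ↦ ?_) (fun d ↦ ?_)).symm
    · let ev : D ⟶ D := TopCat.ofHom ⟨fun d ↦ H' d 0, by fun_prop⟩
      suffices ev = 𝟙 D from ConcreteCategory.congr_hom this d
      apply sq.hom_ext
      · ext b
        exact (H'₁ b 0).trans (congrArg q (hF₀ b))
      · ext c
        exact H'₂ c 0
    · let ev : D ⟶ D := TopCat.ofHom ⟨fun d ↦ H' d 1, by fun_prop⟩
      suffices ev = ρ ≫ q from ConcreteCategory.congr_hom this d
      apply sq.hom_ext
      · ext b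
        exact (H'₁ b 1).trans (congrArg q (ρ₁ b).symm)
      · ext c
        refine (H'₂ c 1).trans (Eq.trans ?_ (congrArg q (ρ₂ c).symm))
        rw [w, hs]

lemma isHtpyEquiv_of_isColimit_cofan {J : Type u} {X Y : J → TopCat.{u}} {f : ∀ j, X j ⟶ Y j}
    (hf : ∀ j, IsHtpyEquiv (f j)) {cX : Cofan X} {cY : Cofan Y} (hX : IsColimit cX)
    (hY : IsColimit cY) (g : cX.pt ⟶ cY.pt) (hg : ∀ j, cX.inj j ≫ g = f j ≫ cY.inj j) :
    IsHtpyEquiv g := by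
  have hf' (j : J) := (isHtpyEquiv_iff (f j)).1 (hf j)
  choose f' h₁ h₂ using hf'
  let g' : cY.pt ⟶ cX.pt := Cofan.IsColimit.desc hY (fun j ↦ TopCat.ofHom (f' j) ≫ cX.inj j)
  have hg' (j : J) : cY.inj j ≫ g' = TopCat.ofHom (f' j) ≫ cX.inj j := Cofan.IsColimit.fac _ _ _
  have key {Z : J → TopCat.{u}} {c : Cofan Z} (hc : IsColimit c) (e : c.pt ⟶ c.pt)
      (e' : ∀ j, Z j ⟶ Z j) (he : ∀ j, c.inj j ≫ e = e' j ≫ c.inj j)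
      (he' : ∀ j, (e' j).hom.Homotopic (.id _)) : e.hom.Homotopic (.id _) := by
    let K (j : J) : C(Z j, C(I, Z j)) := curryOfHomotopy (he' j).some
    let Q (j : J) : Z j ⟶ TopCat.of C(I, c.pt) := TopCat.ofHom
      (ContinuousMap.curry ⟨fun x : Z j × I ↦ c.inj j (K j x.1 x.2), by fun_prop⟩)
    let P' : c.pt ⟶ TopCat.of C(I, c.pt) := Cofan.IsColimit.desc hc Q
    have hP' (j : J) : c.inj j ≫ P' = Q j := Cofan.IsColimit.fac hc Q j
    let P : C(c.pt, C(I, c.pt)) := P'.hom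
    have hP (j : J) (z : Z j) (t : I) : P (c.inj j z) t = c.inj j (K j z t) :=
      congrArg (fun w : C(I, c.pt) ↦ w t) (ConcreteCategory.congr_hom (hP' j) z)
    refine ⟨homotopyOfCurry P _ _ (fun x ↦ ?_) (fun x ↦ ?_)⟩
    · let ev : c.pt ⟶ c.pt := TopCat.ofHom ⟨fun d ↦ P d 0, by fun_prop⟩
      suffices ev = e from ConcreteCategory.congr_hom this x
      refine Cofan.IsColimit.hom_ext hc _ _ (fun j ↦ ?_)
      rw [he]
      ext z
      refine (hP j z 0).trans ?_
      simp [K]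
    · let ev : c.pt ⟶ c.pt := TopCat.ofHom ⟨fun d ↦ P d 1, by fun_prop⟩
      suffices ev = 𝟙 _ from ConcreteCategory.congr_hom this x
      refine Cofan.IsColimit.hom_ext hc _ _ (fun j ↦ ?_)
      ext z
      refine (hP j z 1).trans ?_
      simp [K]
  refine isHtpyEquiv_of_homotopic g g'.hom ?_ ?_
  · exact key hX (g ≫ g') (fun j ↦ f j ≫ TopCat.ofHom (f' j))
      (fun j ↦ by rw [← Category.assoc, hg, Category.assoc, hg', Category.assoc]) h₁
  · exact key hY (g' ≫ g) (fun j ↦ TopCat.ofHom (f' j) ≫ f j)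
      (fun j ↦ by rw [← Category.assoc, hg', Category.assoc, hg, Category.assoc]) h₂

/-- The transfinite composition of a sequence of inclusions of strong deformation retracts
is a homotopy equivalence. -/
lemma isHtpyEquiv_of_isColimit_of_isSDR {X : ℕ ⥤ TopCat.{u}} {c : Cocone X} (hc : IsColimit c)
    (hX : ∀ n, IsSDR (X.map (homOfLE (Nat.le_succ n)))) : IsHtpyEquiv (c.ι.app 0) := by
  choose r hr H h₀ h₁ hH using hX
  let i (n : ℕ) : X.obj n ⟶ X.obj (n + 1) := X.map (homOfLE (Nat.le_succ n))
  let ι (n : ℕ) : X.obj n ⟶ c.pt := c.ι.app n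
  have hι (n : ℕ) (a : X.obj n) : ι (n + 1) (i n a) = ι n a :=
    ConcreteCategory.congr_hom (c.w (homOfLE (Nat.le_succ n))) a
  let R (n : ℕ) : C(X.obj n, X.obj 0) :=
    Nat.rec (motive := fun n ↦ C(X.obj n, X.obj 0)) (.id _) (fun n R ↦ R.comp (r n)) n
  -- The deformation of stage `n` waits until time `2⁻ⁿ`. Stage `n + 1` inserts `H n` into the
  -- interval from `2⁻⁽ⁿ⁺¹⁾` to `2⁻ⁿ`, and `φ n` rescales that interval to the unit interval. Since
  -- `H n` is stationary on the image of stage `n`, the stages are strictly compatible and pass to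
  -- the colimit.
  let T (n : ℕ) (K : C(X.obj n, C(I, c.pt))) : Prop := ∀ a (t : I), (t : ℝ) ≤ (1 / 2) ^ n →
    K a t = ι n a
  let φ (n : ℕ) (t : I) : I := Set.projIcc 0 1 zero_le_one (2 ^ (n + 1) * (t : ℝ) - 1)
  have φ_cont (n : ℕ) : Continuous (φ n) := by fun_prop
  have φ_one (n : ℕ) (t : I) (ht : (t : ℝ) = (1 / 2) ^ n) : φ n t = 1 := by
    refine Set.projIcc_of_right_le _ (le_of_eq ?_)
    rw [ht, pow_succ, mul_right_comm, ← mul_pow]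
    norm_num
  let step (n : ℕ) (K : Subtype (T n)) : C(X.obj (n + 1), C(I, c.pt)) := ContinuousMap.curry
    { toFun p := if (p.2 : ℝ) ≤ (1 / 2) ^ n then ι (n + 1) (H n p.1 (φ n p.2))
        else K.1 (r n p.1) p.2
      continuous_toFun := by
        refine Continuous.if_le (by fun_prop) (by fun_prop) (by fun_prop) (by fun_prop) ?_
        rintro ⟨b, t⟩ ht
        dsimp only at ht ⊢
        rw [φ_one n t ht, K.2 _ _ ht.le, h₁]
        exact hι n _ }
  have step_apply (n : ℕ) (K : Subtype (T n)) (b) (t : I) : step n K b t =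
    if (t : ℝ) ≤ (1 / 2) ^ n then ι (n + 1) (H n b (φ n t)) else K.1 (r n b) t := rfl
  let K (n : ℕ) : Subtype (T n) := Nat.rec (motive := fun n ↦ Subtype (T n))
    ⟨ContinuousMap.curry ⟨fun p : X.obj 0 × I ↦ ι 0 p.1, by fun_prop⟩, fun _ _ _ ↦ rfl⟩
    (fun n K ↦ ⟨step n K, fun b t ht ↦ by
      rw [step_apply, if_pos]
      · have : φ n t = 0 := by
          refine Set.projIcc_of_le_left _ ?_
          have := mul_le_mul_of_nonneg_left ht (show (0 : ℝ) ≤ 2 ^ (n + 1) by positivity)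
          rw [← mul_pow] at this
          norm_num at this
          linarith
        rw [this, h₀]
      · exact ht.trans (pow_le_pow_of_le_one (by norm_num) (by norm_num) (Nat.le_succ n))⟩) n
  have K_succ (n : ℕ) : (K (n + 1)).1 = step n (K n) := rfl
  have K_i (n : ℕ) (a : X.obj n) : (K (n + 1)).1 (i n a) = (K n).1 a := by
    ext t
    rw [K_succ, step_apply]
    split_ifs with ht
    · rw [hH, (K n).2 _ _ ht]
      exact hι n a
    · rw [hr]
  have K_zero (n : ℕ) (a : X.obj n) : (K n).1 a 0 = ι n a := (K n).2 _ _ (by simp)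
  have K_one (n : ℕ) (a : X.obj n) : (K n).1 a 1 = ι 0 (R n a) := by
    induction n with
    | zero => rfl
    | succ n hn =>
      rw [K_succ, step_apply]
      refine Eq.trans ?_ (hn (r n a))
      split_ifs with ht
      · rw [(K n).2 _ _ ht, φ_one, h₁]
        · exact hι _ _
        · exact le_antisymm ht (pow_le_one₀ (by norm_num) (by norm_num))
      · rfl
  let cR : Cocone X :=
    { pt := X.obj 0
      ι := NatTrans.ofSequence (fun n ↦ TopCat.ofHom (R n)) (fun n ↦ by
        ext a
        exact congrArg (R n) (hr n a)) }
  let cK : Cocone X :=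
    { pt := TopCat.of C(I, c.pt)
      ι := NatTrans.ofSequence (fun n ↦ TopCat.ofHom (K n).1) (fun n ↦ by
        ext a
        exact K_i n a) }
  let R' : c.pt ⟶ X.obj 0 := hc.desc cR
  let K' : C(c.pt, C(I, c.pt)) := (hc.desc cK).hom
  have hR' (n) (a : X.obj n) : R' (ι n a) = R n a := ConcreteCategory.congr_hom (hc.fac cR n) a
  have hK' (n) (a : X.obj n) : K' (ι n a) = (K n).1 a :=
    ConcreteCategory.congr_hom (hc.fac cK n) a
  refine isHtpyEquiv_of_homotopic (ι 0) R'.hom ?_ ⟨?_⟩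
  · rw [show R'.hom.comp (ι 0).hom = .id _ from ContinuousMap.ext (hR' 0)]
  · refine (homotopyOfCurry K' (.id _) _ (fun d ↦ ?_) (fun d ↦ ?_)).symm
    · let ev : c.pt ⟶ c.pt := TopCat.ofHom ⟨fun d ↦ K' d 0, by fun_prop⟩
      suffices ev = 𝟙 _ from ConcreteCategory.congr_hom this d
      refine hc.hom_ext fun n ↦ ?_
      ext a
      change K' (ι n a) 0 = ι n a
      rw [hK', K_zero]
    · let ev : c.pt ⟶ c.pt := TopCat.ofHom ⟨fun d ↦ K' d 1, by fun_prop⟩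
      suffices ev = R' ≫ ι 0 from ConcreteCategory.congr_hom this d
      refine hc.hom_ext fun n ↦ ?_
      ext a
      change K' (ι n a) 1 = ι 0 (R' (ι n a))
      rw [hK', K_one, hR']

end Colimits

end TopCat

end

/-! ### Common refinements of points of topological simplices. -/

section

namespace stdSimplex

lemma map_apply' {n m : ℕ} (f : Fin n → Fin m) (x : stdSimplex ℝ (Fin n)) (i : Fin m) :
    map f x i = ∑ k with f k = i, x k := by
  simp [FunOnFinite.linearMap_apply_apply]

lemma sum_map_le {n m : ℕ} (f : Fin n → Fin m) (x : stdSimplex ℝ (Fin n)) (i : Fin m) :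
    ∑ j with j ≤ i, map f x j = ∑ k with f k ≤ i, x k := by
  simp only [map_apply']
  rw [← Finset.sum_fiberwise_of_maps_to (s := {k | f k ≤ i}) (t := {j | j ≤ i}) (g := f)
    (by simp)]
  refine Finset.sum_congr rfl fun j hj ↦ ?_
  congr 1
  ext k
  simp only [Finset.mem_filter, Finset.mem_univ, true_and] at hj ⊢
  grind

/-- Monotone maps are determined by the image of an interior point. -/
lemma eq_of_map_eq {n m : ℕ} {f g : Fin n → Fin m} (hf : Monotone f) (hg : Monotone g)
    (x : stdSimplex ℝ (Fin n)) (hx : ∀ i, 0 < x i) (h : map f x = map g x) : f = g := by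
  have key (i : Fin m) : ∑ k with f k ≤ i, x k = ∑ k with g k ≤ i, x k := by
    refine (sum_map_le f x i).symm.trans (Eq.trans ?_ (sum_map_le g x i))
    rw [h]
  have aux {f g : Fin n → Fin m} (hf : Monotone f) (hg : Monotone g)
      (key : ∀ i : Fin m, ∑ k with f k ≤ i, x k = ∑ k with g k ≤ i, x k) (k : Fin n) :
      f k ≤ g k := by
    by_contra! hk
    -- If `g k < f k`, monotonicity makes the indices with `f ≤ g k` a subset of those with `g ≤ g
    -- k`, and `k` lies only in the latter. Its positive weight contradicts equality of the
    -- distribution functions.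
    refine (key (g k)).not_lt (Finset.sum_lt_sum_of_subset (i := k) ?_ ?_ ?_ (hx k) ?_)
    · intro l hl
      simp only [Finset.mem_filter, Finset.mem_univ, true_and] at hl ⊢
      refine hg (le_of_not_gt fun hl' ↦ ?_)
      exact absurd (hf hl'.le) (not_le.2 (hl.trans_lt hk))
    · simp
    · simpa using hk
    · intro l _ _
      exact (hx l).le
  funext k
  exact le_antisymm (aux hf hg key k) (aux hg hf (fun i ↦ (key i).symm) k)

/-- The partial sums of the barycentric coordinates. -/
noncomputable def partialSum {n : ℕ} (x : stdSimplex ℝ (Fin n)) (i : ℕ) : ℝ :=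
  ∑ k with k.val < i, x k

lemma partialSum_zero {n : ℕ} (x : stdSimplex ℝ (Fin n)) : partialSum x 0 = 0 := by
  simp [partialSum]

lemma partialSum_self {n : ℕ} (x : stdSimplex ℝ (Fin n)) : partialSum x n = 1 := by
  rw [← stdSimplex.sum_eq_one x, partialSum]
  congr 1
  ext
  simp

lemma partialSum_succ {n : ℕ} (x : stdSimplex ℝ (Fin n)) (i : Fin n) :
    partialSum x (i.val + 1) = partialSum x i.val + x i := by
  rw [partialSum, partialSum, add_comm _ (x i), ← Finset.sum_insert (by simp)]
  congr 1
  ext k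
  simp only [Finset.mem_filter, Finset.mem_univ, true_and, Finset.mem_insert, Fin.ext_iff]
  lia

lemma partialSum_mono {n : ℕ} (x : stdSimplex ℝ (Fin n)) : Monotone (partialSum x) := by
  intro i j hij
  refine Finset.sum_le_sum_of_subset_of_nonneg ?_ (fun k _ _ ↦ x.2.1 k)
  intro k hk
  simp only [Finset.mem_filter, Finset.mem_univ, true_and] at hk ⊢
  lia

lemma partialSum_le_one {n : ℕ} (x : stdSimplex ℝ (Fin n)) (i : Fin n) :
    partialSum x (i.val + 1) ≤ 1 := by
  rw [← partialSum_self x]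
  exact partialSum_mono x i.2

lemma partialSum_nonneg {n : ℕ} (x : stdSimplex ℝ (Fin n)) (i : ℕ) : 0 ≤ partialSum x i := by
  rw [← partialSum_zero x]
  exact partialSum_mono x (Nat.zero_le i)

/-- The length of the intersection of the intervals `[a, a']` and `[b, b']`. -/
noncomputable def overlap (a a' b b' : ℝ) : ℝ := max 0 (min a' b' - max a b)

lemma overlap_comm (a a' b b' : ℝ) : overlap a a' b b' = overlap b b' a a' := by
  rw [overlap, overlap, min_comm, max_comm a b]

lemma overlap_eq {a a' b b' : ℝ} (ha : a ≤ a') (hb : b ≤ b') :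
    overlap a a' b b' = max a (min a' b') - max a (min a' b) := by
  grind [overlap]

/-- The monotone coupling of two points of topological simplices. -/
noncomputable def coupling {n m : ℕ} (x : stdSimplex ℝ (Fin n)) (y : stdSimplex ℝ (Fin m))
    (p : Fin n × Fin m) : ℝ :=
  overlap (partialSum x p.1) (partialSum x (p.1 + 1)) (partialSum y p.2) (partialSum y (p.2 + 1))

lemma coupling_swap {n m : ℕ} (x : stdSimplex ℝ (Fin n)) (y : stdSimplex ℝ (Fin m))
    (i : Fin n) (j : Fin m) : coupling x y (i, j) = coupling y x (j, i) :=
  overlap_comm _ _ _ _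

lemma sum_coupling {n m : ℕ} (x : stdSimplex ℝ (Fin n)) (y : stdSimplex ℝ (Fin m))
    (i : Fin n) : ∑ j, coupling x y (i, j) = x i := by
  have hx := partialSum_mono x (Nat.le_succ i.val)
  have := Finset.sum_range_sub (fun j ↦
    max (partialSum x i) (min (partialSum x (i + 1)) (partialSum y j))) m
  rw [partialSum_self, partialSum_zero, min_eq_left (partialSum_le_one x i), max_eq_right hx,
    min_eq_right (partialSum_nonneg _ _), max_eq_left (partialSum_nonneg _ _),
    Finset.sum_range] at this
  rw [← add_sub_cancel_left (partialSum x i) (x i), ← partialSum_succ, ← this]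
  refine Finset.sum_congr rfl fun j _ ↦ ?_
  exact overlap_eq hx (partialSum_mono y (Nat.le_succ j.val))

lemma coupling_nonneg {n m : ℕ} (x : stdSimplex ℝ (Fin n)) (y : stdSimplex ℝ (Fin m))
    (p : Fin n × Fin m) : 0 ≤ coupling x y p := le_max_left _ _

/-- Both points cut the unit interval into consecutive pieces. If the first coordinate moves right
while the second moves left, the two pairs of pieces cannot both overlap in positive length. So the
support of the coupling is a chain. -/
lemma snd_le_of_coupling {n m : ℕ} (x : stdSimplex ℝ (Fin n)) (y : stdSimplex ℝ (Fin m))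
    {p q : Fin n × Fin m} (hp : 0 < coupling x y p) (hq : 0 < coupling x y q) (h : p.1 < q.1) :
    p.2 ≤ q.2 := by
  by_contra! hlt
  have h₁ := partialSum_mono x (show p.1.val + 1 ≤ q.1.val from h)
  have h₂ := partialSum_mono y (show q.2.val + 1 ≤ p.2.val from hlt)
  simp only [coupling, overlap] at hp hq
  grind

/-- Any two points of topological simplices are images of a common interior point
of a topological simplex. -/
lemma exists_common_refinement {n m : ℕ} (x : stdSimplex ℝ (Fin n)) (y : stdSimplex ℝ (Fin m)) :
    ∃ (p : ℕ) (z : stdSimplex ℝ (Fin (p + 1))) (f : Fin (p + 1) → Fin n)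
      (g : Fin (p + 1) → Fin m), Monotone f ∧ Monotone g ∧ (∀ i, 0 < z i) ∧
        map f z = x ∧ map g z = y ∧ p < n * m := by
  classical
  -- The lexicographic order enumerates the support so that first coordinates increase by
  -- construction; `snd_le_of_coupling` then handles the second ones. The positive couplings are the
  -- barycentric coordinates of `z`, whose marginals are `x` and `y`.
  let w (s : Fin n ×ₗ Fin m) : ℝ := coupling x y (ofLex s)
  let S : Finset (Fin n ×ₗ Fin m) := {s | 0 < w s}
  have w_zero (s) (hs : s ∉ S) : w s = 0 := by
    refine le_antisymm ?_ (coupling_nonneg _ _ _)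
    simpa [S] using hs
  have w_sum : ∑ s, w s = 1 := by
    rw [← stdSimplex.sum_eq_one x, ← toLex.sum_comp, Fintype.sum_prod_type]
    exact Finset.sum_congr rfl fun i _ ↦ sum_coupling x y i
  have w_sum' : ∑ s ∈ S, w s = 1 := by
    rw [← w_sum]
    exact Finset.sum_subset (Finset.subset_univ _) fun s _ hs ↦ w_zero s hs
  obtain ⟨p, hp⟩ : ∃ p, S.card = p + 1 := by
    refine Nat.exists_eq_succ_of_ne_zero fun h ↦ ?_
    rw [Finset.card_eq_zero.1 h] at w_sum'
    simp at w_sum'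
  let e := S.orderIsoOfFin hp
  have e_pos (k) : 0 < w (e k) := (Finset.mem_filter.1 (e k).2).2
  have sum_e (F : Fin n ×ₗ Fin m → ℝ) : ∑ k, F (e k) = ∑ s ∈ S, F s := by
    exact (e.toEquiv.sum_comp (fun s : S ↦ F s)).trans (Finset.sum_coe_sort S F)
  let z : stdSimplex ℝ (Fin (p + 1)) := ⟨fun k ↦ w (e k), fun k ↦ (e_pos k).le, by
    rw [sum_e, w_sum']⟩
  have sum_z (P : Fin n ×ₗ Fin m → Prop) [DecidablePred P] :
      ∑ k with P (e k), z k = ∑ s with P s, w s := by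
    rw [Finset.sum_filter, Finset.sum_filter]
    rw [← Finset.sum_subset (Finset.subset_univ S)]
    · exact sum_e (fun s ↦ if P s then w s else 0)
    · intro s _ hs
      simp [w_zero s hs]
  refine ⟨p, z, fun k ↦ (ofLex (e k).1).1, fun k ↦ (ofLex (e k).1).2, ?_, ?_, e_pos, ?_, ?_, ?_⟩
  · intro k l hkl
    have := e.monotone hkl
    rw [← Subtype.coe_le_coe, Prod.Lex.le_iff] at this
    grind
  · intro k l hkl
    have := e.monotone hkl
    rw [← Subtype.coe_le_coe, Prod.Lex.le_iff] at this
    obtain h | h := this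
    · exact snd_le_of_coupling x y (e_pos k) (e_pos l) h
    · exact h.2
  · ext i
    rw [map_apply', sum_z (fun s ↦ (ofLex s).1 = i), Finset.sum_filter, ← toLex.sum_comp,
      Fintype.sum_prod_type, Finset.sum_eq_single i (by intro j _ hj; simp [hj]) (by simp)]
    simpa [w] using sum_coupling x y i
  · ext j
    rw [map_apply', sum_z (fun s ↦ (ofLex s).2 = j), Finset.sum_filter, ← toLex.sum_comp,
      Fintype.sum_prod_type_right, Finset.sum_eq_single j (by intro i _ hi; simp [hi]) (by simp)]
    simpa [w, coupling_swap] using sum_coupling y x j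
  · have := S.card_le_univ
    rw [hp] at this
    simpa using this

end stdSimplex

end

/-! ### Points of geometric realizations and of their products. -/

section

open Simplicial Opposite MonoidalCategory CartesianMonoidalCategory

namespace SSet

variable {X Y Z : SSet.{u}}

/-- The characteristic map to the geometric realization attached to a simplex. -/
noncomputable def realize {n : SimplexCategory} (x : X.obj (op n)) :
    C(_root_.stdSimplex ℝ (Fin (n.len + 1)), |X|) :=
  TopCat.toSSetObjEquiv _ _ ((sSetTopAdj.unit.app X).app (op n) x)

lemma toTop_map_realize (f : X ⟶ Y) {n : SimplexCategory} (x : X.obj (op n))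
    (z : _root_.stdSimplex ℝ (Fin (n.len + 1))) :
    toTop.map f (realize x z) = realize (f.app _ x) z := by
  have := ConcreteCategory.congr_hom (NatTrans.congr_app (sSetTopAdj.unit.naturality f) (op n)) x
  exact DFunLike.congr_fun (congrArg (TopCat.toSSetObjEquiv _ _) this.symm) z

lemma realize_map {n m : SimplexCategory} (α : n ⟶ m) (x : X.obj (op m))
    (z : _root_.stdSimplex ℝ (Fin (n.len + 1))) :
    realize (X.map α.op x) z = realize x (stdSimplex.map α z) := by
  have := ConcreteCategory.congr_hom ((sSetTopAdj.unit.app X).naturality α.op) x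
  exact DFunLike.congr_fun (congrArg (TopCat.toSSetObjEquiv _ _) this) z

lemma toSSetObjEquiv_homEquiv {T : TopCat.{u}} (u : |X| ⟶ T) {n : SimplexCategory}
    (x : X.obj (op n)) :
    TopCat.toSSetObjEquiv _ _ ((sSetTopAdj.homEquiv X T u).app (op n) x) =
      u.hom.comp (realize x) := by
  rw [Adjunction.homEquiv_unit]
  rfl

/-- By adjunction, maps out of the realization are simplicial maps into the singular simplicial set,
which are compatible families of singular simplices. -/
lemma exists_toTop_desc {T : TopCat.{u}}
    (φ : ∀ (n : SimplexCategory) (_ : X.obj (op n)), C(_root_.stdSimplex ℝ (Fin (n.len + 1)), T))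
    (hφ : ∀ (n m : SimplexCategory) (α : n ⟶ m) (x : X.obj (op m)) (z),
      φ n (X.map α.op x) z = φ m x (stdSimplex.map α z)) :
    ∃ u : |X| ⟶ T, ∀ (n : SimplexCategory) (x : X.obj (op n)) (z), u (realize x z) = φ n x z := by
  let ψ : X ⟶ TopCat.toSSet.obj T :=
    { app n := ↾fun x ↦ (TopCat.toSSetObjEquiv T n).symm (φ n.unop x)
      naturality n m α := by
        ext x
        apply (TopCat.toSSetObjEquiv T m).injective
        ext z
        exact (DFunLike.congr_fun ((TopCat.toSSetObjEquiv T m).apply_symm_apply _) z).trans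
          (hφ _ _ α.unop x z) }
  refine ⟨(sSetTopAdj.homEquiv X T).symm ψ, fun n x z ↦ ?_⟩
  have := toSSetObjEquiv_homEquiv ((sSetTopAdj.homEquiv X T).symm ψ) x
  rw [Equiv.apply_symm_apply] at this
  exact (DFunLike.congr_fun this z).symm.trans
    (DFunLike.congr_fun ((TopCat.toSSetObjEquiv T (op n)).apply_symm_apply _) z)

lemma toTop_hom_ext {T : TopCat.{u}} {u v : |X| ⟶ T}
    (h : ∀ (n : SimplexCategory) (x : X.obj (op n)) (z), u (realize x z) = v (realize x z)) :
    u = v := by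
  apply (sSetTopAdj.homEquiv X T).injective
  ext n x
  apply (TopCat.toSSetObjEquiv T n).injective
  ext z
  exact (DFunLike.congr_fun (toSSetObjEquiv_homEquiv u x) z).trans
    ((h _ _ _).trans (DFunLike.congr_fun (toSSetObjEquiv_homEquiv v x) z).symm)

/-- The characteristic maps factor through the subspace of points of this form, hence so does the
identity of the realization. Only the universal property of the realization enters. -/
lemma exists_realize (w : |X|) :
    ∃ (n : SimplexCategory) (x : X.obj (op n)) (z : _), realize x z = w := by
  let S : Set |X| := {w | ∃ (n : SimplexCategory) (x : X.obj (op n)) (z : _), realize x z = w}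
  obtain ⟨u, hu⟩ := exists_toTop_desc (X := X) (T := TopCat.of S)
    (fun n x ↦ ⟨fun z ↦ ⟨realize x z, ⟨_, _, _, rfl⟩⟩, by fun_prop⟩)
    (fun n m α x z ↦ Subtype.ext (realize_map α x z))
  have : u ≫ TopCat.ofHom ⟨Subtype.val, continuous_subtype_val⟩ = 𝟙 _ := by
    refine toTop_hom_ext fun n x z ↦ ?_
    exact congrArg Subtype.val (hu n x z)
  have h := ConcreteCategory.congr_hom this w
  rw [← show (u w).1 = w from h]
  exact (u w).2

lemma continuous_toTop_iff {T : Type u} [TopologicalSpace T] {φ : |X| → T} :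
    Continuous φ ↔ ∀ (n : SimplexCategory) (x : X.obj (op n)), Continuous (φ ∘ realize x) := by
  refine ⟨fun h n x ↦ h.comp (realize x).continuous, fun h ↦ ?_⟩
  obtain ⟨u, hu⟩ := exists_toTop_desc (X := X) (T := TopCat.of T) (fun n x ↦ ⟨_, h n x⟩)
    (fun n m α x z ↦ congrArg φ (realize_map α x z))
  have : φ = u := by
    ext w
    obtain ⟨n, x, z, rfl⟩ := exists_realize w
    exact (hu n x z).symm
  rw [this]
  exact u.hom.continuous

lemma exists_refinement {n m : SimplexCategory} (x : _root_.stdSimplex ℝ (Fin (n.len + 1)))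
    (y : _root_.stdSimplex ℝ (Fin (m.len + 1))) :
    ∃ (p : SimplexCategory) (z : _root_.stdSimplex ℝ (Fin (p.len + 1))) (f : p ⟶ n) (g : p ⟶ m),
      (∀ i, 0 < z i) ∧ stdSimplex.map f z = x ∧ stdSimplex.map g z = y ∧
        p.len < (n.len + 1) * (m.len + 1) := by
  obtain ⟨p, z, f, g, hf, hg, hz, h₁, h₂, h₃⟩ := _root_.stdSimplex.exists_common_refinement x y
  exact ⟨⦋p⦌, z, SimplexCategory.Hom.mk ⟨f, hf⟩, SimplexCategory.Hom.mk ⟨g, hg⟩, hz, h₁, h₂, h₃⟩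

lemma hom_eq_of_map_eq {n m : SimplexCategory} {f g : n ⟶ m}
    (z : _root_.stdSimplex ℝ (Fin (n.len + 1)))
    (hz : ∀ i, 0 < z i) (h : stdSimplex.map f z = stdSimplex.map g z) : f = g := by
  ext i : 3
  exact congrFun (_root_.stdSimplex.eq_of_map_eq f.toOrderHom.monotone g.toOrderHom.monotone
    z hz h) i

lemma map_comp_apply' {n m p : SimplexCategory} (f : n ⟶ m) (g : m ⟶ p)
    (z : _root_.stdSimplex ℝ (Fin (n.len + 1))) :
    _root_.stdSimplex.map (f ≫ g) z = _root_.stdSimplex.map g (_root_.stdSimplex.map f z) :=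
  (_root_.stdSimplex.map_comp_apply f g z).symm

/-- Two points of a geometric realization coincide only if they have a common refinement. -/
lemma exists_of_realize_eq {n m : SimplexCategory} {x : X.obj (op n)} {y : X.obj (op m)}
    {z : _root_.stdSimplex ℝ (Fin (n.len + 1))} {w : _root_.stdSimplex ℝ (Fin (m.len + 1))}
    (h : realize x z = realize y w) :
    ∃ (p : SimplexCategory) (t : _root_.stdSimplex ℝ (Fin (p.len + 1))) (f : p ⟶ n) (g : p ⟶ m),
      stdSimplex.map f t = z ∧ stdSimplex.map g t = w ∧
      X.map f.op x = X.map g.op y := by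
  let E := Σ (n : SimplexCategory) (_ : X.obj (op n)), ULift.{u} (_root_.stdSimplex ℝ (Fin (n.len + 1)))
  let s : Setoid E :=
    { r a b := ∃ (p : SimplexCategory) (t : _root_.stdSimplex ℝ (Fin (p.len + 1)))
        (f : p ⟶ a.1) (g : p ⟶ b.1), stdSimplex.map f t = a.2.2.down ∧
          stdSimplex.map g t = b.2.2.down ∧ X.map f.op a.2.1 = X.map g.op b.2.1
      iseqv :=
        { refl a := ⟨a.1, a.2.2.down, 𝟙 _, 𝟙 _, stdSimplex.map_id_apply _,
            stdSimplex.map_id_apply _, rfl⟩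
          symm := by
            rintro a b ⟨p, t, f, g, h₁, h₂, h₃⟩
            exact ⟨p, t, g, f, h₂, h₁, h₃.symm⟩
          trans := by
            rintro a b c ⟨p, t, f, g, h₁, h₂, h₃⟩ ⟨p', t', f', g', h₁', h₂', h₃'⟩
            -- Two refinements of the middle point are refined once more by an interior point `s`;
            -- monotone maps that agree at an interior point are equal, so the two zigzags compose.
            obtain ⟨q, s, k, k', hs, rfl, rfl, -⟩ := exists_refinement t t'
            have : k ≫ g = k' ≫ f' := by
              apply hom_eq_of_map_eq s hs
              rw [map_comp_apply', map_comp_apply', h₂, h₁']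
            refine ⟨q, s, k ≫ f, k' ≫ g', ?_, ?_, ?_⟩
            · rw [map_comp_apply', h₁]
            · rw [map_comp_apply', h₂']
            · rw [op_comp, Functor.map_comp_apply, h₃, op_comp, Functor.map_comp_apply, ← h₃',
                ← Functor.map_comp_apply, ← Functor.map_comp_apply, ← op_comp, ← op_comp, this] } }
  -- With the indiscrete topology every map to the quotient is continuous, so the realization maps
  -- to it and detects the equivalence relation.
  let _ : TopologicalSpace (Quotient s) := ⊤
  obtain ⟨u, hu⟩ := exists_toTop_desc (X := X) (T := TopCat.of (Quotient s))
    (fun n x ↦ ⟨fun z ↦ Quotient.mk s ⟨n, x, ⟨z⟩⟩, continuous_top⟩) (fun n m α x z ↦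
      Quotient.sound ⟨n, z, 𝟙 _, α, stdSimplex.map_id_apply _, rfl, by simp⟩)
  have h' := congrArg u h
  rw [hu, hu] at h'
  exact Quotient.exact h'

lemma realize_tensor_fst {n : SimplexCategory} (s : (X ⊗ Z).obj (op n))
    (z : _root_.stdSimplex ℝ (Fin (n.len + 1))) :
    toTop.map (fst X Z) (realize s z) = realize s.1 z := toTop_map_realize _ _ _

lemma realize_tensor_snd {n : SimplexCategory} (s : (X ⊗ Z).obj (op n))
    (z : _root_.stdSimplex ℝ (Fin (n.len + 1))) :
    toTop.map (snd X Z) (realize s z) = realize s.2 z := toTop_map_realize _ _ _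

/-- A simplex of a binary product. -/
def tensorMk {n : SimplexCategory} (x : X.obj (op n)) (z : Z.obj (op n)) : (X ⊗ Z).obj (op n) :=
  (x, z)

lemma tensorMk_surjective {n : SimplexCategory} (s : (X ⊗ Z).obj (op n)) :
    ∃ (x : X.obj (op n)) (z : Z.obj (op n)), tensorMk x z = s := ⟨s.1, s.2, rfl⟩

/-- The comparison map from the realization of a product to the product of realizations. -/
noncomputable def toTopProd (X Z : SSet.{u}) (w : |X ⊗ Z|) : |X| × |Z| :=
  (toTop.map (fst X Z) w, toTop.map (snd X Z) w)

lemma toTopProd_realize {n : SimplexCategory} (x : X.obj (op n)) (y : Z.obj (op n))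
    (z : _root_.stdSimplex ℝ (Fin (n.len + 1))) :
    toTopProd X Z (realize (tensorMk x y) z) = (realize x z, realize y z) :=
  Prod.ext (realize_tensor_fst (tensorMk x y) _) (realize_tensor_snd (tensorMk x y) _)

/-- Surjectivity is the common refinement of two points. For injectivity, the refinements witnessing
the two equalities are refined once more, and the resulting monotone maps agree at an interior
point. Nothing is claimed about the inverse being continuous for the product topology. -/
lemma toTopProd_bijective : Function.Bijective (toTopProd X Z) := by
  constructor
  · intro w w' h
    obtain ⟨n, s, z, rfl⟩ := exists_realize w
    obtain ⟨x, y, rfl⟩ := tensorMk_surjective s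
    obtain ⟨n', s', z', rfl⟩ := exists_realize w'
    obtain ⟨x', y', rfl⟩ := tensorMk_surjective s'
    rw [toTopProd_realize, toTopProd_realize, Prod.ext_iff] at h
    obtain ⟨p, t, f, g, h₁, h₂, h₃⟩ := exists_of_realize_eq h.1
    obtain ⟨p', t', f', g', h₁', h₂', h₃'⟩ := exists_of_realize_eq h.2
    obtain ⟨q, s, k, k', hs, rfl, rfl, -⟩ := exists_refinement t t'
    rw [← map_comp_apply'] at h₁ h₂ h₁' h₂'
    have e₁ : k ≫ f = k' ≫ f' := hom_eq_of_map_eq s hs (h₁.trans h₁'.symm)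
    have e₂ : k ≫ g = k' ≫ g' := hom_eq_of_map_eq s hs (h₂.trans h₂'.symm)
    rw [← h₁, ← h₂, ← realize_map, ← realize_map]
    refine DFunLike.congr_fun (congrArg realize (Prod.ext ?_ ?_)) s
    · change X.map _ x = X.map _ x'
      rw [op_comp, Functor.map_comp_apply, h₃, op_comp, Functor.map_comp_apply]
    · change Z.map _ y = Z.map _ y'
      rw [e₁, e₂, op_comp, Functor.map_comp_apply, h₃', op_comp, Functor.map_comp_apply]
  · rintro ⟨w, w'⟩
    obtain ⟨n, x, z, rfl⟩ := exists_realize w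
    obtain ⟨n', x', z', rfl⟩ := exists_realize w'
    obtain ⟨q, s, k, k', hs, rfl, rfl, -⟩ := exists_refinement z z'
    refine ⟨realize (tensorMk (X.map k.op x) (Z.map k'.op x')) s, ?_⟩
    rw [toTopProd_realize, realize_map, realize_map]

/-- A function on `|X| × |Z|` that is continuous on all products of simplices. -/
def SimplexwiseContinuous {T : Type*} [TopologicalSpace T] (φ : |X| × |Z| → T) : Prop :=
  ∀ ⦃n m : SimplexCategory⦄ (x : X.obj (op n)) (z : Z.obj (op m)),
    Continuous (fun p : _root_.stdSimplex ℝ (Fin (n.len + 1)) × _root_.stdSimplex ℝ (Fin (m.len + 1)) ↦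
      φ (realize x p.1, realize z p.2))

/-- Pairs of monotone maps parametrizing simplices of a product of two simplices. -/
structure Refinement (n m : ℕ) where
  /-- the dimension -/
  dim : ℕ
  lt : dim < n * m
  /-- the first projection -/
  left : Fin (dim + 1) →o Fin n
  /-- the second projection -/
  right : Fin (dim + 1) →o Fin m

instance (n m : ℕ) : Finite (Refinement n m) := by
  have (p k : ℕ) : Finite (Fin p →o Fin k) := Finite.of_injective _ DFunLike.coe_injective
  refine Finite.of_surjective (fun a : (Σ p : Fin (n * m), (Fin (p + 1) →o Fin n) ×
    (Fin (p + 1) →o Fin m)) ↦ (⟨a.1, a.1.2, a.2.1, a.2.2⟩ : Refinement n m)) ?_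
  rintro ⟨p, hp, f, g⟩
  exact ⟨⟨⟨p, hp⟩, f, g⟩, rfl⟩

/-- The map from the simplex of a refinement to the product. -/
noncomputable def Refinement.map {n m : ℕ} (a : Refinement n m)
    (z : _root_.stdSimplex ℝ (Fin (a.dim + 1))) :
    _root_.stdSimplex ℝ (Fin n) × _root_.stdSimplex ℝ (Fin m) :=
  (_root_.stdSimplex.map a.left z, _root_.stdSimplex.map a.right z)

lemma Refinement.continuous_map {n m : ℕ} (a : Refinement n m) : Continuous a.map :=
  (_root_.stdSimplex.continuous_map _).prodMk (_root_.stdSimplex.continuous_map _)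

lemma Refinement.exists_map_eq {n m : ℕ} (z : _root_.stdSimplex ℝ (Fin n))
    (z' : _root_.stdSimplex ℝ (Fin m)) :
    ∃ (a : Refinement n m) (s : _), a.map s = (z, z') := by
  obtain ⟨q, s, k, k', hk, hk', hs, h₁, h₂, hq⟩ :=
    _root_.stdSimplex.exists_common_refinement z z'
  exact ⟨⟨q, hq, ⟨k, hk⟩, ⟨k', hk'⟩⟩, s, Prod.ext h₁ h₂⟩

/-- A continuous surjection from a compact space to a Hausdorff space is a quotient map; the source
is compact because the dimension bound leaves only finitely many refinements. -/
lemma isQuotientMap_refinements (n m : ℕ) :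
    Topology.IsQuotientMap (fun q : (Σ a : Refinement n m,
      _root_.stdSimplex ℝ (Fin (a.dim + 1))) ↦ q.1.map q.2) := by
  apply Topology.IsQuotientMap.of_surjective_continuous
  · rintro ⟨z, z'⟩
    obtain ⟨a, s, h⟩ := Refinement.exists_map_eq z z'
    exact ⟨⟨a, s⟩, h⟩
  · exact continuous_sigma fun a ↦ a.continuous_map

/-- A product of two simplices is a quotient of finitely many simplices, each mapping to the
realization of `X ⊗ Z`. Continuity on products of simplices thus replaces the product topology,
which may be too coarse. -/
lemma simplexwiseContinuous_iff {T : Type u} [TopologicalSpace T] {φ : |X| × |Z| → T} :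
    SimplexwiseContinuous φ ↔ Continuous (φ ∘ toTopProd X Z) := by
  constructor
  · intro h
    rw [continuous_toTop_iff]
    intro n s
    obtain ⟨x, y, rfl⟩ := tensorMk_surjective s
    refine ((h x y).comp (Continuous.prodMk continuous_id continuous_id)).congr fun z ↦ ?_
    exact congrArg φ (toTopProd_realize x y z).symm
  · intro h n m x z
    rw [(isQuotientMap_refinements (n.len + 1) (m.len + 1)).continuous_iff]
    refine continuous_sigma fun ⟨p, _, f, g⟩ ↦ ?_
    let f' : ⦋p⦌ ⟶ n := SimplexCategory.Hom.mk f
    let g' : ⦋p⦌ ⟶ m := SimplexCategory.Hom.mk g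
    refine (h.comp (realize (tensorMk (X.map f'.op x) (Z.map g'.op z))).continuous).congr
      fun t ↦ ?_
    refine congrArg φ ((toTopProd_realize _ _ t).trans ?_)
    rw [realize_map, realize_map]
    rfl

/-- Continuity in the first variable is tested on one simplex of `X`. Currying the other way, maps
from `|Z|` into a function space on that simplex are tested on simplices of `Z`, and the simplex is
locally compact, so the two variables can be exchanged. -/
lemma SimplexwiseContinuous.exists_curry {T : Type u} [TopologicalSpace T] {φ : |X| × |Z| → T}
    (h : SimplexwiseContinuous φ) :
    ∃ ψ : C(|X|, C(|Z|, T)), ∀ x z, ψ x z = φ (x, z) := by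
  have h₁ (x : |X|) : Continuous (fun z ↦ φ (x, z)) := by
    rw [continuous_toTop_iff]
    intro m z
    obtain ⟨n, x, t, rfl⟩ := exists_realize x
    exact (h x z).comp (Continuous.prodMk continuous_const continuous_id)
  refine ⟨⟨fun x ↦ ⟨_, h₁ x⟩, ?_⟩, fun _ _ ↦ rfl⟩
  rw [continuous_toTop_iff]
  intro n x
  let ψ : |Z| → C(_root_.stdSimplex ℝ (Fin (n.len + 1)), T) := fun w ↦
    ⟨fun t ↦ φ (realize x t, w), by
      obtain ⟨m, z, s, rfl⟩ := exists_realize w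
      exact (h x z).comp (Continuous.prodMk continuous_id continuous_const)⟩
  have hψ : Continuous ψ := by
    let ψ' : |Z| → ULift.{u} C(_root_.stdSimplex ℝ (Fin (n.len + 1)), T) := fun w ↦ ⟨ψ w⟩
    suffices Continuous ψ' from continuous_uliftDown.comp this
    rw [continuous_toTop_iff]
    intro m z
    refine continuous_uliftUp.comp ?_
    exact ContinuousMap.continuous_of_continuous_uncurry _
      ((h x z).comp continuous_swap)
  apply ContinuousMap.continuous_of_continuous_uncurry
  exact (ContinuousMap.continuous_uncurry_of_continuous ⟨ψ, hψ⟩).comp continuous_swap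

lemma simplexwiseContinuous_of_curry {T : Type*} [TopologicalSpace T] (ψ : C(|X|, C(|Z|, T))) :
    SimplexwiseContinuous (fun p ↦ ψ p.1 p.2) := by
  intro n m x z
  have : Continuous (fun t ↦ (ψ (realize x t)).comp (realize z)) :=
    (ContinuousMap.continuous_precomp _).comp (by fun_prop)
  exact ContinuousMap.continuous_uncurry_of_continuous ⟨_, this⟩

end SSet

end

/-! ### Products of weak equivalences, and simplicial homotopies. -/

section

open Simplicial Opposite MonoidalCategory CartesianMonoidalCategory unitInterval

namespace SSet

variable {X Y Z : SSet.{u}}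

lemma exists_toTop_tensor_curry {T : Type u} [TopologicalSpace T] (u : C(|X ⊗ Z|, T)) :
    ∃ ψ : C(|X|, C(|Z|, T)), ∀ w, ψ (toTop.map (fst X Z) w) (toTop.map (snd X Z) w) = u w := by
  let e := Equiv.ofBijective _ (toTopProd_bijective (X := X) (Z := Z))
  have he (w) : e.symm (toTopProd X Z w) = w := e.symm_apply_apply w
  have : SimplexwiseContinuous (u ∘ e.symm) := by
    rw [simplexwiseContinuous_iff, Function.comp_assoc]
    refine u.continuous.congr fun w ↦ ?_
    exact congrArg u (he w).symm
  obtain ⟨ψ, hψ⟩ := this.exists_curry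
  exact ⟨ψ, fun w ↦ (hψ _ _).trans (congrArg u (he w))⟩

lemma continuous_tensor_of_curry {T : Type u} [TopologicalSpace T] (ψ : C(|X|, C(|Z|, T))) :
    Continuous (fun w ↦ ψ (toTop.map (fst X Z) w) (toTop.map (snd X Z) w)) :=
  simplexwiseContinuous_iff.1 (simplexwiseContinuous_of_curry ψ)

/-- Carries a homotopy in the first factor to a homotopy on the realization of the product. The time
variable is curried away, so continuity is again a question about two simplices. -/
lemma exists_tensor_curry_homotopy {T : Type u} [TopologicalSpace T] (ψ : C(|Y|, C(|Z|, T)))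
    (K : C(|X|, C(I, |Y|))) :
    ∃ L : C(|X ⊗ Z|, C(I, T)), ∀ w t,
      L w t = ψ (K (toTop.map (fst X Z) w) t) (toTop.map (snd X Z) w) := by
  let φ (p : |X| × |Z|) : C(I, T) :=
    ⟨fun t ↦ ψ (K p.1 t) p.2, by fun_prop⟩
  have hφ : SimplexwiseContinuous φ := by
    intro n m x z
    apply ContinuousMap.continuous_of_continuous_uncurry
    let F : C(_root_.stdSimplex ℝ (Fin (n.len + 1)) × I,
        C(_root_.stdSimplex ℝ (Fin (m.len + 1)), T)) :=
      ⟨fun p ↦ (ψ (K (realize x p.1) p.2)).comp (realize z), by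
        refine (ContinuousMap.continuous_precomp _).comp (ψ.continuous.comp ?_)
        fun_prop⟩
    have hF := ContinuousMap.continuous_uncurry_of_continuous F
    exact hF.comp (f := fun q : (_root_.stdSimplex ℝ (Fin (n.len + 1)) ×
      _root_.stdSimplex ℝ (Fin (m.len + 1))) × I ↦ ((q.1.1, q.2), q.1.2)) (by fun_prop)
  exact ⟨⟨_, simplexwiseContinuous_iff.1 hφ⟩, fun w t ↦ rfl⟩

lemma tensor_point_ext {w w' : |X ⊗ Z|} (h₁ : toTop.map (fst X Z) w = toTop.map (fst X Z) w')
    (h₂ : toTop.map (snd X Z) w = toTop.map (snd X Z) w') : w = w' :=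
  toTopProd_bijective.1 (Prod.ext h₁ h₂)

lemma toTop_map_comp_apply (f : X ⟶ Y) (g : Y ⟶ Z) (w : |X|) :
    toTop.map g (toTop.map f w) = toTop.map (f ≫ g) w := by
  rw [Functor.map_comp]
  rfl

lemma toTop_fst_whiskerRight (f : X ⟶ Y) (w : |X ⊗ Z|) :
    toTop.map (fst Y Z) (toTop.map (f ▷ Z) w) = toTop.map f (toTop.map (fst X Z) w) := by
  rw [toTop_map_comp_apply, toTop_map_comp_apply, whiskerRight_fst]

lemma toTop_snd_whiskerRight (f : X ⟶ Y) (w : |X ⊗ Z|) :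
    toTop.map (snd Y Z) (toTop.map (f ▷ Z) w) = toTop.map (snd X Z) w := by
  rw [toTop_map_comp_apply, whiskerRight_snd]

/-- A homotopy inverse need not be the realization of a simplicial map, so `g × id` is built from
the curried identity of `|Y ⊗ Z|`. -/
lemma exists_whiskerRight_map (Z : SSet.{u}) (g : C(|X|, |Y|)) :
    ∃ g' : C(|X ⊗ Z|, |Y ⊗ Z|), ∀ w,
      toTop.map (fst Y Z) (g' w) = g (toTop.map (fst X Z) w) ∧
      toTop.map (snd Y Z) (g' w) = toTop.map (snd X Z) w := by
  obtain ⟨ψ, hψ⟩ := exists_toTop_tensor_curry (ContinuousMap.id |Y ⊗ Z|)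
  have key (y z) : toTop.map (fst Y Z) (ψ y z) = y ∧ toTop.map (snd Y Z) (ψ y z) = z := by
    obtain ⟨w, hw⟩ := toTopProd_bijective.2 (y, z)
    obtain ⟨rfl, rfl⟩ := Prod.ext_iff.1 hw
    have := hψ w
    exact ⟨congrArg _ this, congrArg _ this⟩
  exact ⟨⟨_, continuous_tensor_of_curry (ψ.comp g)⟩, fun w ↦ key _ _⟩

lemma exists_whiskerRight_homotopy (Z : SSet.{u}) {f g : C(|X|, |Y|)} (h : f.Homotopic g)
    {f' g' : C(|X ⊗ Z|, |Y ⊗ Z|)}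
    (hf : ∀ w, toTop.map (fst Y Z) (f' w) = f (toTop.map (fst X Z) w) ∧
      toTop.map (snd Y Z) (f' w) = toTop.map (snd X Z) w)
    (hg : ∀ w, toTop.map (fst Y Z) (g' w) = g (toTop.map (fst X Z) w) ∧
      toTop.map (snd Y Z) (g' w) = toTop.map (snd X Z) w) : f'.Homotopic g' := by
  obtain ⟨h⟩ := h
  obtain ⟨ψ, hψ⟩ := exists_toTop_tensor_curry (ContinuousMap.id |Y ⊗ Z|)
  have key (y z) : toTop.map (fst Y Z) (ψ y z) = y ∧ toTop.map (snd Y Z) (ψ y z) = z := by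
    obtain ⟨w, hw⟩ := toTopProd_bijective.2 (y, z)
    obtain ⟨rfl, rfl⟩ := Prod.ext_iff.1 hw
    have := hψ w
    exact ⟨congrArg _ this, congrArg _ this⟩
  obtain ⟨L, hL⟩ := exists_tensor_curry_homotopy (X := X) ψ (TopCat.curryOfHomotopy h)
  refine ⟨TopCat.homotopyOfCurry L f' g' (fun w ↦ ?_) (fun w ↦ ?_)⟩
  · refine tensor_point_ext ?_ ?_
    · rw [hL, (hf w).1, (key _ _).1]; simp
    · rw [hL, (hf w).2, (key _ _).2]
  · refine tensor_point_ext ?_ ?_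
    · rw [hL, (hg w).1, (key _ _).1]; simp
    · rw [hL, (hg w).2, (key _ _).2]

/-- Weak equivalences are stable under products with a fixed simplicial set. -/
lemma isHtpyEquiv_whiskerRight {f : X ⟶ Y} (hf : TopCat.IsHtpyEquiv (toTop.map f))
    (Z : SSet.{u}) : TopCat.IsHtpyEquiv (toTop.map (f ▷ Z)) := by
  obtain ⟨g, h₁, h₂⟩ := (TopCat.isHtpyEquiv_iff _).1 hf
  obtain ⟨g', hg'⟩ := exists_whiskerRight_map Z g
  refine TopCat.isHtpyEquiv_of_homotopic _ g' ?_ ?_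
  · refine exists_whiskerRight_homotopy Z h₁ (fun w ↦ ?_) (fun w ↦ ⟨rfl, rfl⟩)
    have := hg' (toTop.map (f ▷ Z) w)
    rw [toTop_fst_whiskerRight, toTop_snd_whiskerRight] at this
    exact this
  · refine exists_whiskerRight_homotopy Z h₂ (fun w ↦ ?_) (fun w ↦ ⟨rfl, rfl⟩)
    have h₁ := toTop_fst_whiskerRight f (g' w)
    have h₂ := toTop_snd_whiskerRight f (g' w)
    rw [(hg' w).1] at h₁
    rw [(hg' w).2] at h₂
    exact ⟨h₁, h₂⟩

lemma isHtpyEquiv_toTop_map_of_isIso (f : X ⟶ Y) [IsIso f] :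
    TopCat.IsHtpyEquiv (toTop.map f) := TopCat.isHtpyEquiv_of_isIso _

lemma isHtpyEquiv_whiskerLeft {f : X ⟶ Y} (hf : TopCat.IsHtpyEquiv (toTop.map f))
    (Z : SSet.{u}) : TopCat.IsHtpyEquiv (toTop.map (Z ◁ f)) := by
  have : Z ◁ f = (β_ _ _).hom ≫ f ▷ Z ≫ (β_ _ _).hom := by simp
  rw [this, Functor.map_comp, Functor.map_comp]
  exact (isHtpyEquiv_toTop_map_of_isIso _).comp
    ((isHtpyEquiv_whiskerRight hf Z).comp (isHtpyEquiv_toTop_map_of_isIso _))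

/-! ### The interval -/

/-- The points of the topological one-simplex. -/
noncomputable def segment (t : I) : _root_.stdSimplex ℝ (Fin 2) :=
  ⟨![1 - t, t], ⟨fun i ↦ by fin_cases i <;> simp [t.2.1, t.2.2], by simp⟩⟩

lemma continuous_segment : Continuous segment := by
  refine Continuous.subtype_mk (continuous_pi fun i ↦ ?_) _
  fin_cases i
  · simp; fun_prop
  · simp; fun_prop

/-- The parametrization of the realization of the standard one-simplex. -/
noncomputable def intervalPath : C(I, |(Δ[1] : SSet.{u})|) where
  toFun t := realize (stdSimplex.objEquiv.symm (𝟙 ⦋1⦌) : (Δ[1] : SSet.{u}).obj (op ⦋1⦌)) (segment t)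
  continuous_toFun := (realize _).continuous.comp continuous_segment

lemma exists_intervalCoord :
    ∃ u : C(|(Δ[1] : SSet.{u})|, I), ∀ (n : SimplexCategory) (x : (Δ[1] : SSet.{u}).obj (op n)) z,
      (u (realize x z) : ℝ) = _root_.stdSimplex.map (stdSimplex.objEquiv x) z 1 := by
  have h (z : _root_.stdSimplex ℝ (Fin 2)) : z 1 ∈ I :=
    ⟨z.2.1 1, by
      have h₁ := z.2.2
      have h₀ : 0 ≤ z 0 := z.2.1 0
      rw [Fin.sum_univ_two] at h₁
      replace h₁ : z 0 + z 1 = 1 := h₁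
      linarith⟩
  obtain ⟨u, hu⟩ := exists_toTop_desc (X := (Δ[1] : SSet.{u})) (T := TopCat.of (ULift.{u} I))
    (fun n x ↦ ⟨fun z ↦ ⟨⟨_root_.stdSimplex.map (stdSimplex.objEquiv x) z 1, h _⟩⟩, by
      refine continuous_uliftUp.comp (Continuous.subtype_mk ?_ _)
      exact (continuous_apply (1 : Fin 2)).comp
        (continuous_subtype_val.comp (_root_.stdSimplex.continuous_map _))⟩)
    (fun n m α x z ↦ by
      ext
      change _root_.stdSimplex.map _ _ _ = _root_.stdSimplex.map _ _ _
      rw [← map_comp_apply']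
      rfl)
  refine ⟨⟨fun w ↦ (u w).down, by fun_prop⟩, fun n x z ↦ ?_⟩
  exact congrArg (fun a : ULift I ↦ (a.down : ℝ)) (hu n x z)

/-- The coordinate on the realization of the standard one-simplex. -/
noncomputable def intervalCoord : C(|(Δ[1] : SSet.{u})|, I) := exists_intervalCoord.choose

lemma intervalCoord_realize {n : SimplexCategory} (x : (Δ[1] : SSet.{u}).obj (op n)) (z) :
    (intervalCoord (realize x z) : ℝ) = _root_.stdSimplex.map (stdSimplex.objEquiv x) z 1 :=
  exists_intervalCoord.choose_spec n x z

lemma intervalCoord_intervalPath (t : I) : intervalCoord (intervalPath.{u} t) = t := by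
  apply Subtype.ext
  refine (intervalCoord_realize _ _).trans ?_
  rw [Equiv.apply_symm_apply]
  exact congrArg (fun a : _root_.stdSimplex ℝ (Fin 2) ↦ a 1) (stdSimplex.map_id_apply (segment t))

lemma intervalPath_intervalCoord (w : |(Δ[1] : SSet.{u})|) :
    intervalPath (intervalCoord w) = w := by
  obtain ⟨n, x, z, rfl⟩ := exists_realize w
  obtain ⟨f, rfl⟩ := stdSimplex.objEquiv.symm.surjective x
  have : segment (intervalCoord (realize (stdSimplex.objEquiv.{u}.symm f) z)) =
      _root_.stdSimplex.map f z := by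
    have h := intervalCoord_realize (stdSimplex.objEquiv.{u}.symm f) z
    rw [Equiv.apply_symm_apply] at h
    have h' := (_root_.stdSimplex.map f z).2.2
    rw [Fin.sum_univ_two] at h'
    ext i
    fin_cases i
    · change 1 - (intervalCoord _ : ℝ) = _root_.stdSimplex.map f z 0
      rw [h]
      exact (eq_sub_of_add_eq h').symm
    · exact h
  change realize _ _ = _
  rw [this]
  exact (realize_map f _ z).symm

lemma intervalCoord_const {n : SimplexCategory} (x : X.obj (op n)) (z) (e : Fin 2) :
    intervalCoord (realize ((const (stdSimplex.obj₀Equiv.{u}.symm e) : X ⟶ Δ[1]).app _ x) z) =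
      (if e = 0 then 0 else 1) := by
  apply Subtype.ext
  rw [intervalCoord_realize, _root_.stdSimplex.map_apply']
  have : ∀ k, (stdSimplex.objEquiv ((const (stdSimplex.obj₀Equiv.{u}.symm e) : X ⟶ Δ[1]).app _ x))
      k = e := fun k ↦ rfl
  simp only [this]
  have := z.2.2
  fin_cases e <;> simp

lemma toTop_const_zero (w : |X|) :
    toTop.map (const (stdSimplex.obj₀Equiv.{u}.symm 0) : X ⟶ Δ[1]) w = intervalPath 0 := by
  obtain ⟨n, x, z, rfl⟩ := exists_realize w
  rw [← intervalPath_intervalCoord (toTop.map _ _), toTop_map_realize]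
  have := intervalCoord_const x z 0
  simp only [if_true] at this
  rw [this]

lemma toTop_const_one (w : |X|) :
    toTop.map (const (stdSimplex.obj₀Equiv.{u}.symm 1) : X ⟶ Δ[1]) w = intervalPath 1 := by
  obtain ⟨n, x, z, rfl⟩ := exists_realize w
  rw [← intervalPath_intervalCoord (toTop.map _ _), toTop_map_realize]
  have := intervalCoord_const x z 1
  simp only [one_ne_zero, if_false] at this
  rw [this]

/-- The curried homotopy attached to a map out of a cylinder. -/
lemma exists_curry_cylinder {T : Type u} [TopologicalSpace T] (u : C(|X ⊗ Δ[1]|, T)) :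
    ∃ K : C(|X|, C(I, T)),
      (∀ w : |X ⊗ Δ[1]|, u w = K (toTop.map (fst X _) w) (intervalCoord (toTop.map (snd X _) w))) ∧
      (∀ x, K x 0 = u (toTop.map ι₀ x)) ∧ (∀ x, K x 1 = u (toTop.map ι₁ x)) := by
  obtain ⟨ψ, hψ⟩ := exists_toTop_tensor_curry u
  let K : C(|X|, C(I, T)) :=
    ⟨fun x ↦ (ψ x).comp intervalPath, (ContinuousMap.continuous_precomp _).comp ψ.continuous⟩
  have hK (w : |X ⊗ Δ[1]|) :
      u w = K (toTop.map (fst X _) w) (intervalCoord (toTop.map (snd X _) w)) := by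
    rw [← hψ]
    exact congrArg _ (intervalPath_intervalCoord _).symm
  refine ⟨K, hK, fun x ↦ ?_, fun x ↦ ?_⟩
  · rw [hK, toTop_map_comp_apply, toTop_map_comp_apply, ι₀_fst, ι₀_snd, toTop_const_zero,
      intervalCoord_intervalPath, toTop.map_id]
    rfl
  · rw [hK, toTop_map_comp_apply, toTop_map_comp_apply, ι₁_fst, ι₁_snd, toTop_const_one,
      intervalCoord_intervalPath, toTop.map_id]
    rfl

lemma toTop_homotopic {f g : X ⟶ Y} (h : X ⊗ Δ[1] ⟶ Y) (h₀ : ι₀ ≫ h = f) (h₁ : ι₁ ≫ h = g) :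
    (toTop.map f).hom.Homotopic (toTop.map g).hom := by
  obtain ⟨K, -, hK₀, hK₁⟩ := exists_curry_cylinder (toTop.map h).hom
  refine ⟨TopCat.homotopyOfCurry K _ _ (fun x ↦ ?_) (fun x ↦ ?_)⟩
  · rw [hK₀, ← h₀]
    exact toTop_map_comp_apply _ _ _
  · rw [hK₁, ← h₁]
    exact toTop_map_comp_apply _ _ _

end SSet

end

/-! ### Horn retractions; singular simplicial sets are Kan complexes. -/

section

open Simplicial Opposite MonoidalCategory CartesianMonoidalCategory unitInterval

namespace stdSimplex

variable {n : ℕ}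

/-- The smallest barycentric coordinate different from the `i`-th one. -/
noncomputable def minCoord (i : Fin (n + 2)) (x : stdSimplex ℝ (Fin (n + 2))) : ℝ :=
  Finset.univ.inf' Finset.univ_nonempty (fun j ↦ x (i.succAbove j))

lemma continuous_minCoord (i : Fin (n + 2)) : Continuous (minCoord i) :=
  Continuous.finset_inf'_apply _ fun _ _ ↦ (continuous_apply _).comp continuous_subtype_val

lemma minCoord_nonneg (i : Fin (n + 2)) (x : stdSimplex ℝ (Fin (n + 2))) : 0 ≤ minCoord i x := by
  simp [minCoord, Finset.le_inf'_iff]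

lemma minCoord_le (i : Fin (n + 2)) (x : stdSimplex ℝ (Fin (n + 2))) (j : Fin (n + 1)) :
    minCoord i x ≤ x (i.succAbove j) :=
  Finset.inf'_le _ (Finset.mem_univ j)

lemma exists_minCoord_eq (i : Fin (n + 2)) (x : stdSimplex ℝ (Fin (n + 2))) :
    ∃ j, x (i.succAbove j) = minCoord i x := by
  obtain ⟨j, -, h⟩ := Finset.exists_mem_eq_inf' Finset.univ_nonempty (fun j ↦ x (i.succAbove j))
  exact ⟨j, h.symm⟩

/-- The retraction of the simplex onto its `i`-th horn. -/
noncomputable def hornRetraction (i : Fin (n + 2)) (x : stdSimplex ℝ (Fin (n + 2))) :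
    stdSimplex ℝ (Fin (n + 2)) :=
  -- The same amount is removed from the `n + 1` other coordinates until one of them vanishes, and
  -- the removed mass goes to vertex `i`.
  ⟨i.insertNth (x i + (n + 1) * minCoord i x) (fun j ↦ x (i.succAbove j) - minCoord i x), by
    constructor
    · intro j
      obtain rfl | ⟨j, rfl⟩ := i.eq_self_or_eq_succAbove j
      · have := minCoord_nonneg j x
        have := x.2.1 j
        simp only [Fin.insertNth_apply_same]
        positivity
      · simpa using minCoord_le i x j
    · have : x i + ∑ j, x (i.succAbove j) = 1 := by
        rw [← Fin.sum_univ_succAbove]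
        exact x.2.2
      rw [Fin.sum_univ_succAbove _ i]
      simp only [Fin.insertNth_apply_same, Fin.insertNth_apply_succAbove, Finset.sum_sub_distrib,
        Finset.sum_const, Finset.card_univ, Fintype.card_fin, nsmul_eq_mul]
      push_cast
      linarith⟩

lemma hornRetraction_apply_self (i : Fin (n + 2)) (x : stdSimplex ℝ (Fin (n + 2))) :
    hornRetraction i x i = x i + (n + 1) * minCoord i x :=
  Fin.insertNth_apply_same (α := fun _ ↦ ℝ) i (x i + (n + 1) * minCoord i x)
    (fun j ↦ x (i.succAbove j) - minCoord i x)

lemma hornRetraction_apply_succAbove (i : Fin (n + 2)) (x : stdSimplex ℝ (Fin (n + 2)))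
    (j : Fin (n + 1)) :
    hornRetraction i x (i.succAbove j) = x (i.succAbove j) - minCoord i x :=
  Fin.insertNth_apply_succAbove (α := fun _ ↦ ℝ) i (x i + (n + 1) * minCoord i x)
    (fun j ↦ x (i.succAbove j) - minCoord i x) j

lemma continuous_hornRetraction (i : Fin (n + 2)) : Continuous (hornRetraction i) := by
  refine Continuous.subtype_mk (continuous_pi fun j ↦ ?_) _
  have h (k : Fin (n + 2)) : Continuous fun x : stdSimplex ℝ (Fin (n + 2)) ↦ x k :=
    (continuous_apply k).comp continuous_subtype_val
  have h' := continuous_minCoord i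
  obtain rfl | ⟨j, rfl⟩ := i.eq_self_or_eq_succAbove j
  · simp only [Fin.insertNth_apply_same]
    exact (h _).add (continuous_const.mul h')
  · simp only [Fin.insertNth_apply_succAbove]
    exact (h _).sub h'

lemma hornRetraction_eq_self (i : Fin (n + 2)) (x : stdSimplex ℝ (Fin (n + 2)))
    (hx : ∃ j, x (i.succAbove j) = 0) : hornRetraction i x = x := by
  obtain ⟨j, hj⟩ := hx
  have h : minCoord i x = 0 :=
    le_antisymm (hj ▸ minCoord_le i x j) (minCoord_nonneg i x)
  ext k
  obtain rfl | ⟨k, rfl⟩ := i.eq_self_or_eq_succAbove k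
  · rw [hornRetraction_apply_self, h]; simp
  · rw [hornRetraction_apply_succAbove, h]; simp

lemma exists_hornRetraction_eq_zero (i : Fin (n + 2)) (x : stdSimplex ℝ (Fin (n + 2))) :
    ∃ j, hornRetraction i x (i.succAbove j) = 0 := by
  obtain ⟨j, hj⟩ := exists_minCoord_eq i x
  exact ⟨j, by rw [hornRetraction_apply_succAbove, hj, sub_self]⟩

/-- Omit a vanishing barycentric coordinate. -/
noncomputable def dropCoord (j : Fin (n + 2)) (x : stdSimplex ℝ (Fin (n + 2))) (hx : x j = 0) :
    stdSimplex ℝ (Fin (n + 1)) :=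
  ⟨fun k ↦ x (j.succAbove k), fun k ↦ x.2.1 _, by
    have h : x j + ∑ k, x (j.succAbove k) = 1 := by
      rw [← Fin.sum_univ_succAbove]
      exact x.2.2
    rwa [hx, zero_add] at h⟩

lemma map_dropCoord (j : Fin (n + 2)) (x : stdSimplex ℝ (Fin (n + 2))) (hx : x j = 0) :
    map j.succAbove (dropCoord j x hx) = x := by
  ext k
  rw [map_apply']
  obtain rfl | ⟨k, rfl⟩ := j.eq_self_or_eq_succAbove k
  · simp [hx, Fin.succAbove_ne]
  · simp [Finset.filter_eq']
    rfl

end stdSimplex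

namespace SSet

variable {X Y : SSet.{u}}

lemma injective_toTop_map (f : X ⟶ Y) [Mono f] : Function.Injective (toTop.map f) := by
  intro w w' h
  obtain ⟨n, x, z, rfl⟩ := exists_realize w
  obtain ⟨m, y, z', rfl⟩ := exists_realize w'
  rw [toTop_map_realize, toTop_map_realize] at h
  obtain ⟨p, t, α, β, rfl, rfl, h₃⟩ := exists_of_realize_eq h
  rw [← realize_map, ← realize_map]
  refine DFunLike.congr_fun (congrArg realize ?_) t
  rw [← NatTrans.naturality_apply, ← NatTrans.naturality_apply] at h₃
  have : Mono (f.app (op p)) := inferInstance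
  exact (mono_iff_injective _).1 this h₃

/-- Where a given coordinate other than the `i`-th vanishes, the lift to the horn goes through the
corresponding face, hence is continuous. These loci are finitely many closed sets covering the
simplex, and the lifts agree because the realized horn injects into the realized simplex. -/
lemma exists_hornRetraction {n : ℕ} (i : Fin (n + 2)) :
    ∃ ρ : C(_root_.stdSimplex ℝ (Fin (n + 2)), |(Λ[n + 1, i] : SSet.{u})|), ∀ x,
      toTop.map Λ[n + 1, i].ι (ρ x) =
        realize (stdSimplex.objEquiv.symm (𝟙 ⦋n + 1⦌) : (Δ[n + 1] : SSet.{u}).obj (op ⦋n + 1⦌))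
          (_root_.stdSimplex.hornRetraction i x) := by
  let r := _root_.stdSimplex.hornRetraction i
  let face (j : Fin (n + 1)) : (Λ[n + 1, i] : SSet.{u}).obj (op ⦋n⦌) :=
    (horn.ι i (i.succAbove j) (i.succAbove_ne j)).app _ (stdSimplex.objEquiv.symm (𝟙 ⦋n⦌))
  have hface (j : Fin (n + 1)) (x) (hx : r x (i.succAbove j) = 0) :
      toTop.map Λ[n + 1, i].ι (realize (face j) (_root_.stdSimplex.dropCoord _ _ hx)) =
        realize (stdSimplex.objEquiv.symm (𝟙 ⦋n + 1⦌) : (Δ[n + 1] : SSet.{u}).obj (op ⦋n + 1⦌))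
          (r x) := by
    rw [toTop_map_realize]
    have h₁ : (Λ[n + 1, i].ι).app _ (face j) = (Δ[n + 1] : SSet.{u}).map
        (SimplexCategory.δ (i.succAbove j)).op (stdSimplex.objEquiv.symm (𝟙 ⦋n + 1⦌)) := by
      have := congr_arg (fun f : Δ[n] ⟶ Δ[n + 1] ↦ f.app (op ⦋n⦌) (stdSimplex.objEquiv.symm (𝟙 ⦋n⦌)))
        (horn.ι_ι.{u} i (i.succAbove j) (i.succAbove_ne j))
      exact this
    rw [h₁, realize_map]
    congr 1
    exact _root_.stdSimplex.map_dropCoord _ _ hx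
  have hex (x) : ∃ w : |(Λ[n + 1, i] : SSet.{u})|, toTop.map Λ[n + 1, i].ι w =
      realize (stdSimplex.objEquiv.symm (𝟙 ⦋n + 1⦌) : (Δ[n + 1] : SSet.{u}).obj (op ⦋n + 1⦌))
          (r x) := by
    obtain ⟨j, hj⟩ := _root_.stdSimplex.exists_hornRetraction_eq_zero i x
    exact ⟨_, hface j x hj⟩
  choose ρ hρ using hex
  refine ⟨⟨ρ, ?_⟩, hρ⟩
  have hr : Continuous r := _root_.stdSimplex.continuous_hornRetraction i
  have hcoord (k : Fin (n + 2)) :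
      Continuous fun x : _root_.stdSimplex ℝ (Fin (n + 2)) ↦ r x k :=
    (continuous_apply k).comp (continuous_subtype_val.comp hr)
  refine (locallyFinite_of_finite
    (fun j : Fin (n + 1) ↦ {x | r x (i.succAbove j) = 0})).continuous ?_ ?_ ?_
  · rw [Set.eq_univ_iff_forall]
    intro x
    obtain ⟨j, hj⟩ := _root_.stdSimplex.exists_hornRetraction_eq_zero i x
    exact Set.mem_iUnion.2 ⟨j, hj⟩
  · exact fun j ↦ isClosed_eq (hcoord _) continuous_const
  · intro j
    rw [continuousOn_iff_continuous_domRestrict]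
    have : Continuous (fun x : {x | r x (i.succAbove j) = 0} ↦
        realize (face j) (_root_.stdSimplex.dropCoord _ _ x.2)) := by
      refine (realize _).continuous.comp (Continuous.subtype_mk (continuous_pi fun k ↦ ?_) _)
      exact (hcoord _).comp continuous_subtype_val
    refine this.congr fun x ↦ ?_
    apply injective_toTop_map Λ[n + 1, i].ι
    rw [hface j x.1 x.2]
    exact (hρ x.1).symm

lemma exists_toTop_horn_retraction {n : ℕ} (i : Fin (n + 2)) :
    ∃ R : |(Δ[n + 1] : SSet.{u})| ⟶ |(Λ[n + 1, i] : SSet.{u})|,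
      toTop.map Λ[n + 1, i].ι ≫ R = 𝟙 _ := by
  obtain ⟨ρ, hρ⟩ := exists_hornRetraction.{u} i
  obtain ⟨R, hR⟩ := exists_toTop_desc (X := (Δ[n + 1] : SSet.{u}))
    (T := |(Λ[n + 1, i] : SSet.{u})|)
    (fun m s ↦ ρ.comp ⟨_, _root_.stdSimplex.continuous_map (stdSimplex.objEquiv s)⟩)
    (fun m m' α s z ↦ by
      refine congrArg ρ ?_
      change _root_.stdSimplex.map (stdSimplex.objEquiv _) z = _root_.stdSimplex.map _ _
      rw [← map_comp_apply']
      rfl)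
  refine ⟨R, toTop_hom_ext fun m s z ↦ ?_⟩
  apply injective_toTop_map Λ[n + 1, i].ι
  change toTop.map Λ[n + 1, i].ι (R (toTop.map Λ[n + 1, i].ι (realize s z))) =
    toTop.map Λ[n + 1, i].ι (realize s z)
  rw [toTop_map_realize, hR]
  obtain ⟨s, hs⟩ := s
  obtain ⟨f, rfl⟩ := stdSimplex.objEquiv.symm.surjective s
  change toTop.map Λ[n + 1, i].ι (ρ (_root_.stdSimplex.map f z)) =
    realize (stdSimplex.objEquiv.symm f) z
  rw [hρ, _root_.stdSimplex.hornRetraction_eq_self]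
  · exact (realize_map f _ z).symm
  · rw [mem_horn_iff] at hs
    obtain ⟨k, hk⟩ := (Set.ne_univ_iff_exists_notMem _).1 hs
    simp only [Set.mem_union, not_or, Set.mem_singleton_iff] at hk
    obtain ⟨j, rfl⟩ := Fin.exists_succAbove_eq hk.2
    refine ⟨j, ?_⟩
    rw [_root_.stdSimplex.map_apply', Finset.sum_eq_zero]
    intro l hl
    simp only [Finset.mem_filter, Finset.mem_univ, true_and] at hl
    exact absurd ⟨l, hl⟩ hk.1

open HomotopicalAlgebra modelCategoryQuillen in
/-- The singular simplicial set of a topological space is a Kan complex. -/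
instance kanComplex_toSSet (T : TopCat.{u}) : KanComplex (TopCat.toSSet.obj T) := by
  refine (isFibrant_iff _).2 ((modelCategoryQuillen.fibration_iff _).2 ?_)
  intro _ _ _ hf
  simp only [J, MorphismProperty.iSup_iff] at hf
  obtain ⟨n, ⟨i⟩⟩ := hf
  refine ⟨fun {t _} _ ↦ ?_⟩
  obtain ⟨R, hR⟩ := exists_toTop_horn_retraction i
  refine ⟨⟨{
    l := sSetTopAdj.homEquiv _ _ (R ≫ (sSetTopAdj.homEquiv _ _).symm t)
    fac_left := ?_
    fac_right := by subsingleton }⟩⟩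
  rw [← Adjunction.homEquiv_naturality_left, reassoc_of% hR, Equiv.apply_symm_apply]

end SSet

end

/-! ### Homotopy extension for monomorphisms, and factorizations. -/

section

open Simplicial Opposite MonoidalCategory CartesianMonoidalCategory Limits
  HomotopicalAlgebra

namespace SSet

variable {X Y : SSet.{u}}

open modelCategoryQuillen in
-- The face omitting vertex `1` is the vertex `0`, that is, the horn `Λ[1, 0]`.
lemma anodyneExtensions_δ_one : anodyneExtensions.{u} (stdSimplex.δ (1 : Fin 2)) := by
  intro E B p hp
  have : Fibration p := (HomotopicalAlgebra.fibration_iff _).2 hp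
  refine ⟨fun {t b} sq ↦ ?_⟩
  obtain ⟨φ, hφ, hφ'⟩ := horn.IsCompatible.exists_lift (i := (0 : Fin 2)) (n := 0)
    (f := fun _ _ ↦ t) (by simp) p b (fun j hj ↦ by
      obtain rfl : j = 1 := by fin_cases j <;> simp_all
      exact sq.w)
  exact ⟨⟨⟨φ, hφ 1 (by simp), hφ'⟩⟩⟩

lemma whiskerLeft_δ_one (X : SSet.{u}) :
    X ◁ stdSimplex.δ (1 : Fin 2) = fst X Δ[0] ≫ ι₀ := by
  refine CartesianMonoidalCategory.hom_ext _ _ ?_ ?_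
  · simp
  · simp only [whiskerLeft_snd, Category.assoc]
    have (s t : X ⊗ Δ[0] ⟶ Δ[0]) : s = t := stdSimplex.isTerminalObj₀.hom_ext _ _
    rw [this (snd X Δ[0]) (const (stdSimplex.obj₀Equiv.symm 0))]
    rfl

open modelCategoryQuillen in
lemma exists_extension_of_anodyne {S : SSet.{u}} [KanComplex S] {f : X ⟶ Y}
    (hf : anodyneExtensions f) (t : X ⟶ S) : ∃ l : Y ⟶ S, f ≫ l = t := by
  have : HasLiftingProperty f (terminal.from S) := hf _ (by
    rw [← HomotopicalAlgebra.fibration_iff]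
    exact (isFibrant_iff S).1 inferInstance)
  have sq : CommSq t f (terminal.from S) (terminal.from _) := ⟨by subsingleton⟩
  exact ⟨sq.lift, sq.fac_left⟩

/-- The pushout-product of a monomorphism with the anodyne vertex inclusion is anodyne, and maps
into a Kan complex extend along anodyne maps. -/
lemma exists_homotopy_extension {S : SSet.{u}} [KanComplex S] (i : X ⟶ Y) [Mono i]
    (v : Y ⟶ S) (H : X ⊗ Δ[1] ⟶ S) (hH : ι₀ ≫ H = i ≫ v) :
    ∃ F : Y ⊗ Δ[1] ⟶ S, ι₀ ≫ F = v ∧ i ▷ Δ[1] ≫ F = H := by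
  let sq := Functor.PushoutObjObj.ofHasPushout (curriedTensor SSet.{u}) i (stdSimplex.δ (1 : Fin 2))
  have w : i ▷ Δ[0] ≫ fst Y Δ[0] ≫ v = X ◁ stdSimplex.δ (1 : Fin 2) ≫ H := by
    rw [whiskerLeft_δ_one, Category.assoc, hH, whiskerRight_fst_assoc]
  obtain ⟨F, hF⟩ := exists_extension_of_anodyne
    (anodyneExtensions_pushoutObjObjι sq anodyneExtensions_δ_one) (sq.isPushout.desc _ _ w)
  refine ⟨F, ?_, ?_⟩
  · have h₁ : Y ◁ stdSimplex.δ (1 : Fin 2) ≫ F = fst Y Δ[0] ≫ v := by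
      rw [← sq.isPushout.inl_desc _ _ w, ← hF, sq.inl_ι_assoc]
      rfl
    rw [whiskerLeft_δ_one] at h₁
    have h₂ := congrArg (lift (𝟙 Y) (const (stdSimplex.obj₀Equiv.symm 0)) ≫ ·) h₁
    simpa using h₂
  · rw [← sq.isPushout.inr_desc _ _ w, ← hF, sq.inr_ι_assoc]
    rfl

lemma homEquiv_symm_comp_apply {T : TopCat.{u}} (f : X ⟶ Y) (v : Y ⟶ TopCat.toSSet.obj T)
    (x : |X|) : (sSetTopAdj.homEquiv _ _).symm v (toTop.map f x) =
      (sSetTopAdj.homEquiv _ _).symm (f ≫ v) x := by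
  rw [Adjunction.homEquiv_naturality_left_symm]
  rfl

/-- The realization of a monomorphism has the homotopy extension property. -/
lemma hep_toTop_map (i : X ⟶ Y) [Mono i] : TopCat.HEP (toTop.map i) := by
  intro T v H hH
  -- The extension problem is transposed to the singular simplicial set of `T`, a Kan complex,
  -- solved there and transposed back.
  let v' : Y ⟶ TopCat.toSSet.obj T := sSetTopAdj.homEquiv _ _ (TopCat.ofHom v)
  let H₀ : |X ⊗ Δ[1]| ⟶ T := TopCat.ofHom
    ⟨fun w ↦ H (toTop.map (fst _ _) w) (intervalCoord (toTop.map (snd _ _) w)), by fun_prop⟩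
  let H' : X ⊗ Δ[1] ⟶ TopCat.toSSet.obj T := sSetTopAdj.homEquiv _ _ H₀
  have w : ι₀ ≫ H' = i ≫ v' := by
    rw [← Adjunction.homEquiv_naturality_left, ← Adjunction.homEquiv_naturality_left]
    congr 1
    ext x
    change H (toTop.map (fst _ _) (toTop.map ι₀ x)) (intervalCoord (toTop.map (snd _ _)
      (toTop.map ι₀ x))) = v (toTop.map i x)
    rw [toTop_map_comp_apply, toTop_map_comp_apply, ι₀_fst, ι₀_snd, toTop_const_zero,
      intervalCoord_intervalPath, ← hH, toTop.map_id]
    rfl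
  obtain ⟨F, hF, hF'⟩ := exists_homotopy_extension i v' H' w
  obtain ⟨K, hK, hK₀, -⟩ := exists_curry_cylinder ((sSetTopAdj.homEquiv _ _).symm F).hom
  refine ⟨K, fun b ↦ ?_, fun a ↦ ?_⟩
  · rw [hK₀]
    refine (homEquiv_symm_comp_apply ι₀ F b).trans ?_
    rw [hF, Equiv.symm_apply_apply]
    rfl
  · ext t
    obtain ⟨w, hw⟩ := toTopProd_bijective.2 (a, intervalPath t)
    obtain ⟨rfl, hw₂⟩ := Prod.ext_iff.1 hw
    have h := hK (toTop.map (i ▷ Δ[1]) w)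
    rw [toTop_fst_whiskerRight, toTop_snd_whiskerRight] at h
    have hw₂' : toTop.map (snd X Δ[1]) w = intervalPath t := hw₂
    rw [hw₂', intervalCoord_intervalPath] at h
    refine h.symm.trans ((homEquiv_symm_comp_apply _ F w).trans ?_)
    rw [hF', Equiv.symm_apply_apply]
    change H (toTop.map (fst _ _) w) (intervalCoord (toTop.map (snd _ _) w)) = _
    rw [hw₂', intervalCoord_intervalPath]
    rfl

/-! ### Factorizations -/

attribute [local instance] Cardinal.fact_isRegular_aleph0 Cardinal.orderBotAleph0OrdToType

open modelCategoryQuillen MorphismProperty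

instance isSmall_generatingCofibrations : MorphismProperty.IsSmall.{u} I.{u} :=
  isSmall_ofHoms ..

instance isCardinalForSmallObjectArgument_generatingCofibrations :
    IsCardinalForSmallObjectArgument I.{u} Cardinal.aleph0.{u} where
  preservesColimit {A B X Y} i hi f hf := by
    have : IsFinitelyPresentable.{u} A := by
      obtain ⟨n⟩ := hi
      infer_instance
    infer_instance

instance hasSmallObjectArgument_generatingCofibrations : HasSmallObjectArgument.{u} I.{u} :=
  ⟨.aleph0, inferInstance, inferInstance, inferInstance⟩

lemma llp_rlp_I_le_monomorphisms : I.{u}.rlp.llp ≤ monomorphisms SSet.{u} := by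
  rw [llp_rlp_of_hasSmallObjectArgument, retracts_le_iff]
  refine (transfiniteCompositions_monotone.{u} ?_).trans (transfiniteCompositions_le _)
  rw [pushouts_le_iff, coproducts_le_iff]
  exact I_le_monomorphisms

lemma exists_factorization (f : X ⟶ Y) :
    ∃ (E : SSet.{u}) (j : X ⟶ E) (p : E ⟶ Y), Mono j ∧ I.rlp p ∧ j ≫ p = f := by
  let d := (MorphismProperty.factorizationData I.rlp.llp I.rlp f)
  exact ⟨d.Z, d.i, d.p, llp_rlp_I_le_monomorphisms _ d.hi, d.hp, d.fac⟩

end SSet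

end

/-! ### Weak equivalences of simplicial sets under colimits. -/

section

open Simplicial Opposite MonoidalCategory CartesianMonoidalCategory Limits HomotopicalAlgebra
open SSet.modelCategoryQuillen

namespace SSet

variable {X Y : SSet.{u}}

/-- The two ends of the cylinder. -/
def cylinderEnds (X : SSet.{u}) : (X ⊗ Δ[1]).Subcomplex where
  obj n := {s | (∀ k, stdSimplex.objEquiv s.2 k = 0) ∨ ∀ k, stdSimplex.objEquiv s.2 k = 1}
  map φ s hs := by
    obtain h | h := hs
    · exact Or.inl fun k ↦ h _
    · exact Or.inr fun k ↦ h _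

open Classical in
/-- The morphism from the ends of the cylinder determined by a pair of morphisms. -/
noncomputable def cylinderEndsDesc (f g : X ⟶ Y) : (cylinderEnds X : SSet.{u}) ⟶ Y where
  app n := ↾fun s ↦ if stdSimplex.objEquiv s.1.2 0 = 0 then f.app _ s.1.1 else g.app _ s.1.1
  naturality n m φ := by
    ext ⟨s, hs⟩
    have h : (stdSimplex.objEquiv ((X ⊗ Δ[1]).map φ s).2 0 = 0) ↔
        (stdSimplex.objEquiv s.2 0 = 0) := by
      change stdSimplex.objEquiv s.2 _ = 0 ↔ _
      obtain h | h := hs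
      · rw [h, h]
      · rw [h, h]
    by_cases h' : stdSimplex.objEquiv s.2 0 = 0
    · exact (if_pos (h.2 h')).trans ((NatTrans.naturality_apply f φ s.1).trans
        (congrArg (Y.map φ) (if_pos h').symm))
    · exact (if_neg (h.not.2 h')).trans ((NatTrans.naturality_apply g φ s.1).trans
        (congrArg (Y.map φ) (if_neg h').symm))

lemma cylinderEndsDesc_fst (f g : X ⟶ Y) {n : SimplexCategoryᵒᵖ} (s : (cylinderEnds X).obj n)
    (h : stdSimplex.objEquiv s.1.2 0 = 0) : (cylinderEndsDesc f g).app _ s = f.app _ s.1.1 :=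
  if_pos h

lemma cylinderEndsDesc_snd (f g : X ⟶ Y) {n : SimplexCategoryᵒᵖ} (s : (cylinderEnds X).obj n)
    (h : stdSimplex.objEquiv s.1.2 0 ≠ 0) : (cylinderEndsDesc f g).app _ s = g.app _ s.1.1 :=
  if_neg h

/-- Trivial fibrations are shrinkable. -/
lemma exists_section_homotopy {p : X ⟶ Y} (hp : I.rlp p) :
    ∃ (s : Y ⟶ X) (h : X ⊗ Δ[1] ⟶ X), s ≫ p = 𝟙 Y ∧ ι₀ ≫ h = 𝟙 X ∧ ι₁ ≫ h = p ≫ s ∧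
      h ≫ p = fst X Δ[1] ≫ p := by
  rw [← rlp_monomorphisms] at hp
  -- Trivial fibrations lift against every monomorphism: lifting from the empty set yields the
  -- section, lifting from the ends of the cylinder yields the fibrewise homotopy.
  have : HasLiftingProperty (initial.to Y) p := hp _ (inferInstanceAs (Mono (initial.to Y)))
  have sq : CommSq (initial.to X) (initial.to Y) p (𝟙 Y) := ⟨by simp⟩
  have hs := sq.fac_right
  have : HasLiftingProperty (cylinderEnds X).ι p :=
    hp _ (inferInstanceAs (Mono (cylinderEnds X).ι))
  have sq' : CommSq (cylinderEndsDesc (𝟙 X) (p ≫ sq.lift)) (cylinderEnds X).ι p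
      (fst X Δ[1] ≫ p) := ⟨by
    ext n s
    change p.app _ ((cylinderEndsDesc (𝟙 X) (p ≫ sq.lift)).app _ s) = p.app _ s.1.1
    by_cases h : stdSimplex.objEquiv s.1.2 0 = 0
    · rw [cylinderEndsDesc_fst _ _ _ h]
      rfl
    · rw [cylinderEndsDesc_snd _ _ _ h]
      change ((p ≫ sq.lift) ≫ p).app _ _ = _
      rw [Category.assoc, hs, Category.comp_id]⟩
  refine ⟨sq.lift, sq'.lift, hs, ?_, ?_, sq'.fac_right⟩
  · ext n x
    let s : (cylinderEnds X).obj n := ⟨ι₀.app _ x, Or.inl fun _ ↦ rfl⟩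
    have := ConcreteCategory.congr_hom (NatTrans.congr_app sq'.fac_left n) s
    exact this.trans (cylinderEndsDesc_fst _ _ s rfl)
  · ext n x
    let s : (cylinderEnds X).obj n := ⟨ι₁.app _ x, Or.inr fun _ ↦ rfl⟩
    have := ConcreteCategory.congr_hom (NatTrans.congr_app sq'.fac_left n) s
    refine this.trans (cylinderEndsDesc_snd _ _ s ?_)
    change (1 : Fin 2) ≠ 0
    simp

lemma isShrinkable_toTop_map {p : X ⟶ Y} (hp : I.rlp p) :
    TopCat.IsShrinkable (toTop.map p) := by
  obtain ⟨s, h, hs, h₀, h₁, hh⟩ := exists_section_homotopy hp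
  obtain ⟨K, hK, hK₀, hK₁⟩ := exists_curry_cylinder (toTop.map h).hom
  refine ⟨(toTop.map s).hom, fun y ↦ ?_, K, fun x ↦ ?_, fun x ↦ ?_, fun x t ↦ ?_⟩
  · refine (toTop_map_comp_apply _ _ _).trans ?_
    rw [hs, toTop.map_id]
    rfl
  · rw [hK₀]
    refine (toTop_map_comp_apply _ _ _).trans ?_
    rw [h₀, toTop.map_id]
    rfl
  · rw [hK₁]
    refine (toTop_map_comp_apply _ _ _).trans ?_
    rw [h₁]
    exact (toTop_map_comp_apply _ _ _).symm
  · obtain ⟨w, hw⟩ := toTopProd_bijective.2 (x, intervalPath t)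
    obtain ⟨rfl, hw₂⟩ := Prod.ext_iff.1 hw
    have hw₂' : toTop.map (snd X Δ[1]) w = intervalPath t := hw₂
    have := hK w
    rw [hw₂', intervalCoord_intervalPath] at this
    change toTop.map p (K (toTop.map (fst _ _) w) t) = toTop.map p (toTop.map (fst _ _) w)
    rw [← this]
    refine (toTop_map_comp_apply _ _ _).trans ?_
    rw [hh]
    exact (toTop_map_comp_apply _ _ _).symm

lemma isHtpyEquiv_of_rlp {p : X ⟶ Y} (hp : I.rlp p) : TopCat.IsHtpyEquiv (toTop.map p) :=
  (isShrinkable_toTop_map hp).isHtpyEquiv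

/-! ### Pushouts -/

variable {A B C D : SSet.{u}} {i : A ⟶ B} {k : A ⟶ C} {h : B ⟶ D} {j : C ⟶ D}

lemma isHtpyEquiv_of_isPushout_of_mono (sq : IsPushout i k h j) [Mono i]
    (hi : TopCat.IsHtpyEquiv (toTop.map i)) : TopCat.IsHtpyEquiv (toTop.map j) :=
  (TopCat.IsSDR.of_isPushout (sq.map toTop) ((hep_toTop_map i).isSDR hi)).isHtpyEquiv

/-- Left properness. Factor `k` as a monomorphism `k'` followed by a trivial fibration `p` and cut
the square in two: `k'` is an equivalence by two-out-of-three, so its pushout is a deformation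
retract inclusion; the other half pushes the shrinkable `p` out along a monomorphism. -/
lemma isHtpyEquiv_of_isPushout (sq : IsPushout i k h j) [Mono i]
    (hk : TopCat.IsHtpyEquiv (toTop.map k)) : TopCat.IsHtpyEquiv (toTop.map h) := by
  obtain ⟨E, k', p, hk', hp, rfl⟩ := exists_factorization k
  have hi : Mono (pushout.inr i k') :=
    MorphismProperty.of_isPushout (P := .monomorphisms SSet.{u})
      (IsPushout.of_hasPushout i k').flip (inferInstanceAs (Mono i))
  have w : i ≫ h = k' ≫ p ≫ j := by rw [sq.w, Category.assoc]
  have sq' : IsPushout p (pushout.inr i k') j (pushout.desc h (p ≫ j) w) := by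
    refine (IsPushout.of_left (h₁₁ := k') (v₁₁ := i) (h₂₁ := pushout.inl i k') ?_ ?_
      (IsPushout.of_hasPushout i k').flip)
    · rw [pushout.inl_desc]
      exact sq.flip
    · exact (pushout.inr_desc ..).symm
  have h₁ : TopCat.IsHtpyEquiv (toTop.map k') := by
    rw [Functor.map_comp] at hk
    exact (isHtpyEquiv_of_rlp hp).of_comp_right hk
  have h₂ : TopCat.IsHtpyEquiv (toTop.map (pushout.inl i k')) :=
    isHtpyEquiv_of_isPushout_of_mono (IsPushout.of_hasPushout i k').flip h₁
  have h₃ := (isShrinkable_toTop_map hp).isHtpyEquiv_of_isPushout (sq'.flip.map toTop)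
    (hep_toTop_map _)
  have := h₂.comp h₃
  rwa [← Functor.map_comp, pushout.inl_desc] at this

/-! ### Sequential colimits -/

/-- Simplices and their boundaries are finitely presentable, so a lifting problem against the
colimit already lives, and commutes, at a finite stage. -/
lemma rlp_of_isColimit {F G : ℕ ⥤ SSet.{u}} (α : F ⟶ G) (hα : ∀ n, I.rlp (α.app n))
    {cF : Cocone F} {cG : Cocone G} (hF : IsColimit cF) (hG : IsColimit cG) (p : cF.pt ⟶ cG.pt)
    (hp : ∀ n, cF.ι.app n ≫ p = α.app n ≫ cG.ι.app n) : I.rlp p := by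
  have := Cardinal.fact_isRegular_aleph0.{u}
  have : IsCardinalFiltered ℕ Cardinal.aleph0.{u} :=
    (isCardinalFiltered_aleph0_iff _).2 inferInstance
  rintro _ _ _ ⟨d⟩
  refine ⟨fun {t b} sq ↦ ?_⟩
  obtain ⟨n₁, t₁, rfl⟩ := IsCardinalPresentable.exists_hom_of_isColimit Cardinal.aleph0.{u} hF t
  obtain ⟨n₂, b₂, rfl⟩ := IsCardinalPresentable.exists_hom_of_isColimit Cardinal.aleph0.{u} hG b
  obtain ⟨m, u, v, hm⟩ := IsCardinalPresentable.exists_eq_of_isColimit Cardinal.aleph0.{u} hG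
    (t₁ ≫ α.app n₁) (∂Δ[d].ι ≫ b₂) (by simpa [hp] using sq.w)
  have := hα m _ ⟨d⟩
  have sq' : CommSq (t₁ ≫ F.map u) ∂Δ[d].ι (α.app m) (b₂ ≫ G.map v) := ⟨by simpa using hm⟩
  refine ⟨⟨⟨sq'.lift ≫ cF.ι.app m, ?_, ?_⟩⟩⟩
  · simp
  · simp [hp]

/-- A factorization of a sequence into monomorphisms and trivial fibrations. -/
structure SequenceStage (X : SSet.{u}) where
  /-- the total object -/
  E : SSet.{u}
  /-- the projection -/
  p : E ⟶ X
  rlp : I.rlp p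

lemma exists_next_stage {X Y : SSet.{u}} (f : X ⟶ Y) (s : SequenceStage X) :
    ∃ (t : SequenceStage Y) (j : s.E ⟶ t.E), Mono j ∧ j ≫ t.p = s.p ≫ f := by
  obtain ⟨E, j, p, hj, hp, h⟩ := exists_factorization (s.p ≫ f)
  exact ⟨⟨E, p, hp⟩, j, hj, h⟩

/-- The colimit of a sequence of weak equivalences. -/
lemma isHtpyEquiv_of_isColimit {F : ℕ ⥤ SSet.{u}} {c : Cocone F} (hc : IsColimit c)
    (hF : ∀ n, TopCat.IsHtpyEquiv (toTop.map (F.map (homOfLE (Nat.le_succ n))))) :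
    TopCat.IsHtpyEquiv (toTop.map (c.ι.app 0)) := by
  choose next j hj hjp using fun (n : ℕ) (s : SequenceStage (F.obj n)) ↦
    exists_next_stage (F.map (homOfLE (Nat.le_succ n))) s
  -- The sequence is replaced by one of monomorphisms mapping to it by trivial fibrations. Starting
  -- from the identity of `F.obj 0` makes the leg at stage `0` comparable without correction.
  let s (n : ℕ) : SequenceStage (F.obj n) :=
    Nat.rec ⟨F.obj 0, 𝟙 _, MorphismProperty.rlp_of_isIso ..⟩ (fun n s ↦ next n s) n
  let G : ℕ ⥤ SSet.{u} := Functor.ofSequence (X := fun n ↦ (s n).E) (fun n ↦ j n (s n))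
  have hG (n : ℕ) : G.map (homOfLE (Nat.le_succ n)) = j n (s n) :=
    Functor.ofSequence_map_homOfLE_succ _ n
  let α : G ⟶ F := NatTrans.ofSequence (fun n ↦ (s n).p) (fun n ↦ by
    exact (congrArg (· ≫ (s (n + 1)).p) (hG n)).trans (hjp n (s n)))
  have hα (n : ℕ) : I.rlp (α.app n) := (s n).rlp
  let p : colimit G ⟶ c.pt := colimMap α ≫ (colimit.isoColimitCocone ⟨c, hc⟩).hom
  have hp (n : ℕ) : colimit.ι G n ≫ p = α.app n ≫ c.ι.app n := by simp [p]
  have h₁ : TopCat.IsHtpyEquiv (toTop.map p) :=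
    isHtpyEquiv_of_rlp (rlp_of_isColimit α hα (colimit.isColimit G) hc p hp)
  have h₂ : TopCat.IsHtpyEquiv (toTop.map (colimit.ι G 0)) := by
    refine TopCat.isHtpyEquiv_of_isColimit_of_isSDR (X := G ⋙ toTop)
      (isColimitOfPreserves toTop (colimit.isColimit G)) (fun n ↦ ?_)
    have : Mono (G.map (homOfLE (Nat.le_succ n))) := by rw [hG]; exact hj n _
    refine (hep_toTop_map _).isSDR ?_
    refine (isHtpyEquiv_of_rlp (hα (n + 1))).of_comp_right ?_
    rw [← Functor.map_comp, α.naturality, Functor.map_comp]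
    exact (isHtpyEquiv_of_rlp (hα n)).comp (hF n)
  have := h₂.comp h₁
  rw [← Functor.map_comp, hp] at this
  have h0 : α.app 0 ≫ c.ι.app 0 = c.ι.app 0 := Category.id_comp _
  rwa [h0] at this

/-! ### Coproducts -/

lemma isHtpyEquiv_of_isColimit_cofan {J : Type u} {X Y : J → SSet.{u}} {f : ∀ j, X j ⟶ Y j}
    (hf : ∀ j, TopCat.IsHtpyEquiv (toTop.map (f j))) {cX : Cofan X} {cY : Cofan Y}
    (hX : IsColimit cX) (hY : IsColimit cY) (g : cX.pt ⟶ cY.pt)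
    (hg : ∀ j, cX.inj j ≫ g = f j ≫ cY.inj j) : TopCat.IsHtpyEquiv (toTop.map g) := by
  have key {Z : J → SSet.{u}} {c : Cofan Z} (hc : IsColimit c) :
      IsColimit (Cofan.mk c.pt c.inj) := hc.ofIsoColimit (Cofan.ext (Iso.refl _))
  refine TopCat.isHtpyEquiv_of_isColimit_cofan hf
    (isColimitCofanMkObjOfIsColimit toTop _ _ (key hX))
    (isColimitCofanMkObjOfIsColimit toTop _ _ (key hY)) (toTop.map g) (fun j ↦ ?_)
  exact (toTop.map_comp _ _).symm.trans ((congrArg toTop.map (hg j)).trans (toTop.map_comp _ _))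

end SSet

end

/-! ### Nerves of functor categories and their corepresentability. -/

section

open Simplicial Opposite MonoidalCategory CartesianMonoidalCategory Limits

section

variable {C D : Type u} [Category.{u} C] [Category.{u} D]

/-- The cylinder of nerves attached to a natural transformation. -/
def nerveHomotopy {F G : C ⥤ D} (α : F ⟶ G) : nerve C ⊗ Δ[1] ⟶ nerve D where
  app n := ↾fun s ↦
    (Functor.prod' (SSet.stdSimplex.objEquiv s.2).toOrderHom.monotone.functor s.1 ⋙
      Functor.uncurry.obj (ComposableArrows.mk₁ α) : ComposableArrows D n.unop.len)
  naturality _ _ _ := rfl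

lemma ι₀_nerveHomotopy {F G : C ⥤ D} (α : F ⟶ G) :
    SSet.ι₀ ≫ nerveHomotopy α = nerveMap F := by
  ext n x
  refine CategoryTheory.Functor.ext (fun t ↦ rfl) (fun s t f ↦ ?_)
  refine Eq.trans ?_ ((Category.id_comp _).trans (Category.comp_id _)).symm
  exact Category.id_comp _

lemma ι₁_nerveHomotopy {F G : C ⥤ D} (α : F ⟶ G) :
    SSet.ι₁ ≫ nerveHomotopy α = nerveMap G := by
  ext n x
  refine CategoryTheory.Functor.ext (fun t ↦ rfl) (fun s t f ↦ ?_)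
  refine Eq.trans ?_ ((Category.id_comp _).trans (Category.comp_id _)).symm
  exact Category.id_comp _

lemma homotopic_nerveMap {F G : C ⥤ D} (α : F ⟶ G) :
    (SSet.toTop.map (nerveMap F)).hom.Homotopic (SSet.toTop.map (nerveMap G)).hom :=
  SSet.toTop_homotopic (nerveHomotopy α) (ι₀_nerveHomotopy α) (ι₁_nerveHomotopy α)

/-- A natural transformation in either direction realizes to a homotopy, and homotopy is symmetric.
-/
lemma IsCatWeakEquivalence.of_natTrans {F : C ⥤ D} (G : D ⥤ C)
    (h₁ : Nonempty (F ⋙ G ⟶ 𝟭 C) ∨ Nonempty (𝟭 C ⟶ F ⋙ G))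
    (h₂ : Nonempty (G ⋙ F ⟶ 𝟭 D) ∨ Nonempty (𝟭 D ⟶ G ⋙ F)) : IsCatWeakEquivalence F := by
  have key {A B : Type u} [Category.{u} A] [Category.{u} B] {F : A ⥤ B} {G : B ⥤ A}
      (h : Nonempty (F ⋙ G ⟶ 𝟭 A) ∨ Nonempty (𝟭 A ⟶ F ⋙ G)) :
      ((SSet.toTop.map (nerveMap G)).hom.comp (SSet.toTop.map (nerveMap F)).hom).Homotopic
        (.id _) := by
    have h₁ : (SSet.toTop.map (nerveMap (F ⋙ G))).hom =
        (SSet.toTop.map (nerveMap G)).hom.comp (SSet.toTop.map (nerveMap F)).hom :=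
      congrArg TopCat.Hom.hom (SSet.toTop.map_comp (nerveMap F) (nerveMap G))
    have h₂ : (SSet.toTop.map (nerveMap (𝟭 A))).hom = .id _ :=
      congrArg TopCat.Hom.hom (SSet.toTop.map_id (nerve A))
    rw [← h₁, ← h₂]
    obtain ⟨⟨α⟩⟩ | ⟨⟨α⟩⟩ := h
    · exact homotopic_nerveMap α
    · exact (homotopic_nerveMap α).symm
  exact TopCat.isHtpyEquiv_of_homotopic (SSet.toTop.map (nerveMap F)) _ (key h₁) (key h₂)

end

/-- The nerve of the category of functors out of `I`. -/
def funNerve (I : Cat.{u, u}) : Cat.{u, u} ⥤ SSet.{u} where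
  obj X := nerve (I ⥤ X)
  map F := nerveMap (funCatMap I F.toFunctor)

/-- Weak equivalences of categories of functors out of `I`. -/
def IsFunEquiv (I : Cat.{u, u}) {X Y : Cat.{u, u}} (F : X ⟶ Y) : Prop :=
  TopCat.IsHtpyEquiv (SSet.toTop.map ((funNerve I).map F))

namespace IsFunEquiv

variable {I X Y Z : Cat.{u, u}}

lemma comp {F : X ⟶ Y} {G : Y ⟶ Z} (hF : IsFunEquiv I F) (hG : IsFunEquiv I G) :
    IsFunEquiv I (F ≫ G) := by
  unfold IsFunEquiv at *
  rw [Functor.map_comp, Functor.map_comp]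
  exact TopCat.IsHtpyEquiv.comp hF hG

lemma of_comp_left {F : X ⟶ Y} {G : Y ⟶ Z} (hF : IsFunEquiv I F) (hG : IsFunEquiv I (F ≫ G)) :
    IsFunEquiv I G := by
  unfold IsFunEquiv at *
  rw [Functor.map_comp, Functor.map_comp] at hG
  exact hF.of_comp_left hG

lemma of_comp_right {F : X ⟶ Y} {G : Y ⟶ Z} (hG : IsFunEquiv I G) (hFG : IsFunEquiv I (F ≫ G)) :
    IsFunEquiv I F := by
  unfold IsFunEquiv at *
  rw [Functor.map_comp, Functor.map_comp] at hFG
  exact hG.of_comp_right hFG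

lemma of_isIso (F : X ⟶ Y) [IsIso F] : IsFunEquiv I F :=
  SSet.isHtpyEquiv_toTop_map_of_isIso _

/-- Postcomposition with a natural transformation. -/
abbrev whiskerRightHom (I : Cat.{u, u}) {A B : Type u} [Category.{u} A] [Category.{u} B]
    {F G : A ⥤ B} (α : F ⟶ G) :
    (Functor.whiskeringRight I A B).obj F ⟶ (Functor.whiskeringRight I A B).obj G :=
  (Functor.whiskeringRight I A B).map α

lemma of_natTrans {F : X ⟶ Y} (G : (Y : Type u) ⥤ X)
    (h₁ : Nonempty (F.toFunctor ⋙ G ⟶ 𝟭 X) ∨ Nonempty (𝟭 X ⟶ F.toFunctor ⋙ G))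
    (h₂ : Nonempty (G ⋙ F.toFunctor ⟶ 𝟭 Y) ∨ Nonempty (𝟭 Y ⟶ G ⋙ F.toFunctor)) :
    IsFunEquiv I F := by
  refine IsCatWeakEquivalence.of_natTrans (F := funCatMap I F.toFunctor) (funCatMap I G) ?_ ?_
  · exact h₁.imp (Nonempty.map (whiskerRightHom I)) (Nonempty.map (whiskerRightHom I))
  · exact h₂.imp (Nonempty.map (whiskerRightHom I)) (Nonempty.map (whiskerRightHom I))

end IsFunEquiv

/-- The small category parametrizing `n`-simplices of categories of functors. -/
abbrev chainCat (I : Cat.{u, u}) (n : ℕ) : Cat.{u, u} := Cat.of (AsSmall.{u} (Fin (n + 1)) × I)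

/-- The chains of functors are functors out of a product. -/
def chainEquiv (I X : Cat.{u, u}) (n : ℕ) :
    ComposableArrows (I ⥤ X) n ≃ (chainCat I n ⟶ X) where
  toFun F := (AsSmall.down.prod (𝟭 I) ⋙ Functor.uncurry.obj F).toCatHom
  invFun G := Functor.curry.obj ((AsSmall.up.prod (𝟭 I)) ⋙ G.toFunctor)
  left_inv F := Functor.curry_obj_uncurry_obj F
  right_inv G := by
    refine Cat.ext ?_
    change AsSmall.down.prod (𝟭 I) ⋙ Functor.uncurry.obj (Functor.curry.obj
      ((AsSmall.up.prod (𝟭 I)) ⋙ G.toFunctor)) = _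
    rw [Functor.uncurry_obj_curry_obj]
    rfl

/-- Simplices of nerves of functor categories are corepresentable. -/
def funNerveIso (I : Cat.{u, u}) (n : SimplexCategoryᵒᵖ) :
    funNerve I ⋙ (evaluation _ _).obj n ≅ coyoneda.obj (op (chainCat I n.unop.len)) :=
  NatIso.ofComponents (fun X ↦ (chainEquiv I X n.unop.len).toIso) (fun _ ↦ by
    ext F
    refine Cat.ext (CategoryTheory.Functor.ext (fun p ↦ rfl) (fun p q g ↦ ?_))
    refine Eq.trans ?_ ((Category.id_comp _).trans (Category.comp_id _)).symm
    exact (Functor.map_comp _ _ _).symm)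

section

variable {I : Cat.{u, u}} {J : Type*} [Category* J] {K : J ⥤ Cat.{u, u}}

/-- Colimits of simplicial sets are computed degreewise, and each degree is corepresented by
`chainCat I n`. -/
lemma nonempty_isColimit_funNerve (c : Cocone K)
    (h : ∀ n, Nonempty (IsColimit ((coyoneda.obj (op (chainCat I n))).mapCocone c))) :
    Nonempty (IsColimit ((funNerve I).mapCocone c)) :=
  ⟨evaluationJointlyReflectsColimits _ fun n ↦
    IsColimit.mapCoconeEquiv (funNerveIso I n).symm (h n.unop.len).some⟩

lemma nonempty_isLimit_funNerve (c : Cone K) (hc : IsLimit c) :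
    Nonempty (IsLimit ((funNerve I).mapCone c)) :=
  ⟨evaluationJointlyReflectsLimits _ fun n ↦
    IsLimit.mapConeEquiv (funNerveIso I n).symm (isLimitOfPreserves _ hc)⟩

lemma isPushout_funNerve {W₁ W₂ B D : Cat.{u, u}} {t : W₁ ⟶ W₂} {l : W₁ ⟶ B} {r : W₂ ⟶ D}
    {b : B ⟶ D}
    (h : ∀ n, IsPushout ((coyoneda.obj (op (chainCat I n))).map t)
      ((coyoneda.obj (op (chainCat I n))).map l) ((coyoneda.obj (op (chainCat I n))).map r)
      ((coyoneda.obj (op (chainCat I n))).map b)) :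
    IsPushout ((funNerve I).map t) ((funNerve I).map l) ((funNerve I).map r)
      ((funNerve I).map b) := by
  have h' (n : SimplexCategoryᵒᵖ) : IsPushout (((funNerve I).map t).app n)
      (((funNerve I).map l).app n) (((funNerve I).map r).app n) (((funNerve I).map b).app n) :=
    (h n.unop.len).of_iso ((funNerveIso I n).symm.app _) ((funNerveIso I n).symm.app _)
      ((funNerveIso I n).symm.app _) ((funNerveIso I n).symm.app _)
      ((funNerveIso I n).inv.naturality t) ((funNerveIso I n).inv.naturality l)
      ((funNerveIso I n).inv.naturality r) ((funNerveIso I n).inv.naturality b)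
  exact
    { w := NatTrans.ext (funext fun n ↦ (h' n).w)
      isColimit' := ⟨evaluationJointlyReflectsColimits _ fun n ↦
        (isColimitMapCoconePushoutCoconeEquiv _ _).2 (h' n).isColimit⟩ }

lemma mono_funNerve_map {X Y : Cat.{u, u}} (F : X ⟶ Y)
    (h : ∀ n, Function.Injective ((coyoneda.obj (op (chainCat I n))).map F)) :
    Mono ((funNerve I).map F) := by
  rw [NatTrans.mono_iff_mono_app]
  intro n
  have : Mono ((coyoneda.obj (op (chainCat I n.unop.len))).map F) := (mono_iff_injective _).2 (h _)
  have e := (funNerveIso I n).hom.naturality F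
  have : Mono ((funNerve I ⋙ (evaluation _ _).obj n).map F ≫ (funNerveIso I n).hom.app Y) := by
    rw [e]
    exact mono_comp _ _
  exact mono_of_mono ((funNerve I ⋙ (evaluation _ _).obj n).map F) ((funNerveIso I n).hom.app Y)

/-- The empty category is vacuously strongly connected but gives no weakly initial object, so it
needs its own argument: there is exactly one functor out of it. -/
lemma isFunEquiv_of_isEmpty [IsEmpty I] {X Y : Cat.{u, u}} (F : X ⟶ Y) : IsFunEquiv I F := by
  have h (Z : Cat.{u, u}) (n : ℕ) (G G' : chainCat I n ⟶ Z) : G = G' :=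
    Cat.ext (CategoryTheory.Functor.ext (fun p ↦ isEmptyElim p.2) (fun p ↦ isEmptyElim p.2))
  have hne (Z : Cat.{u, u}) (n : ℕ) : Nonempty (chainCat I n ⟶ Z) :=
    ⟨Functor.toCatHom
      { obj p := isEmptyElim (α := I) p.2
        map {p _} _ := isEmptyElim (α := I) p.2
        map_id p := isEmptyElim (α := I) p.2
        map_comp {p _ _} _ _ := isEmptyElim (α := I) p.2 }⟩
  have : IsIso ((funNerve I).map F) := by
    rw [NatTrans.isIso_iff_isIso_app]
    intro n
    rw [isIso_iff_bijective]
    constructor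
    · intro a b _
      exact (chainEquiv I X n.unop.len).injective (h _ _ _ _)
    · intro b
      obtain ⟨a⟩ := hne X n.unop.len
      exact ⟨(chainEquiv I X n.unop.len).symm a, (chainEquiv I Y n.unop.len).injective (h _ _ _ _)⟩
  exact SSet.isHtpyEquiv_toTop_map_of_isIso _

end

end

/-! ### Coproducts and finite products. -/

section

open Simplicial Opposite MonoidalCategory CartesianMonoidalCategory Limits

section

variable {P X Y : Type*} [Category* P] [Category* X] [Category* Y]

lemma exists_functor_comp_eq (F : X ⥤ Y) [F.Full] [F.Faithful] (G : P ⥤ Y)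
    (h : ∀ p, ∃ x, F.obj x = G.obj p) : ∃ G' : P ⥤ X, G' ⋙ F = G := by
  choose x hx using h
  refine ⟨{ obj := x
            map {p q} f := F.preimage (eqToHom (hx p) ≫ G.map f ≫ eqToHom (hx q).symm)
            map_id p := F.map_injective (by simp)
            map_comp f g := F.map_injective (by simp) }, ?_⟩
  exact CategoryTheory.Functor.ext hx (fun p q f ↦ by simp)

lemma functor_comp_injective (F : X ⥤ Y) [F.Faithful] (hF : Function.Injective F.obj)
    {G G' : P ⥤ X} (h : G ⋙ F = G' ⋙ F) : G = G' := by
  have hobj (p : P) : G.obj p = G'.obj p := hF (Functor.congr_obj h p)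
  refine CategoryTheory.Functor.ext hobj (fun p q f ↦ F.map_injective ?_)
  have := Functor.congr_hom h f
  simpa [eqToHom_map] using this

end

/-- A category with a weakly initial object. -/
def HasWeaklyInitial (P : Type*) [Category* P] : Prop := ∃ p₀ : P, ∀ p, Nonempty (p₀ ⟶ p)

/-- The object `(0, i)` reaches everything, for any `i`. This is how strong connectivity enters the
proof. -/
lemma hasWeaklyInitial_chainCat (I : Cat.{u, u}) [Nonempty I] (hI : IsStronglyConnectedCat I)
    (n : ℕ) : HasWeaklyInitial (chainCat I n) := by
  obtain ⟨i⟩ := ‹Nonempty I›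
  refine ⟨⟨⟨0⟩, i⟩, fun p ↦ ⟨?_⟩⟩
  exact ⟨ULift.up (homOfLE (Fin.zero_le _)), (hI i p.2).some⟩

section

variable {J : Type u} (X : J → Cat.{u, u})

/-- The disjoint union of categories. -/
abbrev sigmaCofan : Cofan X :=
  Cofan.mk (Cat.of (Σ j, X j)) (fun j ↦ (Sigma.incl (C := fun j ↦ X j) j).toCatHom)

/-- The disjoint union of categories is a coproduct. -/
def sigmaCofanIsColimit : IsColimit (sigmaCofan X) :=
  Cofan.IsColimit.mk _ (fun s ↦ (Sigma.desc (fun j ↦ (s.inj j).toFunctor)).toCatHom)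
    (fun s j ↦ Cat.ext rfl)
    (fun s m hm ↦ by
      refine Cat.ext (CategoryTheory.Functor.ext (fun ⟨j, x⟩ ↦ ?_) ?_)
      · exact Functor.congr_obj (congrArg Cat.Hom.toFunctor (hm j)) x
      · rintro ⟨j, x⟩ ⟨_, y⟩ ⟨f⟩
        exact Functor.congr_hom (congrArg Cat.Hom.toFunctor (hm j)) f)

variable {X}

/-- Morphisms of a disjoint union stay in one component, so a functor out of `P` lands in the
component of the image of the weakly initial object, and this component is unique. -/
lemma nonempty_isColimit_coyoneda_cofan {P : Cat.{u, u}} (hP : HasWeaklyInitial P)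
    {c : Cofan X} (hc : IsColimit c) :
    Nonempty (IsColimit ((coyoneda.obj (op P)).mapCocone c)) := by
  obtain ⟨p₀, hp₀⟩ := hP
  refine Nonempty.map (fun h ↦ IsColimit.ofIsoColimit
    ((isColimitMapCoconeCofanMkEquiv (coyoneda.obj (op P)) X _).symm h)
    ((Cocone.functoriality _ _).mapIso ((sigmaCofanIsColimit X).uniqueUpToIso hc))) ?_
  rw [Cofan.nonempty_isColimit_iff_bijective_fromSigma]
  constructor
  · rintro ⟨j, G⟩ ⟨j', G'⟩ h
    replace h : G.toFunctor ⋙ Sigma.incl (C := fun j ↦ X j) j =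
        G'.toFunctor ⋙ Sigma.incl (C := fun j ↦ X j) j' :=
      congrArg (Cat.Hom.toFunctor (C := P) (D := Cat.of (Σ j, X j))) h
    obtain rfl : j = j' := congrArg Sigma.fst (Functor.congr_obj h p₀)
    obtain rfl : G = G' := Cat.ext (functor_comp_injective _ (fun x y h ↦ by simpa using h) h)
    rfl
  · intro (G : P ⟶ Cat.of (Σ j, X j))
    obtain ⟨G', hG'⟩ := exists_functor_comp_eq
      (Sigma.incl (C := fun j ↦ X j) (G.toFunctor.obj p₀).1) G.toFunctor (fun p ↦ by
        obtain ⟨f⟩ := hp₀ p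
        have key {a b : Σ j, X j} (f : a ⟶ b) : ∃ x, (Sigma.incl a.1).obj x = b := by
          obtain ⟨f⟩ := f
          exact ⟨_, rfl⟩
        exact key (G.toFunctor.map f))
    exact ⟨⟨_, G'.toCatHom⟩, Cat.ext hG'⟩

lemma isFunEquiv_of_isColimit_cofan {I : Cat.{u, u}} (hI : IsStronglyConnectedCat I)
    {Y : J → Cat.{u, u}} {f : ∀ j, X j ⟶ Y j} (hf : ∀ j, IsFunEquiv I (f j)) {cX : Cofan X}
    {cY : Cofan Y} (hX : IsColimit cX) (hY : IsColimit cY) (g : cX.pt ⟶ cY.pt)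
    (hg : ∀ j, cX.inj j ≫ g = f j ≫ cY.inj j) : IsFunEquiv I g := by
  obtain _ | _ := isEmpty_or_nonempty I
  · exact isFunEquiv_of_isEmpty g
  have key {Z : J → Cat.{u, u}} {c : Cofan Z} (hc : IsColimit c) : Nonempty (IsColimit
      (Cofan.mk ((funNerve I).obj c.pt) (fun j ↦ (funNerve I).map (c.inj j)))) := by
    have hc' : IsColimit (Cofan.mk c.pt c.inj) := hc.ofIsoColimit (Cofan.ext (Iso.refl _))
    exact (nonempty_isColimit_funNerve _ (fun n ↦ nonempty_isColimit_coyoneda_cofan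
      (hasWeaklyInitial_chainCat I hI n) hc')).map (isColimitMapCoconeCofanMkEquiv _ _ _)
  refine SSet.isHtpyEquiv_of_isColimit_cofan hf (key hX).some (key hY).some _ (fun j ↦ ?_)
  exact ((funNerve I).map_comp _ _).symm.trans
    ((congrArg (funNerve I).map (hg j)).trans ((funNerve I).map_comp _ _))

end

namespace SSet

section

variable {J : Type u}

/-- The product of a family of simplicial sets. -/
def pi (X : J → SSet.{u}) : SSet.{u} where
  obj n := ∀ j, (X j).obj n
  map φ := ↾fun x j ↦ (X j).map φ (x j)

/-- The projections of the product of a family of simplicial sets. -/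
abbrev piFan (X : J → SSet.{u}) : Fan X := Fan.mk (pi X) (fun j ↦ { app n := ↾fun x ↦ x j })

/-- The product of a family of simplicial sets is a product. -/
def piFanIsLimit (X : J → SSet.{u}) : IsLimit (piFan X) :=
  Fan.IsLimit.mk _ (fun s ↦
    { app n := ↾fun x j ↦ (s.proj j).app n x
      naturality n m φ := by
        ext x
        exact funext fun j ↦ ConcreteCategory.congr_hom ((s.proj j).naturality φ) x })
    (fun s j ↦ rfl)
    (fun s m hm ↦ NatTrans.ext (funext fun n ↦ by
      ext x
      exact funext fun j ↦ ConcreteCategory.congr_hom (congrArg (fun (t : s.pt ⟶ X j) ↦ t.app n) (hm j)) x))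

/-- The product of a family of morphisms of simplicial sets. -/
def piMap {X Y : J → SSet.{u}} (f : ∀ j, X j ⟶ Y j) : pi X ⟶ pi Y where
  app n := ↾fun x j ↦ (f j).app n (x j)
  naturality n m φ := by
    ext x
    exact funext fun j ↦ ConcreteCategory.congr_hom ((f j).naturality φ) (x j)

/-- Reindexing of products. -/
def piCongr {J' : Type u} (e : J ≃ J') (X : J' → SSet.{u}) : pi X ≅ pi (fun j ↦ X (e j)) :=
  NatIso.ofComponents (fun n ↦ (e.symm.piCongrLeft' (fun j ↦ (X j).obj n)).toIso)

/-- The product of a family indexed by an option type. -/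
def piOption (X : Option J → SSet.{u}) :
    pi X ≅ X none ⊗ pi (fun j ↦ X (some j)) :=
  NatIso.ofComponents (fun n ↦ (Equiv.piOptionEquivProd (β := fun j ↦ (X j).obj n)).toIso)

end

lemma isHtpyEquiv_of_iso {X Y X' Y' : SSet.{u}} {f : X ⟶ Y} {g : X' ⟶ Y'} (e₁ : X ≅ X')
    (e₂ : Y ≅ Y') (h : e₁.hom ≫ g = f ≫ e₂.hom) (hg : TopCat.IsHtpyEquiv (toTop.map g)) :
    TopCat.IsHtpyEquiv (toTop.map f) := by
  refine TopCat.IsHtpyEquiv.of_comp_right (isHtpyEquiv_toTop_map_of_isIso e₂.hom) ?_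
  rw [← toTop.map_comp, ← h, toTop.map_comp]
  exact TopCat.IsHtpyEquiv.comp (isHtpyEquiv_toTop_map_of_isIso e₁.hom) hg

lemma isHtpyEquiv_piMap {J : Type u} [Finite J] {X Y : J → SSet.{u}} {f : ∀ j, X j ⟶ Y j}
    (hf : ∀ j, TopCat.IsHtpyEquiv (toTop.map (f j))) :
    TopCat.IsHtpyEquiv (toTop.map (piMap f)) := by
  induction J using Finite.induction_empty_option with
  | of_equiv e ih =>
    exact isHtpyEquiv_of_iso (piCongr e X) (piCongr e Y) rfl (ih (fun j ↦ hf (e j)))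
  | h_empty =>
    have : IsIso (piMap f) := by
      rw [NatTrans.isIso_iff_isIso_app]
      intro n
      rw [isIso_iff_bijective]
      exact ⟨fun x y _ ↦ funext (fun j ↦ j.elim), fun x ↦ ⟨fun j ↦ j.elim, funext (fun j ↦ j.elim)⟩⟩
    exact isHtpyEquiv_toTop_map_of_isIso _
  | h_option ih =>
    refine isHtpyEquiv_of_iso (piOption X) (piOption Y)
      -- One factor is changed at a time, so only products with a fixed simplicial set are needed.
      (g := f none ▷ pi (fun j ↦ X (some j)) ≫ Y none ◁ piMap (fun j ↦ f (some j))) rfl ?_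
    rw [toTop.map_comp]
    exact TopCat.IsHtpyEquiv.comp (isHtpyEquiv_whiskerRight (hf none) _)
      (isHtpyEquiv_whiskerLeft (ih (fun j ↦ hf (some j))) _)

/-- Finite products of weak equivalences are weak equivalences. -/
lemma isHtpyEquiv_of_isLimit_fan {J : Type u} [Finite J] {X Y : J → SSet.{u}}
    {f : ∀ j, X j ⟶ Y j} (hf : ∀ j, TopCat.IsHtpyEquiv (toTop.map (f j))) {cX : Fan X} {cY : Fan Y}
    (hX : IsLimit cX) (hY : IsLimit cY) (g : cX.pt ⟶ cY.pt)
    (hg : ∀ j, g ≫ cY.proj j = cX.proj j ≫ f j) : TopCat.IsHtpyEquiv (toTop.map g) := by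
  refine isHtpyEquiv_of_iso (hX.conePointUniqueUpToIso (piFanIsLimit X))
    (hY.conePointUniqueUpToIso (piFanIsLimit Y)) ?_ (isHtpyEquiv_piMap hf)
  refine Fan.IsLimit.hom_ext (piFanIsLimit Y) _ _ (fun j ↦ ?_)
  have e₁ := hX.conePointUniqueUpToIso_hom_comp (piFanIsLimit X) ⟨j⟩
  have e₂ := hY.conePointUniqueUpToIso_hom_comp (piFanIsLimit Y) ⟨j⟩
  have e₃ : piMap f ≫ (piFan Y).proj j = (piFan X).proj j ≫ f j := rfl
  refine (Category.assoc _ _ _).trans ?_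
  rw [Category.assoc, e₃]
  refine Eq.trans ?_ ((congrArg (g ≫ ·) e₂).trans (hg j)).symm
  exact (Category.assoc _ _ _).symm.trans (congrArg (· ≫ f j) e₁)

end SSet

lemma isFunEquiv_of_isLimit_fan {I : Cat.{u, u}} {J : Type u} [Finite J]
    {X Y : J → Cat.{u, u}} {f : ∀ j, X j ⟶ Y j} (hf : ∀ j, IsFunEquiv I (f j)) {cX : Fan X}
    {cY : Fan Y} (hX : IsLimit cX) (hY : IsLimit cY) (g : cX.pt ⟶ cY.pt)
    (hg : ∀ j, g ≫ cY.proj j = cX.proj j ≫ f j) : IsFunEquiv I g := by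
  have key {Z : J → Cat.{u, u}} {c : Fan Z} (hc : IsLimit c) : Nonempty (IsLimit
      (Fan.mk ((funNerve I).obj c.pt) (fun j ↦ (funNerve I).map (c.proj j)))) := by
    have hc' : IsLimit (Fan.mk c.pt c.proj) := hc.ofIsoLimit (Fan.ext (Iso.refl _))
    exact (nonempty_isLimit_funNerve _ hc').map (isLimitMapConeFanMkEquiv _ _ _)
  refine SSet.isHtpyEquiv_of_isLimit_fan hf (key hX).some (key hY).some _ (fun j ↦ ?_)
  exact ((funNerve I).map_comp _ _).symm.trans
    ((congrArg (funNerve I).map (hg j)).trans ((funNerve I).map_comp _ _))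

end

/-! ### The collage along a cosieve and its left neighborhood. -/

section

open Opposite Limits

/-- The data of a collage of `C` and `V`: a cosieve `W` of `V` and a functor `ρ` from `W` to `C`.
The morphisms of the collage from `c` to `v` are the morphisms from `c` to `ρ v`, for `v` in `W`. -/
structure CollageData (C V : Type u) [Category.{u} C] [Category.{u} V] where
  /-- the cosieve -/
  W : ObjectProperty V
  up : ∀ {v v' : V}, (v ⟶ v') → W v → W v'
  /-- the functor -/
  ρ : W.FullSubcategory ⥤ C

/-- The objects of the collage. -/
inductive Collage {C V : Type u} [Category.{u} C] [Category.{u} V] (S : CollageData C V) : Type u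
  | left (c : C) : Collage S
  | right (v : V) : Collage S

namespace Collage

section

variable {C V : Type u} [Category.{u} C] [Category.{u} V] {S : CollageData C V}

/-- The morphisms of the collage. -/
def Hom : Collage S → Collage S → Type u
  | left c, left c' => c ⟶ c'
  | left c, right v => Σ' h : S.W v, c ⟶ S.ρ.obj ⟨v, h⟩
  | right _, left _ => PEmpty
  | right v, right v' => v ⟶ v'

/-- The identity morphisms of the collage. -/
def id : ∀ x : Collage S, Hom x x
  | left c => 𝟙 c
  | right v => 𝟙 v

/-- The composition in the collage. -/
def comp : ∀ {x y z : Collage S}, Hom x y → Hom y z → Hom x z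
  | left c, left _, left c', f, g => (f ≫ g : (c : C) ⟶ c')
  | left c, left _, right v, f, g => ⟨g.1, (f ≫ g.2 : (c : C) ⟶ S.ρ.obj ⟨v, g.1⟩)⟩
  | left _, right v, right v', f, g =>
    ⟨S.up g f.1, f.2 ≫ S.ρ.map (X := ⟨v, f.1⟩) (Y := ⟨v', S.up g f.1⟩) (ObjectProperty.homMk g)⟩
  | right v, right _, right v', f, g => (f ≫ g : (v : V) ⟶ v')
  | _, right _, left _, _, g => g.elim
  | right _, left _, _, f, _ => f.elim

instance : Category.{u} (Collage S) where
  Hom := Hom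
  id := id
  comp := comp
  id_comp {x y} f := by
    obtain c | v := x <;> obtain c' | v' := y
    · exact Category.id_comp (X := c) (Y := c') f
    · exact congrArg (PSigma.mk f.1) (Category.id_comp f.2)
    · exact f.elim
    · exact Category.id_comp (X := v) (Y := v') f
  comp_id {x y} f := by
    obtain c | v := x <;> obtain c' | v' := y
    · exact Category.comp_id (X := c) (Y := c') f
    · refine congrArg (PSigma.mk f.1) ?_
      exact (congrArg (f.2 ≫ ·) (S.ρ.map_id _)).trans (Category.comp_id f.2)
    · exact f.elim
    · exact Category.comp_id (X := v) (Y := v') f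
  assoc {w x y z} f g h := by
    obtain a | a := w <;> obtain b | b := x <;> obtain c | c := y <;> obtain d | d := z
    · exact Category.assoc (W := a) (X := b) (Y := c) (Z := d) f g h
    · exact congrArg (PSigma.mk h.1) (Category.assoc (W := a) (X := b) (Y := c) f g h.2)
    · exact h.elim
    · exact congrArg (PSigma.mk (S.up h g.1)) (Category.assoc (W := a) (X := b) f g.2 _)
    · exact g.elim
    · exact g.elim
    · exact h.elim
    · refine congrArg (PSigma.mk (S.up h (S.up g f.1))) ?_
      refine (Category.assoc _ _ _).trans (congrArg (f.2 ≫ ·) ?_)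
      exact (S.ρ.map_comp (X := ⟨b, f.1⟩) (Y := ⟨c, S.up g f.1⟩)
        (Z := ⟨d, S.up h (S.up g f.1)⟩) (ObjectProperty.homMk g) (ObjectProperty.homMk h)).symm
    · exact f.elim
    · exact f.elim
    · exact f.elim
    · exact f.elim
    · exact g.elim
    · exact g.elim
    · exact h.elim
    · exact Category.assoc (W := a) (X := b) (Y := c) (Z := d) f g h

variable (S) in
/-- The inclusion of the left part. -/
def inl : C ⥤ Collage S where
  obj c := left c
  map f := f

variable (S) in
/-- The inclusion of the right part. -/
def inr : V ⥤ Collage S where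
  obj v := right v
  map f := f

instance : (inr S).Full := ⟨fun f ↦ ⟨f, rfl⟩⟩

instance : (inr S).Faithful := ⟨fun h ↦ h⟩

lemma inr_obj_injective : Function.Injective (inr S).obj := fun _ _ h ↦ by
  injection h

/-- A morphism of the collage from the left part to the right part. -/
def cross {c : C} {v : V} (h : S.W v) (f : c ⟶ S.ρ.obj ⟨v, h⟩) :
    (inl S).obj c ⟶ (inr S).obj v := ⟨h, f⟩

lemma inl_map_comp_cross {c c' : C} {v : V} (h : S.W v) (f : c ⟶ c')
    (g : c' ⟶ S.ρ.obj ⟨v, h⟩) : (inl S).map f ≫ cross h g = cross h (f ≫ g) := rfl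

lemma cross_comp_inr_map {c : C} {v v' : V} (h : S.W v) (f : c ⟶ S.ρ.obj ⟨v, h⟩) (g : v ⟶ v') :
    cross h f ≫ (inr S).map g = cross (S.up g h) (f ≫ S.ρ.map (ObjectProperty.homMk g)) := rfl

lemma cross_eq {c : C} {v : V} (h : S.W v) (f : c ⟶ S.ρ.obj ⟨v, h⟩) :
    cross h f = (inl S).map f ≫ cross h (𝟙 _) := by
  rw [inl_map_comp_cross, Category.comp_id]

lemma hom_cases {motive : ∀ {x y : Collage S}, (x ⟶ y) → Prop}
    (hl : ∀ {c c' : C} (f : c ⟶ c'), motive ((inl S).map f))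
    (hr : ∀ {v v' : V} (f : v ⟶ v'), motive ((inr S).map f))
    (hc : ∀ {c : C} {v : V} (h : S.W v) (f : c ⟶ S.ρ.obj ⟨v, h⟩), motive (cross h f))
    {x y : Collage S} (f : x ⟶ y) : motive f := by
  obtain c | v := x <;> obtain c' | v' := y
  · exact hl f
  · exact hc f.1 f.2
  · exact PEmpty.elim f
  · exact hr f

section desc

variable {T : Type*} [Category* T] (q : C ⥤ T) (s : V ⥤ T) (α : S.ρ ⋙ q ⟶ S.W.ι ⋙ s)

/-- Functors out of the collage. -/
def desc : Collage S ⥤ T where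
  obj
    | left c => q.obj c
    | right v => s.obj v
  map {x y} f := match x, y, f with
    | left c, left c', f => q.map (X := c) (Y := c') f
    | left _, right v, f => q.map f.2 ≫ α.app ⟨v, f.1⟩
    | right _, left _, f => PEmpty.elim f
    | right v, right v', f => s.map (X := v) (Y := v') f
  map_id x := by
    obtain c | v := x
    · exact q.map_id c
    · exact s.map_id v
  map_comp {x y z} f g := by
    induction f using hom_cases with
    | hl f =>
      obtain d | w := z
      · exact q.map_comp _ _
      · exact (congrArg (· ≫ _) (q.map_comp _ _)).trans (Category.assoc _ _ _)
    | hr f =>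
      obtain d | w := z
      · exact PEmpty.elim g
      · exact s.map_comp _ _
    | @hc c v h f =>
      obtain d | w := z
      · exact PEmpty.elim g
      · refine (congrArg (· ≫ _) (q.map_comp _ _)).trans ?_
        refine (Category.assoc _ _ _).trans (Eq.trans ?_ (Category.assoc _ _ _).symm)
        exact congrArg (q.map f ≫ ·) (α.naturality (X := ⟨v, h⟩) (Y := ⟨w, S.up g h⟩)
          (ObjectProperty.homMk g))

lemma desc_map_cross {c : C} {v : V} (h : S.W v) (f : c ⟶ S.ρ.obj ⟨v, h⟩) :
    (desc q s α).map (cross h f) = q.map f ≫ α.app ⟨v, h⟩ := rfl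

end desc

/-- Every crossing morphism is a morphism of the left part followed by a canonical crossing, so only
the canonical ones need comparing. -/
lemma functor_ext {T : Type*} [Category* T] {F G : Collage S ⥤ T} (hl : inl S ⋙ F = inl S ⋙ G)
    (hr : inr S ⋙ F = inr S ⋙ G)
    (hc : ∀ (v : V) (h : S.W v), F.map (cross h (𝟙 _)) =
      eqToHom (Functor.congr_obj hl _) ≫ G.map (cross h (𝟙 _)) ≫
        eqToHom (Functor.congr_obj hr v).symm) : F = G := by
  refine CategoryTheory.Functor.ext (fun x ↦ ?_) (fun x y f ↦ ?_)
  · obtain c | v := x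
    · exact Functor.congr_obj hl c
    · exact Functor.congr_obj hr v
  · induction f using hom_cases with
    | hl f => exact Functor.congr_hom hl f
    | hr f => exact Functor.congr_hom hr f
    | hc h f =>
      have := Functor.congr_hom hl f
      dsimp only [Functor.comp_map] at this
      rw [cross_eq, F.map_comp, G.map_comp, hc, this]
      simp

/-- The objects of the collage in the left part or over the cosieve. -/
def near (S : CollageData C V) : ObjectProperty (Collage S)
  | left _ => True
  | right v => S.W v

lemma near_of_hom {x y : Collage S} (f : x ⟶ y) (hx : near S x) : near S y := by
  induction f using hom_cases with
  | hl f => trivial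
  | hr f => exact S.up f hx
  | hc h f => exact h

/-- The retraction on the left part. -/
def ret : (near S).FullSubcategory ⥤ C where
  obj
    | ⟨left c, _⟩ => c
    | ⟨right v, h⟩ => S.ρ.obj ⟨v, h⟩
  map {x y} f := match x, y, f with
    | ⟨left c, _⟩, ⟨left c', _⟩, f => (f.hom : (c : C) ⟶ c')
    | ⟨left _, _⟩, ⟨right _, _⟩, f => f.hom.2
    | ⟨right _, _⟩, ⟨left _, _⟩, f => PEmpty.elim f.hom
    | ⟨right v, h⟩, ⟨right v', h'⟩, f =>
      S.ρ.map (X := ⟨v, h⟩) (Y := ⟨v', h'⟩) (ObjectProperty.homMk f.hom)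
  map_id x := by
    obtain ⟨c | v, h⟩ := x
    · rfl
    · exact S.ρ.map_id _
  map_comp {x y z} f g := by
    obtain ⟨c | v, h⟩ := x <;> obtain ⟨c' | v', h'⟩ := y <;> obtain ⟨c'' | v'', h''⟩ := z
    · rfl
    · rfl
    · exact PEmpty.elim g.hom
    · rfl
    · exact PEmpty.elim f.hom
    · exact PEmpty.elim f.hom
    · exact PEmpty.elim g.hom
    · exact S.ρ.map_comp (X := ⟨v, h⟩) (Y := ⟨v', h'⟩) (Z := ⟨v'', h''⟩)
        (ObjectProperty.homMk f.hom) (ObjectProperty.homMk g.hom)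

variable (S) in
/-- The inclusion of the left part in its neighborhood. -/
abbrev inlNear : C ⥤ (near S).FullSubcategory := (near S).lift (inl S) (fun _ ↦ trivial)

/-- The counit of the retraction. -/
def retCounit : ret ⋙ inlNear S ⟶ 𝟭 _ where
  app
    | ⟨left c, _⟩ => 𝟙 _
    | ⟨right v, h⟩ => ObjectProperty.homMk (cross h (𝟙 _))
  naturality x y f := by
    obtain ⟨c | v, h⟩ := x <;> obtain ⟨c' | v', h'⟩ := y
    · exact (Category.comp_id _).trans (Category.id_comp _).symm
    · refine ObjectProperty.hom_ext _ ?_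
      exact (inl_map_comp_cross _ _ _).trans (congrArg (cross _) (Category.comp_id _)) |>.trans
        (Category.id_comp f.hom).symm
    · exact PEmpty.elim f.hom
    · refine ObjectProperty.hom_ext _ ?_
      refine (inl_map_comp_cross h' _ (𝟙 _)).trans (Eq.trans ?_ (cross_comp_inr_map h _ _).symm)
      exact congrArg (cross h') ((Category.comp_id _).trans (Category.id_comp _).symm)

end

/-- The retraction is a strict left inverse of the inclusion, and its counit deforms the other
composite to the identity. -/
lemma isFunEquiv_inlNear {C : Cat.{u, u}} {V : Type u} [Category.{u} V] (S : CollageData C V)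
    (I : Cat.{u, u}) :
    IsFunEquiv I (X := C) (Y := Cat.of (near S).FullSubcategory) (inlNear S).toCatHom :=
  IsFunEquiv.of_natTrans ret (.inl ⟨𝟙 _⟩) (.inl ⟨retCounit⟩)

end Collage

end

/-! ### Cobase change of collages and Dwyer maps. -/

section

open Opposite Limits

namespace Collage

variable {A C : Cat.{u, u}} {V : Type u} [Category.{u} V]

/-- The change of the left part. -/
abbrev _root_.CollageData.post (S : CollageData A V) (k : A ⟶ C) : CollageData C V where
  W := S.W
  up := S.up
  ρ := S.ρ ⋙ k.toFunctor

variable (S : CollageData A V) (k : A ⟶ C)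

/-- The canonical natural transformation in the collage. -/
def crossNatTrans (S : CollageData A V) : S.ρ ⋙ inl S ⟶ S.W.ι ⋙ inr S where
  app v := cross v.2 (𝟙 _)
  naturality v w f := by
    refine (inl_map_comp_cross w.2 _ (𝟙 _)).trans (Eq.trans ?_ (cross_comp_inr_map v.2 _ _).symm)
    exact congrArg (cross w.2) ((Category.comp_id _).trans (Category.id_comp _).symm)

/-- The functoriality of the collage in the left part. -/
def map : Collage S ⥤ Collage (S.post k) :=
  desc (k.toFunctor ⋙ inl (S.post k)) (inr (S.post k)) (crossNatTrans (S.post k))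

lemma map_map_cross {v : V} (h : S.W v) :
    (map S k).map (cross h (𝟙 _)) = cross (S := S.post k) h (𝟙 _) := by
  refine (inl_map_comp_cross (S := S.post k) h _ (𝟙 _)).trans (congrArg _ ?_)
  exact (Category.comp_id _).trans (k.toFunctor.map_id _)

lemma near_map_iff (x : Collage S) : near (S.post k) ((map S k).obj x) ↔ near S x := by
  obtain c | v := x <;> rfl

/-- The inclusion of the left part, as a morphism of categories. -/
abbrev inlHom : A ⟶ Cat.of (Collage S) := (inl S).toCatHom

/-- The functoriality of the collage, as a morphism of categories. -/
abbrev mapHom : Cat.of (Collage S) ⟶ Cat.of (Collage (S.post k)) := (map S k).toCatHom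

section

variable {T : Type*} [Category* T] (q : C ⥤ T) (b : Collage S ⥤ T)
  (h : k.toFunctor ⋙ q = inl S ⋙ b)

/-- The functors out of the changed collage induced by functors out of the original one. -/
def pushoutDesc : Collage (S.post k) ⥤ T :=
  desc (S := S.post k) q (inr S ⋙ b) (eqToHom (congrArg (S.ρ ⋙ ·) h) ≫
    Functor.whiskerRight (crossNatTrans S) b)

lemma pushoutDesc_map_cross {v : V} (hv : S.W v) :
    (pushoutDesc S k q b h).map (cross (S := S.post k) hv (𝟙 _)) =
      eqToHom (Functor.congr_obj h _) ≫ b.map (cross hv (𝟙 _)) := by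
  refine (desc_map_cross (S := S.post k) q (inr S ⋙ b) _ hv (𝟙 _)).trans ?_
  refine (congrArg (· ≫ _) (q.map_id _)).trans ((Category.id_comp _).trans ?_)
  refine (NatTrans.comp_app _ _ _).trans ?_
  rw [eqToHom_app]
  rfl

lemma map_pushoutDesc : map S k ⋙ pushoutDesc S k q b h = b := by
  refine functor_ext h rfl (fun v hv ↦ ?_)
  refine (congrArg (pushoutDesc S k q b h).map (map_map_cross S k hv)).trans ?_
  refine (pushoutDesc_map_cross S k q b h hv).trans ?_
  exact congrArg (_ ≫ ·) (Category.comp_id _).symm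

lemma eq_pushoutDesc (m : Collage (S.post k) ⥤ T) (hl : inl (S.post k) ⋙ m = q)
    (hr : map S k ⋙ m = b) : m = pushoutDesc S k q b h := by
  refine functor_ext hl (congrArg (inr S ⋙ ·) hr) (fun v hv ↦ ?_)
  have := (congrArg m.map (map_map_cross S k hv)).symm.trans (Functor.congr_hom hr _)
  rw [pushoutDesc_map_cross]
  refine this.trans ?_
  have aux {x₁ x₂ x₃ x₄ x₅ : T} (t : x₁ ⟶ x₂) (h₁ : x₃ = x₁) (h₂ : x₂ = x₄) (h₃ : x₃ = x₅)
      (h₄ : x₅ = x₁) : eqToHom h₁ ≫ t ≫ eqToHom h₂ =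
        eqToHom h₃ ≫ (eqToHom h₄ ≫ t) ≫ eqToHom h₂ := by simp
  exact aux _ _ _ _ _

end

/-- The collage category of the changed left part is a pushout. -/
lemma isPushout : IsPushout k (inlHom S) (inlHom (S.post k)) (mapHom S k) where
  w := rfl
  isColimit' :=
    ⟨PushoutCocone.IsColimit.mk _
      (fun s ↦ (pushoutDesc S k s.inl.toFunctor s.inr.toFunctor
        (congrArg Cat.Hom.toFunctor s.condition)).toCatHom)
      (fun _ ↦ rfl)
      (fun s ↦ Cat.ext (map_pushoutDesc S k _ _ (congrArg Cat.Hom.toFunctor s.condition)))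
      (fun s _ hl hr ↦ Cat.ext (eq_pushoutDesc S k _ _
        (congrArg Cat.Hom.toFunctor s.condition) _
        (congrArg Cat.Hom.toFunctor hl) (congrArg Cat.Hom.toFunctor hr)))⟩

/-- The restriction of the functoriality of the collage to the neighborhoods of the left part. -/
abbrev nearMapHom : Cat.of (near S).FullSubcategory ⟶ Cat.of (near (S.post k)).FullSubcategory :=
  ((near (S.post k)).lift ((near S).ι ⋙ map S k)
    (fun x ↦ (near_map_iff S k x.obj).2 x.property)).toCatHom

/-- The inclusion of the neighborhood of the left part. -/
abbrev nearHom : Cat.of (near S).FullSubcategory ⟶ Cat.of (Collage S) := (near S).ι.toCatHom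

/-- The inclusion of the left part in its neighborhood. -/
abbrev inlNearHom : A ⟶ Cat.of (near S).FullSubcategory := (inlNear S).toCatHom

lemma ι_obj_injective {B : Type*} [Category* B] (Q : ObjectProperty B) :
    Function.Injective Q.ι.obj := fun ⟨_, _⟩ ⟨_, _⟩ h ↦ by
  obtain rfl : _ = _ := h
  rfl

variable {P : Cat.{u, u}}

lemma coyoneda_nearHom_injective :
    Function.Injective ((coyoneda.obj (op P)).map (nearHom S)) := fun _ _ h ↦
  Cat.ext (functor_comp_injective (near S).ι (ι_obj_injective _) (congrArg Cat.Hom.toFunctor h))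

lemma exists_comp_nearHom (F : P ⟶ Cat.of (Collage S)) (h : ∀ p, near S (F.toFunctor.obj p)) :
    ∃ G : P ⟶ _, G ≫ nearHom S = F := by
  obtain ⟨G, hG⟩ := exists_functor_comp_eq (near S).ι F.toFunctor (fun p ↦ ⟨⟨_, h p⟩, rfl⟩)
  exact ⟨G.toCatHom, Cat.ext hG⟩

/-- If the weakly initial object lands in the cosieve `near`, so does everything. Otherwise it lands
in the right part, which no morphism leaves. -/
lemma exists_comp_nearHom_or (hP : HasWeaklyInitial P) (F : P ⟶ Cat.of (Collage S)) :
    (∃ G : P ⟶ _, G ≫ nearHom S = F) ∨ ∃ G : P ⟶ Cat.of V, G ≫ (inr S).toCatHom = F := by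
  obtain ⟨p₀, hp₀⟩ := hP
  by_cases h : near S (F.toFunctor.obj p₀)
  · refine .inl (exists_comp_nearHom S F (fun p ↦ ?_))
    obtain ⟨f⟩ := hp₀ p
    exact near_of_hom (F.toFunctor.map f) h
  · right
    obtain ⟨G, hG⟩ := exists_functor_comp_eq (inr S) F.toFunctor (fun p ↦ by
      obtain ⟨f⟩ := hp₀ p
      replace f := F.toFunctor.map f
      generalize F.toFunctor.obj p₀ = x at *
      generalize F.toFunctor.obj p = y at *
      obtain c | v := x
      · exact (h trivial).elim
      · obtain c | v := y
        · exact PEmpty.elim f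
        · exact ⟨v, rfl⟩)
    exact ⟨G.toCatHom, Cat.ext hG⟩

/-- Functors that miss the neighborhood factor through `V`, which the change of left part does not
touch. So the square is a pullback along injections that is bijective on complements, hence a
pushout of sets. -/
lemma isPushout_coyoneda (hP : HasWeaklyInitial P) :
    IsPushout ((coyoneda.obj (op P)).map (nearMapHom S k)) ((coyoneda.obj (op P)).map (nearHom S))
      ((coyoneda.obj (op P)).map (nearHom (S.post k)))
      ((coyoneda.obj (op P)).map (mapHom S k)) := by
  have : Mono ((coyoneda.obj (op P)).map (nearHom (S.post k))) :=
    (mono_iff_injective _).2 (coyoneda_nearHom_injective _)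
  refine Types.isPushout_of_isPullback_of_mono' ?_ ?_ ?_
  · rw [Types.isPullback_iff]
    refine ⟨rfl, fun x y h ↦ coyoneda_nearHom_injective S h.2, fun F G h ↦ ?_⟩
    obtain ⟨G', rfl⟩ := exists_comp_nearHom S G (fun p ↦ by
      refine (near_map_iff S k _).1 ?_
      have : (near (S.post k)).ι.obj (F.toFunctor.obj p) = (map S k).obj (G.toFunctor.obj p) :=
        Functor.congr_obj (congrArg Cat.Hom.toFunctor h) p
      exact this ▸ (F.toFunctor.obj p).property)
    exact ⟨G', coyoneda_nearHom_injective _ h.symm, rfl⟩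
  · refine Set.eq_univ_of_forall fun F ↦ ?_
    obtain ⟨G, hG⟩ | ⟨G, hG⟩ := exists_comp_nearHom_or (S.post k) hP F
    · exact .inl ⟨G, hG⟩
    · exact .inr ⟨G ≫ (inr S).toCatHom, hG⟩
  · intro F G hF hG h
    obtain hF' | ⟨F, rfl⟩ := exists_comp_nearHom_or S hP F
    · exact (hF hF').elim
    obtain hG' | ⟨G, rfl⟩ := exists_comp_nearHom_or S hP G
    · exact (hG hG').elim
    have h' : F.toFunctor ⋙ inr (S.post k) = G.toFunctor ⋙ inr (S.post k) :=
      congrArg Cat.Hom.toFunctor h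
    rw [show F = G from Cat.ext (functor_comp_injective _ inr_obj_injective h')]

variable {I : Cat.{u, u}}

lemma isPushout_funNerve [Nonempty I] (hI : IsStronglyConnectedCat I) :
    IsPushout ((funNerve I).map (nearMapHom S k)) ((funNerve I).map (nearHom S))
      ((funNerve I).map (nearHom (S.post k))) ((funNerve I).map (mapHom S k)) :=
  _root_.isPushout_funNerve
    (fun n ↦ isPushout_coyoneda S k (hasWeaklyInitial_chainCat I hI n))

instance : Mono ((funNerve I).map (nearHom S)) :=
  mono_funNerve_map _ (fun _ ↦ coyoneda_nearHom_injective S)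

/-- On neighborhoods the map is equivalent to `k`, since both deform onto their left parts; left
properness passes this to the collages. -/
lemma isFunEquiv_mapHom [Nonempty I] (hI : IsStronglyConnectedCat I) (hk : IsFunEquiv I k) :
    IsFunEquiv I (mapHom S k) := by
  refine SSet.isHtpyEquiv_of_isPushout (isPushout_funNerve S k hI).flip ?_
  refine IsFunEquiv.of_comp_left (F := inlNearHom S) (isFunEquiv_inlNear S I) ?_
  exact IsFunEquiv.comp (F := k) (G := inlNearHom (S.post k)) hk (isFunEquiv_inlNear (S.post k) I)

/-- By two-out-of-three the neighborhood inclusion is an equivalence, and also a monomorphism on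
nerves, so its pushout is an equivalence for arbitrary `k`. -/
lemma isFunEquiv_inlHom [Nonempty I] (hI : IsStronglyConnectedCat I)
    (h : IsFunEquiv I (inlHom S)) : IsFunEquiv I (inlHom (S.post k)) := by
  refine IsFunEquiv.comp (F := inlNearHom (S.post k)) (G := nearHom (S.post k))
    (isFunEquiv_inlNear (S.post k) I) ?_
  refine SSet.isHtpyEquiv_of_isPushout_of_mono (isPushout_funNerve S k hI).flip ?_
  exact IsFunEquiv.of_comp_left (F := inlNearHom S) (isFunEquiv_inlNear S I) h

end Collage

lemma isIso_of_fullyFaithful {X Y : Cat.{u, u}} (F : X ⟶ Y) [F.toFunctor.Full]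
    [F.toFunctor.Faithful] (h : Function.Bijective F.toFunctor.obj) : IsIso F := by
  obtain ⟨G, hG⟩ := exists_functor_comp_eq F.toFunctor (𝟭 Y) h.2
  refine ⟨G.toCatHom, Cat.ext ?_, Cat.ext hG⟩
  refine functor_comp_injective F.toFunctor h.1 ?_
  exact congrArg (F.toFunctor ⋙ ·) hG

/-- A Dwyer map is isomorphic to the left inclusion of a collage. -/
lemma IsDwyerMap.exists_collage {A B : Cat.{u, u}} {i : A ⟶ B} (hi : IsDwyerMap i) :
    ∃ (V : Type u) (_ : Category.{u} V) (S : CollageData A V) (e : Cat.of (Collage S) ≅ B),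
      Collage.inlHom S ≫ e.hom = i := by
  obtain ⟨W, hW, hi', hadj⟩ := hi.exists_cosieve
  have := hi.full
  have := hi.faithful
  let R := (W.lift i.toFunctor hi').rightAdjoint
  let adj : W.lift i.toFunctor hi' ⊣ R := Adjunction.ofIsLeftAdjoint _
  -- The right part consists of the objects outside the image, and `ρ` is the right adjoint
  -- restricted to those lying in `W`.
  let N : ObjectProperty B := fun b ↦ ¬ ∃ a, i.toFunctor.obj a = b
  let S : CollageData A N.FullSubcategory :=
    { W v := W v.obj
      up f := hW f.hom
      ρ := W.lift (ObjectProperty.ι _ ⋙ N.ι) (fun v ↦ v.property) ⋙ R }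
  let Φ : Collage S ⥤ B := Collage.desc i.toFunctor N.ι
    { app v := (adj.counit.app ⟨v.obj.obj, v.property⟩).hom
      naturality v w f := congrArg (fun t ↦ t.hom) (adj.counit.naturality
        (X := ⟨v.obj.obj, v.property⟩) (Y := ⟨w.obj.obj, w.property⟩)
        (ObjectProperty.homMk f.hom.hom)) }
  -- The adjunction identifies morphisms `i a ⟶ b` with morphisms `a ⟶ R b`, the crossings of the
  -- collage. The cosieve condition puts every such `b` in `W`; the sieve condition excludes
  -- morphisms back into the image.
  have key {a : A} {b : N.FullSubcategory} (h : W b.obj) :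
      Function.Bijective (fun f : a ⟶ R.obj ⟨b.obj, h⟩ ↦
        (i.toFunctor.map f ≫ (adj.counit.app ⟨b.obj, h⟩).hom : i.toFunctor.obj a ⟶ b.obj)) := by
    have h₁ := ((adj.homEquiv a ⟨b.obj, h⟩).symm).bijective
    have h₂ : Function.Bijective (fun (f : (W.lift i.toFunctor hi').obj a ⟶ ⟨b.obj, h⟩) ↦
        (f.hom : i.toFunctor.obj a ⟶ b.obj)) :=
      ⟨fun _ _ e ↦ ObjectProperty.hom_ext _ e, fun f ↦ ⟨ObjectProperty.homMk f, rfl⟩⟩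
    refine (congrArg Function.Bijective (funext fun f ↦ ?_)).mp (h₂.comp h₁)
    exact congrArg (fun (t : (W.lift i.toFunctor hi').obj a ⟶ ⟨b.obj, h⟩) ↦ t.hom)
      (adj.homEquiv_counit _ _ f)
  have hfull : Φ.Full := ⟨fun {x y} f ↦ by
    obtain a | b := x <;> obtain a' | b' := y
    · exact i.toFunctor.map_surjective f
    · obtain ⟨g, hg⟩ := (key (hW f (hi' a))).2 f
      exact ⟨Collage.cross (S := S) (hW f (hi' a)) g, hg⟩
    · obtain ⟨a, ha⟩ := hi.sieve f
      exact (b.property ⟨a, ha⟩).elim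
    · exact N.ι.map_surjective f⟩
  have hfaith : Φ.Faithful := ⟨fun {x y} f g h ↦ by
    obtain a | b := x <;> obtain a' | b' := y
    · exact i.toFunctor.map_injective h
    · exact congrArg (PSigma.mk f.1) ((key f.1).1 h)
    · exact PEmpty.elim f
    · exact N.ι.map_injective h⟩
  have hobj : Function.Bijective Φ.obj := by
    constructor
    · intro x y h
      obtain a | b := x <;> obtain a' | b' := y
      · exact congrArg Collage.left (hi.obj_injective h)
      · exact (b'.property ⟨a, h⟩).elim
      · exact (b.property ⟨a', h.symm⟩).elim
      · exact congrArg Collage.right (Collage.ι_obj_injective N h)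
    · intro b
      by_cases h : ∃ a, i.toFunctor.obj a = b
      · obtain ⟨a, rfl⟩ := h
        exact ⟨.left a, rfl⟩
      · exact ⟨.right ⟨b, h⟩, rfl⟩
  have : IsIso (X := Cat.of (Collage S)) (Y := B) Φ.toCatHom := by
    exact @isIso_of_fullyFaithful (Cat.of (Collage S)) B Φ.toCatHom hfull hfaith hobj
  exact ⟨_, _, S, asIso (X := Cat.of (Collage S)) (Y := B) Φ.toCatHom, rfl⟩

/-- If `i` is Dwyer, `B` is a collage and `h` is the change of its left part along `k`. If `k` is
Dwyer, `C` is a collage and `h` is the left inclusion after changing the left part along `i`. -/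
lemma isFunEquiv_of_isPushout_of_isDwyerMap {I A B C D : Cat.{u, u}}
    (hI : IsStronglyConnectedCat I) {k : A ⟶ C} {i : A ⟶ B} {j : C ⟶ D} {h : B ⟶ D}
    (sq : IsPushout k i j h) (hk : IsFunEquiv I k) (hik : IsDwyerMap i ∨ IsDwyerMap k) :
    IsFunEquiv I h := by
  obtain _ | _ := isEmpty_or_nonempty I
  · exact isFunEquiv_of_isEmpty h
  obtain hi | hk' := hik
  · obtain ⟨V, _, S, e, rfl⟩ := hi.exists_collage
    have sq' : IsPushout k (Collage.inlHom S) j (e.hom ≫ h) :=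
      sq.of_iso (Iso.refl _) (Iso.refl _) e.symm (Iso.refl _) (by simp) (by simp) (by simp)
        (by simp)
    have e' := (Collage.isPushout S k).inr_isoIsPushout_hom _ _ sq'
    refine IsFunEquiv.of_comp_left (F := e.hom) (IsFunEquiv.of_isIso _) ?_
    rw [← e']
    exact (Collage.isFunEquiv_mapHom S k hI hk).comp (IsFunEquiv.of_isIso _)
  · obtain ⟨V, _, S, e, rfl⟩ := hk'.exists_collage
    have sq' : IsPushout i (Collage.inlHom S) h (e.hom ≫ j) :=
      sq.flip.of_iso (Iso.refl _) (Iso.refl _) e.symm (Iso.refl _) (by simp) (by simp) (by simp)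
        (by simp)
    have e' := (Collage.isPushout S i).inl_isoIsPushout_hom _ _ sq'
    rw [← e']
    refine IsFunEquiv.comp (Collage.isFunEquiv_inlHom S i hI ?_) (IsFunEquiv.of_isIso _)
    exact IsFunEquiv.of_comp_right (G := e.hom) (IsFunEquiv.of_isIso _) hk

end

/-! ### Finite presheaves and sequential colimits. -/

section

open Opposite Limits

namespace CategoryTheory.Limits.IsColimit

variable {K : Type*} [Category* K] {X : ℕ ⥤ K ⥤ Type u} {c : Cocone X}

lemma ι_app_app_map (c : Cocone X) {k : K} {n m : ℕ} (h : n ≤ m) (x : (X.obj n).obj k) :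
    (c.ι.app m).app k ((X.map (homOfLE h)).app k x) = (c.ι.app n).app k x :=
  ConcreteCategory.congr_hom (congrArg (fun (t : X.obj n ⟶ c.pt) ↦ t.app k)
    (c.w (homOfLE h))) x

lemma exists_ι_app_app_eq (hc : IsColimit c) {k : K} (y : c.pt.obj k) :
    ∃ n₀, ∀ n ≥ n₀, ∃ x : (X.obj n).obj k, (c.ι.app n).app k x = y := by
  obtain ⟨n, x, hx⟩ := Types.jointly_surjective _
    (isColimitOfPreserves ((evaluation K (Type u)).obj k) hc) y
  exact ⟨n, fun m h ↦ ⟨(X.map (homOfLE h)).app k x, (ι_app_app_map c h x).trans hx⟩⟩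

lemma exists_map_app_eq (hc : IsColimit c) {k : K} {n : ℕ} {x y : (X.obj n).obj k}
    (h : (c.ι.app n).app k x = (c.ι.app n).app k y) :
    ∃ n₀, ∀ m ≥ n₀, ∀ (hm : n ≤ m),
      (X.map (homOfLE hm)).app k x = (X.map (homOfLE hm)).app k y := by
  obtain ⟨m₀, f, hf⟩ := (Types.FilteredColimit.isColimit_eq_iff' (F := X ⋙ (evaluation _ _).obj k)
    (isColimitOfPreserves ((evaluation K (Type u)).obj k) hc) x y).1 h
  refine ⟨m₀, fun m h₁ h₂ ↦ ?_⟩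
  have key (z : (X.obj n).obj k) : (X.map (homOfLE h₂)).app k z =
      (X.map (homOfLE h₁)).app k ((X.map f).app k z) := by
    refine Eq.trans ?_ (ConcreteCategory.congr_hom (congrArg (fun (t : X.obj n ⟶ X.obj m) ↦ t.app k)
      (X.map_comp f (homOfLE h₁))) z)
    rfl
  exact (key x).trans ((congrArg _ hf).trans (key y).symm)

variable {G : K ⥤ Type u} [Finite K] [∀ k, Finite (G.obj k)]

lemma exists_comp_map_eq (hc : IsColimit c) {n : ℕ} {φ ψ : G ⟶ X.obj n}
    (h : φ ≫ c.ι.app n = ψ ≫ c.ι.app n) :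
    ∃ (m : ℕ) (f : n ⟶ m), φ ≫ X.map f = ψ ≫ X.map f := by
  have h' (p : Σ k, G.obj k) := exists_map_app_eq hc (x := φ.app p.1 p.2) (y := ψ.app p.1 p.2)
    (ConcreteCategory.congr_hom (congrArg (fun (t : G ⟶ c.pt) ↦ t.app p.1) h) p.2)
  choose m₀ hm₀ using h'
  obtain ⟨M, hM⟩ := Finite.exists_le m₀
  refine ⟨max n M, homOfLE (le_max_left _ _), NatTrans.ext (funext fun k ↦ ?_)⟩
  ext g
  exact hm₀ ⟨k, g⟩ _ ((hM _).trans (le_max_right _ _)) _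

/-- A morphism out of `G` consists of finitely many values and finitely many naturality equations.
The values lift to a stage `N`, and the equations hold after enlarging it by `M`. -/
lemma exists_comp_ι_eq [∀ k l : K, Finite (k ⟶ l)] (hc : IsColimit c) (φ : G ⟶ c.pt) :
    ∃ (n : ℕ) (ψ : G ⟶ X.obj n), ψ ≫ c.ι.app n = φ := by
  have h₁ (p : Σ k, G.obj k) := exists_ι_app_app_eq hc (φ.app p.1 p.2)
  choose n₀ hn₀ using h₁
  obtain ⟨N, hN⟩ := Finite.exists_le n₀
  choose ψ hψ using fun p ↦ hn₀ p N (hN p)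
  have h₂ (p : Σ (k : K) (l : K), (k ⟶ l) × G.obj k) := exists_map_app_eq hc
    (x := ψ ⟨p.2.1, G.map p.2.2.1 p.2.2.2⟩) (y := (X.obj N).map p.2.2.1 (ψ ⟨p.1, p.2.2.2⟩)) (by
      rw [hψ]
      refine (ConcreteCategory.congr_hom (φ.naturality p.2.2.1) p.2.2.2).trans ?_
      refine Eq.trans ?_
        (ConcreteCategory.congr_hom ((c.ι.app N).naturality p.2.2.1) (ψ ⟨p.1, p.2.2.2⟩)).symm
      exact congrArg (c.pt.map p.2.2.1) (hψ ⟨p.1, p.2.2.2⟩).symm)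
  choose m₀ hm₀ using h₂
  obtain ⟨M, hM⟩ := Finite.exists_le m₀
  have hNM := le_max_left N M
  refine ⟨max N M,
    { app k := ↾fun g ↦ (X.map (homOfLE hNM)).app k (ψ ⟨k, g⟩)
      naturality k l f := ?_ }, NatTrans.ext (funext fun k ↦ ?_)⟩
  · ext g
    refine (hm₀ ⟨k, l, f, g⟩ _ ((hM _).trans (le_max_right _ _)) hNM).trans ?_
    exact ConcreteCategory.congr_hom ((X.map (homOfLE hNM)).naturality f) (ψ ⟨k, g⟩)
  · ext g
    exact (ι_app_app_map c hNM _).trans (hψ ⟨k, g⟩)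

end CategoryTheory.Limits.IsColimit

end

/-! ### Recognition of 2-truncated nerves of categories. -/

section

open Opposite Limits Nerve Simplicial SimplexCategory.Truncated SimplicialObject.Truncated

namespace SSet.Truncated

/-- The condition that characterizes the `2`-truncated nerves of categories: composable edges
have a unique composite, and the composition is associative. -/
structure IsNervelike (T : SSet.Truncated.{u} 2) : Prop where
  ext : ∀ s t : T _⦋2⦌₂, T.map (δ₂ 2).op s = T.map (δ₂ 2).op t →
    T.map (δ₂ 0).op s = T.map (δ₂ 0).op t → s = t
  assoc : ∀ a b c : T _⦋1⦌₂, T.map (δ₂ 0).op a = T.map (δ₂ 1).op b →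
    T.map (δ₂ 0).op b = T.map (δ₂ 1).op c → ∃ s t v w : T _⦋2⦌₂,
      (T.map (δ₂ 2).op s = a ∧ T.map (δ₂ 0).op s = b) ∧
      (T.map (δ₂ 2).op t = b ∧ T.map (δ₂ 0).op t = c) ∧
      (T.map (δ₂ 2).op v = T.map (δ₂ 1).op s ∧ T.map (δ₂ 0).op v = c) ∧
      (T.map (δ₂ 2).op w = a ∧ T.map (δ₂ 0).op w = T.map (δ₂ 1).op t) ∧
      T.map (δ₂ 1).op v = T.map (δ₂ 1).op w

lemma isNervelike_nerveFunctor₂ (C : Cat.{u, u}) : (nerveFunctor₂.obj C).IsNervelike where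
  ext s t h₂ h₀ := by
    refine IsStrictSegal.ext (X := (truncation 2).obj (nerve C)) (fun i ↦ ?_)
    fin_cases i
    · dsimp
      simp only [SimplexCategory.mkOfSucc_zero_eq_δ]
      exact h₂
    · dsimp
      simp only [SimplexCategory.mkOfSucc_one_eq_δ]
      exact h₀
  assoc a b c h₁ h₂ := by
    obtain ⟨x, y, f, rfl⟩ := ComposableArrows.mk₁_surjective a
    obtain ⟨y', z, g, rfl⟩ := ComposableArrows.mk₁_surjective b
    obtain ⟨z', t, h, rfl⟩ := ComposableArrows.mk₁_surjective c
    obtain rfl : y = y' := congrArg (fun F : ComposableArrows C 0 ↦ F.obj 0) h₁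
    obtain rfl : z = z' := congrArg (fun F : ComposableArrows C 0 ↦ F.obj 0) h₂
    refine ⟨.mk₂ f g, .mk₂ g h, .mk₂ (f ≫ g) h, .mk₂ f (g ≫ h), ⟨nerve.δ₂_mk₂_eq f g,
      nerve.δ₀_mk₂_eq f g⟩, ⟨nerve.δ₂_mk₂_eq g h, nerve.δ₀_mk₂_eq g h⟩,
      ⟨(nerve.δ₂_mk₂_eq (f ≫ g) h).trans (nerve.δ₁_mk₂_eq f g).symm, nerve.δ₀_mk₂_eq (f ≫ g) h⟩,
      ⟨nerve.δ₂_mk₂_eq f (g ≫ h), (nerve.δ₀_mk₂_eq f (g ≫ h)).trans (nerve.δ₁_mk₂_eq g h).symm⟩,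
      (nerve.δ₁_mk₂_eq (f ≫ g) h).trans (Eq.trans ?_ (nerve.δ₁_mk₂_eq f (g ≫ h)).symm)⟩
    rw [Category.assoc]

/-- Sequential colimits of nervelike sets are nervelike. -/
lemma IsNervelike.of_isColimit {X : ℕ ⥤ SSet.Truncated.{u} 2} (hX : ∀ n, (X.obj n).IsNervelike)
    {c : Cocone X} (hc : IsColimit c) : c.pt.IsNervelike where
  ext s t h₂ h₀ := by
    -- Each condition mentions finitely many simplices and equations, so both can be realized at a
    -- common stage, where the hypothesis applies.
    obtain ⟨n₁, h₁⟩ := hc.exists_ι_app_app_eq s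
    obtain ⟨n₂, h₂'⟩ := hc.exists_ι_app_app_eq t
    obtain ⟨s, rfl⟩ := h₁ (max n₁ n₂) (le_max_left _ _)
    obtain ⟨t, rfl⟩ := h₂' (max n₁ n₂) (le_max_right _ _)
    generalize max n₁ n₂ = n at *
    simp only [← NatTrans.naturality_apply] at h₂ h₀
    obtain ⟨m₁, h₂⟩ := hc.exists_map_app_eq h₂
    obtain ⟨m₂, h₀⟩ := hc.exists_map_app_eq h₀
    let m := max n (max m₁ m₂)
    have hm : n ≤ m := le_max_left _ _
    specialize h₂ m ((le_max_left _ _).trans (le_max_right _ _)) hm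
    specialize h₀ m ((le_max_right _ _).trans (le_max_right _ _)) hm
    simp only [NatTrans.naturality_apply] at h₂ h₀
    rw [← IsColimit.ι_app_app_map c hm, ← IsColimit.ι_app_app_map c hm, (hX m).ext _ _ h₂ h₀]
  assoc a b d hab hbd := by
    obtain ⟨n₁, h₁⟩ := hc.exists_ι_app_app_eq a
    obtain ⟨n₂, h₂⟩ := hc.exists_ι_app_app_eq b
    obtain ⟨n₃, h₃⟩ := hc.exists_ι_app_app_eq d
    obtain ⟨a, rfl⟩ := h₁ (max n₁ (max n₂ n₃)) (le_max_left _ _)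
    obtain ⟨b, rfl⟩ := h₂ (max n₁ (max n₂ n₃)) ((le_max_left _ _).trans (le_max_right _ _))
    obtain ⟨d, rfl⟩ := h₃ (max n₁ (max n₂ n₃)) ((le_max_right _ _).trans (le_max_right _ _))
    generalize max n₁ (max n₂ n₃) = n at *
    simp only [← NatTrans.naturality_apply] at hab hbd
    obtain ⟨m₁, hab⟩ := hc.exists_map_app_eq hab
    obtain ⟨m₂, hbd⟩ := hc.exists_map_app_eq hbd
    let m := max n (max m₁ m₂)
    have hm : n ≤ m := le_max_left _ _
    specialize hab m ((le_max_left _ _).trans (le_max_right _ _)) hm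
    specialize hbd m ((le_max_right _ _).trans (le_max_right _ _)) hm
    simp only [NatTrans.naturality_apply] at hab hbd
    obtain ⟨s, t, v, w, ⟨hs, hs'⟩, ⟨ht, ht'⟩, ⟨hv, hv'⟩, ⟨hw, hw'⟩, hvw⟩ :=
      (hX m).assoc _ _ _ hab hbd
    refine ⟨(c.ι.app m).app _ s, (c.ι.app m).app _ t, (c.ι.app m).app _ v, (c.ι.app m).app _ w, ?_⟩
    simp only [← NatTrans.naturality_apply]
    rw [hs, hs', ht, ht', hv, hv', hw, hw', hvw]
    simp [IsColimit.ι_app_app_map c hm]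

namespace IsNervelike

variable {T : SSet.Truncated.{u} 2} (hT : T.IsNervelike)

include hT in
lemma edge_eq {x y z : T _⦋0⦌₂} {e : Edge x y} {e' : Edge y z} {f f' : Edge x z}
    (h : Edge.CompStruct e e' f) (h' : Edge.CompStruct e e' f') : f = f' := by
  ext
  rw [← h.d₁, ← h'.d₁, hT.ext h.simplex h'.simplex (by simp) (by simp)]

lemma exists_compStruct_of_simplex {x y z : T _⦋0⦌₂} (e : Edge x y) (e' : Edge y z) (s : T _⦋2⦌₂)
    (h₂ : T.map (δ₂ 2).op s = e.edge) (h₀ : T.map (δ₂ 0).op s = e'.edge) :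
    ∃ (f : Edge x z) (h : Edge.CompStruct e e' f), h.simplex = s := by
  obtain ⟨x₀, x₁, x₂, e₀₁, e₁₂, e₀₂, h, rfl⟩ := Edge.CompStruct.exists_of_simplex s
  obtain rfl : x₀ = x := by rw [← e.src_eq, ← h₂, h.d₂, e₀₁.src_eq]
  obtain rfl : x₁ = y := by rw [← e.tgt_eq, ← h₂, h.d₂, e₀₁.tgt_eq]
  obtain rfl : x₂ = z := by rw [← e'.tgt_eq, ← h₀, h.d₀, e₁₂.tgt_eq]
  obtain rfl : e₀₁ = e := Edge.ext (h.d₂.symm.trans h₂)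
  obtain rfl : e₁₂ = e' := Edge.ext (h.d₀.symm.trans h₀)
  exact ⟨_, h, rfl⟩

include hT in
-- The associativity condition also encodes existence of composites: take its third edge to be
-- degenerate.
lemma exists_simplex (a b : T _⦋1⦌₂) (h : T.map (δ₂ 0).op a = T.map (δ₂ 1).op b) :
    ∃ s : T _⦋2⦌₂, T.map (δ₂ 2).op s = a ∧ T.map (δ₂ 0).op s = b := by
  obtain ⟨s, _, _, _, hs, _⟩ := hT.assoc a b (Edge.id (T.map (δ₂ 0).op b)).edge h
    (Edge.src_eq _).symm
  exact ⟨s, hs⟩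

include hT in
lemma exists_comp {x y z : T _⦋0⦌₂} (e : Edge x y) (e' : Edge y z) :
    ∃ f : Edge x z, Nonempty (Edge.CompStruct e e' f) := by
  obtain ⟨s, hs, hs'⟩ := hT.exists_simplex e.edge e'.edge (by simp)
  obtain ⟨f, h, _⟩ := exists_compStruct_of_simplex e e' s hs hs'
  exact ⟨f, ⟨h⟩⟩

/-- The category whose morphisms are the edges of a nervelike set. -/
structure Edges {T : SSet.Truncated.{u} 2} (hT : T.IsNervelike) : Type u where
  /-- the underlying vertex -/
  pt : T _⦋0⦌₂

noncomputable instance : CategoryStruct.{u} (Edges hT) where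
  Hom x y := Edge x.pt y.pt
  id x := Edge.id x.pt
  comp e e' := (hT.exists_comp e e').choose

/-- The composition of edges. -/
noncomputable def compStruct {x y z : Edges hT} (e : x ⟶ y) (e' : y ⟶ z) :
    Edge.CompStruct (X := T) e e' (e ≫ e') :=
  (hT.exists_comp e e').choose_spec.some

lemma comp_eq {x y z : Edges hT} {e : x ⟶ y} {e' : y ⟶ z} {f : x ⟶ z}
    (h : Edge.CompStruct (X := T) e e' f) : e ≫ e' = f :=
  hT.edge_eq (compStruct hT e e') h

noncomputable instance : Category.{u} (Edges hT) where
  id_comp e := comp_eq hT (Edge.CompStruct.idComp e)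
  comp_id e := comp_eq hT (Edge.CompStruct.compId e)
  assoc {x y z t} e e' e'' := by
    obtain ⟨s, t, v, w, ⟨hs, hs'⟩, ⟨ht, ht'⟩, ⟨hv, hv'⟩, ⟨hw, hw'⟩, hvw⟩ :=
      hT.assoc (Edge.edge e) (Edge.edge e') (Edge.edge e'') (by simp) (by simp)
    obtain ⟨f, h, rfl⟩ := exists_compStruct_of_simplex _ _ s hs hs'
    obtain ⟨f', h', rfl⟩ := exists_compStruct_of_simplex _ _ t ht ht'
    obtain ⟨g, k, rfl⟩ := exists_compStruct_of_simplex _ _ v (hv.trans h.d₁) hv'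
    obtain ⟨g', k', rfl⟩ := exists_compStruct_of_simplex _ _ w hw (hw'.trans h'.d₁)
    rw [comp_eq hT h, comp_eq hT h', comp_eq hT k, comp_eq hT k']
    exact Edge.ext (k.d₁.symm.trans (hvw.trans k'.d₁))

/-- The tautological functor from the homotopy category. -/
noncomputable def toEdges : T.HomotopyCategory ⥤ Edges hT :=
  HomotopyCategory.lift (fun x ↦ ⟨x⟩) (fun e ↦ e) (fun _ ↦ rfl) (fun h ↦ comp_eq hT h)

lemma toEdges_map_homMk {x y : T _⦋0⦌₂} (e : Edge x y) :
    (toEdges hT).map (HomotopyCategory.homMk e) = e :=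
  HomotopyCategory.lift_map_homMk _ _ _ (fun h ↦ comp_eq hT h) e

include hT in
/-- A morphism between nervelike sets that is bijective on vertices and edges is an isomorphism. -/
lemma isIso {T' : SSet.Truncated.{u} 2} (hT' : T'.IsNervelike) (φ : T ⟶ T')
    (h₀ : Function.Bijective (φ.app (op ⦋0⦌₂))) (h₁ : Function.Bijective (φ.app (op ⦋1⦌₂))) :
    IsIso φ := by
  have h₂ : Function.Bijective (φ.app (op ⦋2⦌₂)) := by
    constructor
    · intro s t h
      refine hT.ext s t (h₁.1 ?_) (h₁.1 ?_)
      · simp only [NatTrans.naturality_apply, h]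
      · simp only [NatTrans.naturality_apply, h]
    · intro y
      obtain ⟨a, ha⟩ := h₁.2 (T'.map (δ₂ 2).op y)
      obtain ⟨b, hb⟩ := h₁.2 (T'.map (δ₂ 0).op y)
      obtain ⟨s, hs, hs'⟩ := hT.exists_simplex a b (h₀.1 (by
        rw [NatTrans.naturality_apply, NatTrans.naturality_apply, ha, hb]
        simp only [← Functor.map_comp_apply, ← op_comp, δ₂_zero_comp_δ₂_two]))
      refine ⟨s, hT'.ext _ _ ?_ ?_⟩
      · rw [← NatTrans.naturality_apply, hs, ha]
      · rw [← NatTrans.naturality_apply, hs', hb]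
  rw [NatTrans.isIso_iff_isIso_app]
  rintro ⟨⟨n, hn⟩⟩
  rw [isIso_iff_bijective]
  induction n using SimplexCategory.rec with | _ n
  obtain _ | _ | _ | n := n
  · exact h₀
  · exact h₁
  · exact h₂
  · exact absurd hn (by simp)

/-- Nervelike sets are nerves. -/
lemma nonempty_iso (hT : T.IsNervelike) :
    Nonempty (T ≅ nerveFunctor₂.obj (Cat.of (Edges hT))) := by
  let φ : T ⟶ nerveFunctor₂.obj (Cat.of (Edges hT)) := HomotopyCategory.homToNerveMk (toEdges hT)
  have hφ {x y : T _⦋0⦌₂} (e : Edge x y) : φ.app _ e.edge =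
      ComposableArrows.mk₁ (C := Edges hT) (X₀ := ⟨x⟩) (X₁ := ⟨y⟩) e := by
    refine (HomotopyCategory.homToNerveMk_app_edge (toEdges hT) e).trans ?_
    exact congrArg ComposableArrows.mk₁ (toEdges_map_homMk hT e)
  have : IsIso φ := by
    refine hT.isIso (isNervelike_nerveFunctor₂ _) φ ?_ ?_
    · constructor
      · intro x y h
        exact congrArg Edges.pt (congrArg (nerveEquiv (C := Edges hT)) h)
      · intro x
        exact ⟨(nerveEquiv (C := Edges hT) x).pt, nerveEquiv.symm_apply_apply x⟩
    · constructor
      · intro a b h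
        obtain ⟨x₀, x₁, e, rfl⟩ := Edge.exists_of_simplex a
        obtain ⟨y₀, y₁, f, rfl⟩ := Edge.exists_of_simplex b
        rw [hφ, hφ] at h
        exact congrArg (fun (F : ComposableArrows (Edges hT) 1) ↦
          Edge.edge (X := T) (F.map' 0 1)) h
      · intro y
        obtain ⟨x, y, f, rfl⟩ := ComposableArrows.mk₁_surjective y
        exact ⟨Edge.edge (X := T) f, hφ _⟩
  exact ⟨asIso φ⟩

end IsNervelike

end SSet.Truncated

end

/-! ### Finite categories and sequential colimits of categories. -/

section

open Opposite Limits Nerve Simplicial SimplexCategory.Truncated SimplicialObject.Truncated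

/-- The truncated nerve functor preserves sequential colimits. -/
lemma preservesColimit_nerveFunctor₂ (F : ℕ ⥤ Cat.{u, u}) :
    PreservesColimit F nerveFunctor₂.{u, u} := by
  have : HasColimit (F ⋙ nerveFunctor₂.{u, u}) :=
    inferInstanceAs (HasColimit (C := _ ⥤ Type u) (F ⋙ nerveFunctor₂.{u, u}))
  let d : Cocone (F ⋙ nerveFunctor₂.{u, u}) := colimit.cocone _
  have hd : IsColimit d := colimit.isColimit _
  -- The colimit of the truncated nerves is again the nerve of a category. Full faithfulness pulls
  -- the cocone back to categories and reflects its universal property, so the nerve carries some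
  -- colimit cocone, hence every one, to a colimit.
  have hT : d.pt.IsNervelike :=
    .of_isColimit (fun n ↦ SSet.Truncated.isNervelike_nerveFunctor₂ (F.obj n)) hd
  obtain ⟨e⟩ := hT.nonempty_iso
  let c : Cocone F :=
    { pt := _
      ι :=
        { app n := nerveFunctor₂.preimage (d.ι.app n ≫ e.hom)
          naturality n m f := nerveFunctor₂.map_injective (by
            refine Eq.trans ?_ (congrArg nerveFunctor₂.map (Category.comp_id _)).symm
            refine (nerveFunctor₂.map_comp _ _).trans ?_
            rw [nerveFunctor₂.map_preimage, nerveFunctor₂.map_preimage]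
            exact (Category.assoc _ _ _).symm.trans (congrArg (· ≫ e.hom) (d.w f))) } }
  have hc : IsColimit (nerveFunctor₂.mapCocone c) :=
    hd.ofIsoColimit (Cocone.ext e (fun n ↦ (nerveFunctor₂.map_preimage _).symm))
  exact preservesColimit_of_preserves_colimit_cocone
    (isColimitOfReflects nerveFunctor₂.{u, u} hc) hc

instance : Finite (SimplexCategory.Truncated 2) :=
  Finite.of_injective (fun x ↦ (⟨x.obj.len, Nat.lt_succ_of_le x.property⟩ : Fin 3))
    (fun ⟨x, _⟩ ⟨y, _⟩ h ↦ by
      obtain rfl : x = y := SimplexCategory.ext (by simpa using h)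
      rfl)

instance (x y : SimplexCategory.Truncated 2) : Finite (x ⟶ y) :=
  Finite.of_injective (fun f ↦ f.hom) (fun _ _ h ↦ ObjectProperty.hom_ext _ h)

instance : Finite (SimplexCategory.Truncated 2)ᵒᵖ :=
  Finite.of_equiv _ equivToOpposite

instance (x y : (SimplexCategory.Truncated 2)ᵒᵖ) : Finite (x ⟶ y) :=
  Finite.of_equiv _ (opEquiv x y).symm

/-- The nerve of a finite category has finitely many simplices in low dimensions. -/
lemma finite_nerveFunctor₂_obj {P : Cat.{u, u}} (hP : IsFiniteCat P)
    (k : (SimplexCategory.Truncated 2)ᵒᵖ) : Finite ((nerveFunctor₂.obj P).obj k) := by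
  have := hP.finite_obj
  have := hP.finite_hom
  have h₁ : Finite ((nerveFunctor₂.obj P).obj (op ⦋1⦌₂)) :=
    Finite.of_surjective (fun (p : Σ x y : P, (x ⟶ y)) ↦ ComposableArrows.mk₁ p.2.2) (fun y ↦ by
      obtain ⟨x, y, f, rfl⟩ := ComposableArrows.mk₁_surjective y
      exact ⟨⟨x, y, f⟩, rfl⟩)
  obtain ⟨⟨n, hn⟩⟩ := k
  induction n using SimplexCategory.rec with | _ n
  obtain _ | _ | _ | n := n
  · exact Finite.of_equiv _ (nerveEquiv (C := P)).symm
  · exact h₁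
  · exact Finite.of_injective (fun s ↦ ((nerveFunctor₂.obj P).map (δ₂ 2).op s,
      (nerveFunctor₂.obj P).map (δ₂ 0).op s)) (fun s t h ↦
        (SSet.Truncated.isNervelike_nerveFunctor₂ P).ext s t (congrArg Prod.fst h)
          (congrArg Prod.snd h))
  · exact absurd hn (by simp)

/-- Finite categories are finitely presentable with respect to sequential colimits. -/
lemma nonempty_isColimit_coyoneda_of_isFiniteCat {P : Cat.{u, u}} (hP : IsFiniteCat P)
    {F : ℕ ⥤ Cat.{u, u}} {c : Cocone F} (hc : IsColimit c) :
    Nonempty (IsColimit ((coyoneda.obj (op P)).mapCocone c)) := by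
  -- Under the fully faithful truncated nerve, functors out of `P` become morphisms out of a finite
  -- presheaf on a finite category.
  have := preservesColimit_nerveFunctor₂ F
  have hc' := isColimitOfPreserves nerveFunctor₂.{u, u} hc
  have := finite_nerveFunctor₂_obj hP
  refine ⟨Types.FilteredColimit.isColimitOf' _ _ (fun (φ : P ⟶ c.pt) ↦ ?_)
    (fun n (φ : P ⟶ F.obj n) (ψ : P ⟶ F.obj n) h ↦ ?_)⟩
  · obtain ⟨n, ψ, hψ⟩ := hc'.exists_comp_ι_eq (nerveFunctor₂.map φ)
    refine ⟨n, nerveFunctor₂.preimage ψ, nerveFunctor₂.map_injective ?_⟩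
    refine hψ.symm.trans (Eq.trans ?_ (nerveFunctor₂.map_comp _ _).symm)
    rw [nerveFunctor₂.map_preimage]
    rfl
  · have h' : nerveFunctor₂.map φ ≫ (nerveFunctor₂.mapCocone c).ι.app n =
        nerveFunctor₂.map ψ ≫ (nerveFunctor₂.mapCocone c).ι.app n :=
      (nerveFunctor₂.map_comp _ _).symm.trans
        ((congrArg nerveFunctor₂.map h).trans (nerveFunctor₂.map_comp _ _))
    obtain ⟨m, f, hf⟩ := hc'.exists_comp_map_eq h'
    refine ⟨m, f, nerveFunctor₂.map_injective ?_⟩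
    exact (nerveFunctor₂.map_comp _ _).trans (hf.trans (nerveFunctor₂.map_comp _ _).symm)

lemma isFiniteCat_chainCat {I : Cat.{u, u}} (hI : IsFiniteCat I) (n : ℕ) :
    IsFiniteCat (chainCat I n) where
  finite_obj := by
    have := hI.finite_obj
    exact inferInstanceAs (Finite (ULift (Fin (n + 1)) × I))
  finite_hom x y := by
    have := hI.finite_hom
    have : Finite (x.1 ⟶ y.1) :=
      inferInstanceAs (Finite (ULift (ULift (PLift (ULift.down x.1 ≤ ULift.down y.1)))))
    exact inferInstanceAs (Finite ((x.1 ⟶ y.1) × (x.2 ⟶ y.2)))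

/-- Finiteness of `I` makes every `chainCat I n` finite, so the nerve of `Fun(I, -)` commutes with
the sequential colimit. -/
lemma isFunEquiv_of_isColimit {I : Cat.{u, u}} (hI : IsFiniteCat I) {F : ℕ ⥤ Cat.{u, u}}
    (hF : ∀ n, IsFunEquiv I (F.map (homOfLE (Nat.le_succ n)))) {c : Cocone F} (hc : IsColimit c) :
    IsFunEquiv I (c.ι.app 0) := by
  obtain ⟨hc'⟩ := nonempty_isColimit_funNerve (I := I) c
    (fun n ↦ nonempty_isColimit_coyoneda_of_isFiniteCat (isFiniteCat_chainCat hI n) hc)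
  exact SSet.isHtpyEquiv_of_isColimit hc' hF

end

theorem mainTheorem8 (M : ObjectProperty Cat.{u, u})
    (hfin : ∀ I : Cat.{u, u}, M I → IsFiniteCat I)
    (hconn : ∀ I : Cat.{u, u}, M I → IsStronglyConnectedCat I) :
    -- coproducts
    (∀ (J : Type u) (X Y : J → Cat.{u, u}) (f : ∀ j, X j ⟶ Y j),
      (∀ j, IsMEquivalence M (f j)) →
      ∀ (cX : Limits.Cofan X) (cY : Limits.Cofan Y) (_ : Limits.IsColimit cX)
        (_ : Limits.IsColimit cY) (g : cX.pt ⟶ cY.pt),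
        (∀ j, cX.inj j ≫ g = f j ≫ cY.inj j) → IsMEquivalence M g) ∧
    -- finite products
    (∀ (J : Type u) [Finite J] (X Y : J → Cat.{u, u}) (f : ∀ j, X j ⟶ Y j),
      (∀ j, IsMEquivalence M (f j)) →
      ∀ (cX : Limits.Fan X) (cY : Limits.Fan Y) (_ : Limits.IsLimit cX)
        (_ : Limits.IsLimit cY) (g : cX.pt ⟶ cY.pt),
        (∀ j, g ≫ cY.proj j = cX.proj j ≫ f j) → IsMEquivalence M g) ∧
    -- sequential colimits
    (∀ (Y : ℕ ⥤ Cat.{u, u}),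
      (∀ n : ℕ, IsMEquivalence M (Y.map (homOfLE (Nat.le_succ n)))) →
      ∀ (c : Limits.Cocone Y) (_ : Limits.IsColimit c), IsMEquivalence M (c.ι.app 0)) ∧
    -- cobase change along a pushout square in which one leg is a Dwyer map
    (∀ (A B C D : Cat.{u, u}) (k : A ⟶ C) (i : A ⟶ B) (j : C ⟶ D) (h : B ⟶ D),
      IsPushout k i j h → IsMEquivalence M k → (IsDwyerMap i ∨ IsDwyerMap k) →
      IsMEquivalence M h) := by
  refine ⟨fun J X Y f hf cX cY hX hY g hg I hI ↦ ?_, fun J _ X Y f hf cX cY hX hY g hg I hI ↦ ?_,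
    fun Y hY c hc I hI ↦ ?_, fun A B C D k i j h sq hk hik I hI ↦ ?_⟩
  · exact isFunEquiv_of_isColimit_cofan (hconn I hI) (fun j ↦ hf j I hI) hX hY g hg
  · exact isFunEquiv_of_isLimit_fan (fun j ↦ hf j I hI) hX hY g hg
  · exact isFunEquiv_of_isColimit (hfin I hI) (fun n ↦ hY n I hI) hc
  · exact isFunEquiv_of_isPushout_of_isDwyerMap (hconn I hI) sq (hk I hI) hik
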